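/- Let $0<b<1$ and let $E=\{(x,y)\in\mathbb R^2 : x^2+y^2/b^2\le 1\}$ be the ellipse with major axis from $(-1,0)$ to $(1,0)$ and minor half-axis $b$. The set $E$ is compact with $\lambda^2(E)=\pi b$, and the uniform distribution $\mathbb P_E$ in $E$ has support $E$ and the density $f=\frac1{\pi b}1_E$ with respect to Lebesgue measure $\lambda^2$. **(i)** Let $Q_1,\dots,Q_4$ be the open quadrants (numbered anti-clockwise), $E_i=E\cap Q_i$, $a=1$, $B(h)=\{z\in\mathbb R^2:|z|\le a-h\}$, $U(x,\varepsilon)=\{z\in\mathbb R^2:|z-(x,0)|<\varepsilon\}$, $f_a(x)=\sqrt{a^2-x^2}/2$, $g_1(x)=g_2(x)=b\sqrt{1-x^2}$, $g_3(x)=g_4(x)=-b\sqrt{1-x^2}$, $q_1=\dots=q_4=2b$, $p_1=\dots=p_4=\frac1{\pi b}$. Then, for every $\nu\in[0,a)$, the following hold: * (A1) $\operatorname{diam}(E)=2a$, $\inf\{x:(x,y)\in E\}=-a$ and $\sup\{x:(x,y)\in E\}=a$. * (A2) $\operatorname{diam}\big(E\setminus(U(-a,\varepsilon)\cup U(a,\varepsilon))\big)<2a$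 for each $\varepsilon>0$ (with $\operatorname{diam}\emptyset=0$). * (A3) For each $\varepsilon>0$, $\lambda^2(E_i\cap U(a,\varepsilon))>0$ for $i\in\{1,4\}$ and $\lambda^2(E_j\cap U(-a,\varepsilon))>0$ for $j\in\{2,3\}$. * (A4) $g_1\ge0\ge g_4$ are continuous on $[\nu,a]$, $g_2\ge 0\ge g_3$ are continuous on $[-a,-\nu]$, $g_1(a)=g_4(a)=g_2(-a)=g_3(-a)=0$, $E^\circ\cap\{x>\nu\}=\{(x,y):\nu<x<a,\ g_4(x)<y<g_1(x)\}$ and $E^\circ\cap\{x<-\nu\}=\{(x,y):-a<x<-\nu,\ g_3(x)<y<g_2(x)\}$. * (A5) $0<q_i<2$ for each $i$; $g_1/f_a\to q_1$ and $-g_4/f_a\to q_4$ as $x\to a$; $g_2/f_a\to q_2$ and $-g_3/f_a\to q_3$ as $x\to -a$. * (A6) For each $i$ and all sufficiently small $h>0$, $E_i^\circ\cap\{|x|<\nu\}\subset B(h)$, and the graph of $g_i$ (over $[\nu,a]$ for $i\in\{1,4\}$, over $[-a,-\nu]$ for $i\in\{2,3\}$) meets $\partial B(h)$ in exactly one point.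 * (A7) For sufficiently small $\varepsilon>0$, $f$ is continuous on $E\cap U(a,\varepsilon)$ and on $E\cap U(-a,\varepsilon)$; $p_1=p_4=f(a,0)>0$ and $p_2=p_3=f(-a,0)>0$. **(ii)** Put, with $a=1$, $q=2b$ and $p=\frac1{\pi b}$, $$c=\frac{2q\sqrt{2a}}{3\sqrt{4-q^2}},\qquad \sigma=(pc)^{-2/3},\qquad \tau=\frac{3}{2a}\,c .$$ Let $\mathrm{NA}_\infty(\sigma,\tau)$ be the law of the sequence $(Z_{1,m},Z_{2,m})_{m\ge1}$ with $Z_{1,m}=\sigma S_m^{2/3}$, $Z_{2,m}=U_m\,\tau\,\sigma^{1/2}S_m^{1/3}$, $S_m=Y_1+\dots+Y_m$, where $Y_1,Y_2,\dots$ (unit exponential) and $U_1,U_2,\dots$ (uniform on $[0,1]$) are all independent. Let $(Z^i_{1,k},Z^i_{2,k})_{k\ge1}$, $i\in\{1,2,3,4\}$, be independent with law $\mathrm{NA}_\infty(\sigma,\tau)$. Then, almost surely, the minima $$S^{i,j}=\min_{k,l\in\mathbb N}\Big\{Z^i_{1,k}+Z^j_{1,l}+\tfrac a4\big(Z^i_{2,k}-Z^j_{2,l}\big)^2\Big\},\quad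 (i,j)\in\{(1,3),(2,4)\},$$ $$S^{i,j}=\min_{k,l\in\mathbb N}\Big\{Z^i_{1,k}+Z^j_{1,l}+\tfrac a4\big(Z^i_{2,k}+Z^j_{2,l}\big)^2\Big\},\quad (i,j)\in\{(1,2),(3,4)\},$$ are attained. Let $S=\min\{S^{1,2},S^{1,3},S^{2,4},S^{3,4}\}$. * If, for each $n$, $\Phi_n$ is a Poisson process in $\mathbb R^2$ with intensity measure $n\,\mathbb P_E$, and $\operatorname{diam}(\Phi_n)$ is the diameter of its support, then $n^{2/3}\big(2-\operatorname{diam}(\Phi_n)\big)\to S$ in distribution as $n\to\infty$. * If $X_1,X_2,\dots$ are i.i.d. with law $\mathbb P_E$ and $M_n=\max_{1\le i<j\le n}|X_i-X_j|$, then $n^{2/3}(2-M_n)\to S$ in distribution as $n\to\infty$. -/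

import Mathlib

open MeasureTheory ProbabilityTheory Set Filter Topology
open scoped ENNReal

noncomputable section

namespace LargestDistance

/-- The Euclidean plane. -/
abbrev Plane : Type := EuclideanSpace ℝ (Fin 2)

/-! ### Assumptions on a set `E` and a density `f`

The four quadrants, and everything attached to them, are indexed by `Fin 4`; the index `i`
stands for the `(i + 1)`-th quadrant, counted anti-clockwise. -/

/-- The open quadrants of the plane. -/
def quadrant : Fin 4 → Set Plane
  | 0 => {z | 0 < z 0 ∧ 0 < z 1}
  | 1 => {z | z 0 < 0 ∧ 0 < z 1}
  | 2 => {z | z 0 < 0 ∧ z 1 < 0}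
  | 3 => {z | 0 < z 0 ∧ z 1 < 0}

/-- The part of `E` in the open quadrant `i`. -/
def quadrantPart (E : Set Plane) (i : Fin 4) : Set Plane := E ∩ quadrant i

/-- The closed disc centred at the origin with radius `a - h`. -/
def disc (a h : ℝ) : Set Plane := {z | ‖z‖ ≤ a - h}

/-- The open disc of radius `ε` centred at the point `(x, 0)` of the horizontal axis. -/
def axisBall (x ε : ℝ) : Set Plane := {z | ‖z - !₂[x, 0]‖ < ε}

/-- The upper boundary function of the ellipse with horizontal axis of length `2 * a`
and vertical axis of length `a`. -/
def refBoundary (a x : ℝ) : ℝ := √(a ^ 2 - x ^ 2) / 2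

/-- A1: `E` has diameter `2 * a` and extends horizontally exactly from `-a` to `a`. -/
def AssumptionA1 (E : Set Plane) (a : ℝ) : Prop :=
  0 < a ∧ Bornology.IsBounded E ∧ Metric.diam E = 2 * a ∧
    IsGLB ((fun z : Plane => z 0) '' E) (-a) ∧ IsLUB ((fun z : Plane => z 0) '' E) a

/-- A2: the poles `(-a, 0)` and `(a, 0)` are the endpoints of the unique major axis. -/
def AssumptionA2 (E : Set Plane) (a : ℝ) : Prop :=
  ∀ ε > 0, Metric.diam (E \ (axisBall (-a) ε ∪ axisBall a ε)) < 2 * a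

/-- A3: positive area near the poles in each quadrant. -/
def AssumptionA3 (E : Set Plane) (a : ℝ) : Prop :=
  ∀ ε > 0,
    0 < volume (quadrantPart E 0 ∩ axisBall a ε) ∧
    0 < volume (quadrantPart E 1 ∩ axisBall (-a) ε) ∧
    0 < volume (quadrantPart E 2 ∩ axisBall (-a) ε) ∧
    0 < volume (quadrantPart E 3 ∩ axisBall a ε)

/-- The interval on which the `i`-th boundary function lives. -/
def boundaryDomain (a ν : ℝ) : Fin 4 → Set ℝ
  | 0 => Icc ν a
  | 1 => Icc (-a) (-ν)
  | 2 => Icc (-a) (-ν)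
  | 3 => Icc ν a

/-- A4: near the poles the interior of `E` lies between the boundary functions `g i`. -/
def AssumptionA4 (E : Set Plane) (a ν : ℝ) (g : Fin 4 → ℝ → ℝ) : Prop :=
  ν ∈ Ico 0 a ∧
  (∀ i, ContinuousOn (g i) (boundaryDomain a ν i)) ∧
  (∀ x ∈ boundaryDomain a ν 0, 0 ≤ g 0 x) ∧ (∀ x ∈ boundaryDomain a ν 1, 0 ≤ g 1 x) ∧
  (∀ x ∈ boundaryDomain a ν 2, g 2 x ≤ 0) ∧ (∀ x ∈ boundaryDomain a ν 3, g 3 x ≤ 0) ∧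
  g 0 a = 0 ∧ g 3 a = 0 ∧ g 1 (-a) = 0 ∧ g 2 (-a) = 0 ∧
  interior E ∩ {z | ν < z 0} = {z | ν < z 0 ∧ z 0 < a ∧ g 3 (z 0) < z 1 ∧ z 1 < g 0 (z 0)} ∧
  interior E ∩ {z | z 0 < -ν} =
    {z | -a < z 0 ∧ z 0 < -ν ∧ g 2 (z 0) < z 1 ∧ z 1 < g 1 (z 0)}

/-- A5: at the poles the boundary functions behave like those of ellipses that are not
circles. -/
def AssumptionA5 (a : ℝ) (g : Fin 4 → ℝ → ℝ) (q : Fin 4 → ℝ) : Prop :=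
  (∀ i, 0 < q i ∧ q i < 2) ∧
  Tendsto (fun x => g 0 x / refBoundary a x) (𝓝[<] a) (𝓝 (q 0)) ∧
  Tendsto (fun x => -g 3 x / refBoundary a x) (𝓝[<] a) (𝓝 (q 3)) ∧
  Tendsto (fun x => g 1 x / refBoundary a x) (𝓝[>] (-a)) (𝓝 (q 1)) ∧
  Tendsto (fun x => -g 2 x / refBoundary a x) (𝓝[>] (-a)) (𝓝 (q 2))

/-- A6: for small `h > 0`, points of `E` outside `disc a h` are near the poles, and the graph
of each boundary function meets the boundary of `disc a h` in exactly one point. -/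
def AssumptionA6 (E : Set Plane) (a ν : ℝ) (g : Fin 4 → ℝ → ℝ) : Prop :=
  ∀ᶠ h in 𝓝[>] (0 : ℝ), ∀ i,
    interior (quadrantPart E i) ∩ {z | |z 0| < ν} ⊆ disc a h ∧
    ∃! x, x ∈ boundaryDomain a ν i ∧ !₂[x, g i x] ∈ frontier (disc a h)

/-- A7: the density `f` is continuous and positive at the poles, where it takes
the values `p i`. -/
def AssumptionA7 (E : Set Plane) (a : ℝ) (f : Plane → ℝ) (p : Fin 4 → ℝ) : Prop :=
  (∀ᶠ ε in 𝓝[>] (0 : ℝ),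
    ContinuousOn f (E ∩ axisBall a ε) ∧ ContinuousOn f (E ∩ axisBall (-a) ε)) ∧
  p 0 = f !₂[a, 0] ∧ p 3 = f !₂[a, 0] ∧ 0 < f !₂[a, 0] ∧
  p 1 = f !₂[-a, 0] ∧ p 2 = f !₂[-a, 0] ∧ 0 < f !₂[-a, 0]

/-! ### The ellipse and the uniform distribution in it -/

/-- The ellipse with major axis from `(-1, 0)` to `(1, 0)` and minor half-axis `b`. -/
def ellipse (b : ℝ) : Set Plane := {z | z 0 ^ 2 + (z 1 / b) ^ 2 ≤ 1}

/-- The boundary functions `±b√(1 - x²)` of the ellipse. -/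
def ellipseBoundary (b : ℝ) : Fin 4 → ℝ → ℝ
  | 0 => fun x => b * √(1 - x ^ 2)
  | 1 => fun x => b * √(1 - x ^ 2)
  | 2 => fun x => -(b * √(1 - x ^ 2))
  | 3 => fun x => -(b * √(1 - x ^ 2))

/-- The uniform distribution in the ellipse: normalised Lebesgue measure. -/
def uniformEllipse (b : ℝ) : Measure Plane := ProbabilityTheory.cond volume (ellipse b)

/-- The density `1 / (πb)` on the ellipse, `0` outside. -/
def ellipseDensity (b : ℝ) : Plane → ℝ :=
  (ellipse b).indicator fun _ => 1 / (Real.pi * b)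

/-! ### The largest interpoint distance and Poisson processes -/

/-- `M_n`, the largest distance between two of the first `n` points `X 0, …, X (n - 1)`
(a maximum as soon as `2 ≤ n`). -/
def maxDist {Ω : Type*} (X : ℕ → Ω → Plane) (n : ℕ) (ω : Ω) : ℝ :=
  sSup {d : ℝ | ∃ i j : ℕ, i < j ∧ j < n ∧ d = ‖X i ω - X j ω‖}

/-- `Φ` is a Poisson process with intensity measure `μ` under `P`: a random measure whose
value on a measurable set `B` has the Poisson distribution with parameter `μ B`
(is a.s. infinite if `μ B = ∞`), and whose values on disjoint sets are independent. -/
structure IsPoissonProcess {E Ω : Type*} [MeasurableSpace E] [MeasurableSpace Ω]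
    (Φ : Ω → Measure E) (μ : Measure E) (P : Measure Ω) : Prop where
  measurable : Measurable Φ
  hasLaw : ∀ B, MeasurableSet B → μ B ≠ ∞ →
    HasLaw (fun ω => Φ ω B)
      ((poissonMeasure (μ B).toNNReal).map (fun k : ℕ => (k : ℝ≥0∞))) P
  infinite : ∀ B, MeasurableSet B → μ B = ∞ → ∀ᵐ ω ∂P, Φ ω B = ∞
  indep : ∀ (k : ℕ) (B : Fin k → Set E), (∀ i, MeasurableSet (B i)) →
    Pairwise (fun i j => Disjoint (B i) (B j)) → iIndepFun (fun i ω => Φ ω (B i)) P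

/-- The diameter of the support of a (point) measure. -/
def supportDiam (φ : Measure Plane) : ℝ := Metric.diam φ.support

/-! ### The limit -/

/-- The constant `c = 2q√(2a) / (3√(4 - q²))`. -/
def cConst (a q : ℝ) : ℝ := 2 * q * √(2 * a) / (3 * √(4 - q ^ 2))

/-- The constant `σ = (pc)^(-2/3)`. -/
def sigmaConst (a q p : ℝ) : ℝ := (p * cConst a q) ^ (-(2 / 3) : ℝ)

/-- The constant `τ = 3c / (2a)`. -/
def tauConst (a q : ℝ) : ℝ := 3 / (2 * a) * cConst a q

/-- The joint law of independent sequences `Y_1, Y_2, …` (i.i.d. unit exponential) and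
`U_1, U_2, …` (i.i.d. uniform on `[0, 1]`), as a law of the sequence `(Y_m, U_m)`. -/
def expUnifLaw : Measure (ℕ → ℝ × ℝ) :=
  Measure.infinitePi fun _ : ℕ =>
    (expMeasure 1).prod (ProbabilityTheory.cond volume (Icc (0 : ℝ) 1))

/-- `S_1 = Y_1`, …, `S_m = Y_1 + ⋯ + Y_m`; the index `m : ℕ` stands for `m + 1`. -/
def partialSum (y : ℕ → ℝ × ℝ) (m : ℕ) : ℝ := ∑ j ∈ Finset.range (m + 1), (y j).1

/-- The sequence of pairs `(Z_{1,m}, Z_{2,m}) = (σ S_m^(2/3), U_m τ σ^(1/2) S_m^(1/3))`. -/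
def normAngle (σ τ : ℝ) (y : ℕ → ℝ × ℝ) (m : ℕ) : ℝ × ℝ :=
  (σ * partialSum y m ^ (2 / 3 : ℝ),
    (y m).2 * τ * σ ^ (1 / 2 : ℝ) * partialSum y m ^ (1 / 3 : ℝ))

/-- The norm-angle distribution `NA_∞(σ, τ)`. -/
def normAngleLaw (σ τ : ℝ) : Measure (ℕ → ℝ × ℝ) := expUnifLaw.map (normAngle σ τ)

/-- `Z_{1,k} + W_{1,l} + (a/4) (Z_{2,k} - W_{2,l})²`. -/
def termSub (a : ℝ) (z w : ℕ → ℝ × ℝ) (kl : ℕ × ℕ) : ℝ :=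
  (z kl.1).1 + (w kl.2).1 + a / 4 * ((z kl.1).2 - (w kl.2).2) ^ 2

/-- `Z_{1,k} + W_{1,l} + (a/4) (Z_{2,k} + W_{2,l})²`. -/
def termAdd (a : ℝ) (z w : ℕ → ℝ × ℝ) (kl : ℕ × ℕ) : ℝ :=
  (z kl.1).1 + (w kl.2).1 + a / 4 * ((z kl.1).2 + (w kl.2).2) ^ 2

/-- `S^{i,j}` for diagonally opposite quadrants. -/
def minSub (a : ℝ) (z w : ℕ → ℝ × ℝ) : ℝ := ⨅ kl : ℕ × ℕ, termSub a z w kl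

/-- `S^{i,j}` for quadrants on the same side of the horizontal axis. -/
def minAdd (a : ℝ) (z w : ℕ → ℝ × ℝ) : ℝ := ⨅ kl : ℕ × ℕ, termAdd a z w kl

/-- `min {S^{1,2}, S^{1,3}, S^{2,4}, S^{3,4}}`. -/
def limitMin (a : ℝ) (z : Fin 4 → ℕ → ℝ × ℝ) : ℝ :=
  min (min (minAdd a (z 0) (z 1)) (minSub a (z 0) (z 2)))
    (min (minSub a (z 1) (z 3)) (minAdd a (z 2) (z 3)))

/-- The infima in the definition of the limit are attained. -/
def MinimaAttained (a : ℝ) (z : Fin 4 → ℕ → ℝ × ℝ) : Prop :=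
  IsLeast (range (termAdd a (z 0) (z 1))) (minAdd a (z 0) (z 1)) ∧
  IsLeast (range (termSub a (z 0) (z 2))) (minSub a (z 0) (z 2)) ∧
  IsLeast (range (termSub a (z 1) (z 3))) (minSub a (z 1) (z 3)) ∧
  IsLeast (range (termAdd a (z 2) (z 3))) (minAdd a (z 2) (z 3))

end LargestDistance

end

noncomputable section

namespace LargestDistance

/-! ### Convergence in distribution from one-sided comparisons -/

/-! Only neighbourhoods of the two poles matter. With ε = n^(-2/3), a point (x, y) of a given
quadrant is described by u = (1 - |x| - y²/2)/ε and v = |y|/√ε, to leading order its scaled norm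
deficit and scaled angle. The Jacobian is ε√ε = 1/n, so n times the uniform distribution acquires
the constant density p = 1/(πb) on a region that increases, as ε decreases to 0, to {0 < v < τ√u}.
In the limit the points therefore form four independent Poisson processes of intensity p on this
region. NA_∞(σ, τ) is such a process: exponential arrivals with uniform marks are a unit-rate
Poisson process on (0, ∞) × (0, 1), and `normAngleMap` carries it over with the constant Jacobian
(2/3)τσ^(3/2) = 1/p (`expUnifLaw_void`, `normAngleLaw_void`).

For points near opposite poles, 2 - |z - w| is exactly ε times `gap`, which is continuous down to ε
= 0 and equals u + u' + (±v ± v')²/4 there (`gap_localCoord`, `gap_zero`). Since b < 1, two points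
at distance more than 2 - εt lie in boxes at opposite poles whose size in local coordinates does not
depend on ε (`exists_opposite_boxes`).

The passage to the limit compares only void probabilities. The boxes are cut into finitely many
cells; void probabilities of unions of cells determine, by inclusion-exclusion, the law of the set
of occupied cells (`tendsto_occupied_pair`), and this set decides whether the minimum lies below a
given level, up to an error controlled by the mesh. Distribution functions are thus squeezed. The
sampling scheme enters essentially through one property: P(no point in A_n) → e^(-l) whenever
n·P_E(A_n) → l. For Poisson processes the void probability is an exact exponential; for independent
points it is (1 - P_E(A_n))^n. Hence `tendstoInDistribution_limitMin` serves both.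

The geometric assumptions are direct computations with the boundary ±b√(1 - x²). -/

theorem countable_atoms {Ω : Type*} [MeasurableSpace Ω] (P : Measure Ω) [IsProbabilityMeasure P]
    {W : Ω → ℝ} (hW : AEMeasurable W P) : {a : ℝ | P.map W {a} ≠ 0}.Countable := by
  have : IsProbabilityMeasure (P.map W) := Measure.isProbabilityMeasure_map hW
  have := Measure.countable_meas_pos_of_disjoint_iUnion (μ := P.map W) (As := fun a : ℝ => {a})
    (fun a => measurableSet_singleton a)
    (fun a b hab => by simpa [Function.onFun] using hab)
  refine this.mono fun a ha => ?_
  simpa [pos_iff_ne_zero] using ha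

theorem exists_nonatom_between {μ : Measure ℝ} (h : {a : ℝ | μ {a} ≠ 0}.Countable) {x y : ℝ}
    (hxy : x < y) : ∃ a ∈ Ioo x y, μ {a} = 0 := by
  obtain ⟨a, ha, ha'⟩ := (h.dense_compl ℝ).exists_between hxy
  exact ⟨a, ha', by simpa using ha⟩

/-- If the distribution functions are asymptotically squeezed between shifted copies of a limit
distribution function, then there is convergence in distribution. -/
theorem tendstoInDistribution_of_squeeze {Ω : ℕ → Type*} [∀ n, MeasurableSpace (Ω n)]
    {P : (n : ℕ) → Measure (Ω n)} [∀ n, IsProbabilityMeasure (P n)] {Ω' : Type*}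
    [MeasurableSpace Ω'] {P' : Measure Ω'} [IsProbabilityMeasure P'] {W : (n : ℕ) → Ω n → ℝ}
    {W' : Ω' → ℝ} (hW : ∀ n, AEMeasurable (W n) (P n)) (hW' : AEMeasurable W' P')
    (hup : ∀ s t, s < t → ∀ c, P'.real {ω | W' ω < t} < c →
      ∀ᶠ n in atTop, (P n).real {ω | W n ω < s} < c)
    (hlow : ∀ s t, s < t → ∀ c, c < P'.real {ω | W' ω < s} →
      ∀ᶠ n in atTop, c < (P n).real {ω | W n ω < t}) :
    TendstoInDistribution W atTop W' P P' := by
  refine ⟨hW, hW', ?_⟩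
  have hcount := countable_atoms P' hW'
  have : IsProbabilityMeasure (P'.map W') := Measure.isProbabilityMeasure_map hW'
  have (n : ℕ) : IsProbabilityMeasure ((P n).map (W n)) := Measure.isProbabilityMeasure_map (hW n)
  have hreal (n : ℕ) (a : ℝ) : ((P n).map (W n)).real (Iio a) = (P n).real {ω | W n ω < a} :=
    map_measureReal_apply_of_aemeasurable (hW n) measurableSet_Iio
  have hreal' (a : ℝ) : (P'.map W').real (Iio a) = P'.real {ω | W' ω < a} :=
    map_measureReal_apply_of_aemeasurable hW' measurableSet_Iio
  simp_rw [← hreal, ← hreal'] at hup hlow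
  set μ := P'.map W' with hμ
  -- At a non-atom, the masses of `Iio (a - 1/(k+1))` and `Iio (a + 1/(k+1))` have the same limit,
  -- which absorbs the gap between `s` and `t` in the hypotheses.
  have hIio (a : ℝ) (ha : μ {a} = 0) :
      Tendsto (fun n => ((P n).map (W n)).real (Iio a)) atTop (𝓝 (μ.real (Iio a))) := by
    refine tendsto_order.2 ⟨fun c hc => ?_, fun c hc => ?_⟩
    · have h1 : Tendsto (fun k : ℕ => μ (Iio (a - 1 / ((k : ℝ) + 1)))) atTop (𝓝 (μ (Iio a))) := by
        have hun : Iio a = ⋃ k : ℕ, Iio (a - 1 / ((k : ℝ) + 1)) := by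
          ext x
          simp only [mem_Iio, mem_iUnion]
          refine ⟨fun hx => ?_, fun ⟨k, hk⟩ => ?_⟩
          · obtain ⟨k, hk⟩ := exists_nat_one_div_lt (sub_pos.2 hx)
            exact ⟨k, by linarith⟩
          · have : (0 : ℝ) < 1 / ((k : ℝ) + 1) := by positivity
            linarith
        rw [hun]
        refine tendsto_measure_iUnion_atTop fun k l hkl => Iio_subset_Iio ?_
        have : (k : ℝ) ≤ l := by exact_mod_cast hkl
        have := one_div_le_one_div_of_le (by positivity : (0 : ℝ) < (k : ℝ) + 1)
          (by linarith : (k : ℝ) + 1 ≤ (l : ℝ) + 1)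
        linarith
      have h2 := (ENNReal.tendsto_toReal (measure_ne_top μ _)).comp h1
      obtain ⟨k, hk⟩ := ((tendsto_order.1 h2).1 c hc).exists
      exact hlow _ a (by have : (0 : ℝ) < 1 / ((k : ℝ) + 1) := by positivity
                         linarith) c hk
    · have h1 : Tendsto (fun k : ℕ => μ (Iio (a + 1 / ((k : ℝ) + 1)))) atTop (𝓝 (μ (Iic a))) := by
        have hun : Iic a = ⋂ k : ℕ, Iio (a + 1 / ((k : ℝ) + 1)) := by
          ext x
          simp only [mem_Iio, mem_Iic, mem_iInter]
          refine ⟨fun hx k => ?_, fun h => ?_⟩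
          · have : (0 : ℝ) < 1 / ((k : ℝ) + 1) := by positivity
            linarith
          · by_contra! hx
            obtain ⟨k, hk⟩ := exists_nat_one_div_lt (sub_pos.2 hx)
            linarith [h k]
        rw [hun]
        refine tendsto_measure_iInter_atTop (fun k => measurableSet_Iio.nullMeasurableSet)
          (fun k l hkl => Iio_subset_Iio ?_) ⟨0, measure_ne_top μ _⟩
        have : (k : ℝ) ≤ l := by exact_mod_cast hkl
        have := one_div_le_one_div_of_le (by positivity : (0 : ℝ) < (k : ℝ) + 1)
          (by linarith : (k : ℝ) + 1 ≤ (l : ℝ) + 1)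
        linarith
      have h3 : μ (Iic a) = μ (Iio a) := by
        refine le_antisymm ?_ (measure_mono Iio_subset_Iic_self)
        rw [← Iio_union_right]
        exact (measure_union_le _ _).trans (by rw [ha, add_zero])
      rw [h3] at h1
      have h2 := (ENNReal.tendsto_toReal (measure_ne_top μ _)).comp h1
      obtain ⟨k, hk⟩ := ((tendsto_order.1 h2).2 c hc).exists
      exact hup a _ (by have : (0 : ℝ) < 1 / ((k : ℝ) + 1) := by positivity
                        linarith) c hk
  -- Half-open intervals with non-atomic endpoints are closed under intersection and contain
  -- arbitrarily small neighbourhoods of each point, because atoms are countable; so they determine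
  -- weak convergence.
  refine IsPiSystem.tendsto_probabilityMeasure_of_tendsto_of_mem
    (S := {s | ∃ a b, μ {a} = 0 ∧ μ {b} = 0 ∧ s = Ico a b}) ?_ ?_ ?_ ?_
  · rintro _ ⟨a, b, ha, hb, rfl⟩ _ ⟨a', b', ha', hb', rfl⟩ -
    refine ⟨max a a', min b b', ?_, ?_, Ico_inter_Ico⟩
    · rcases max_choice a a' with h | h <;> rwa [h]
    · rcases min_choice b b' with h | h <;> rwa [h]
  · rintro _ ⟨a, b, -, -, rfl⟩
    exact measurableSet_Ico
  · intro u hu x hx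
    obtain ⟨ε, hε, hball⟩ := Metric.isOpen_iff.1 hu x hx
    obtain ⟨a, ha, ha0⟩ := exists_nonatom_between hcount (show x - ε < x by linarith)
    obtain ⟨b, hb, hb0⟩ := exists_nonatom_between hcount (show x < x + ε by linarith)
    refine ⟨Ico a b, ⟨a, b, ha0, hb0, rfl⟩, Ico_mem_nhds ha.2 hb.1, fun y hy => hball ?_⟩
    rw [Real.ball_eq_Ioo]
    exact ⟨ha.1.trans_le hy.1, hy.2.trans hb.2⟩
  · rintro _ ⟨a, b, ha, hb, rfl⟩
    rcases le_total b a with hab | hab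
    · simp [Ico_eq_empty (not_lt.2 hab)]
    have key (ν : Measure ℝ) [IsProbabilityMeasure ν] :
        ν.real (Ico a b) = ν.real (Iio b) - ν.real (Iio a) := by
      rw [← measureReal_sdiff (Iio_subset_Iio hab) measurableSet_Iio]
      congr 1
      ext x
      simp
    have h := (hIio b hb).sub (hIio a ha)
    simp_rw [← key] at h
    rw [← NNReal.tendsto_coe]
    exact h

/-! ### Finite occupancy vectors -/

/-- Void events form a π-system, since the intersection of those of `J` and `J'` is that of `J ∪
J'`. The complement of the event in question is a finite union of void events, so
inclusion-exclusion transfers the convergence. -/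
theorem tendsto_occupied_pair {ι : Type*} [Fintype ι] {Ω : ℕ → Type*}
    [∀ n, MeasurableSpace (Ω n)] {P : (n : ℕ) → Measure (Ω n)} [∀ n, IsProbabilityMeasure (P n)]
    {Ω' : Type*} [MeasurableSpace Ω'] {P' : Measure Ω'} [IsProbabilityMeasure P']
    {χ : (n : ℕ) → Ω n → ι → Prop} {χ' : Ω' → ι → Prop}
    (hχ : ∀ n, AEMeasurable (χ n) (P n)) (hχ' : AEMeasurable χ' P')
    (h : ∀ J : Finset ι, Tendsto (fun n => (P n).real {ω | ∀ i ∈ J, ¬ χ n ω i}) atTop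
      (𝓝 (P'.real {ω | ∀ i ∈ J, ¬ χ' ω i}))) (R : ι → ι → Prop) :
    Tendsto (fun n => (P n).real {ω | ∃ i j, R i j ∧ χ n ω i ∧ χ n ω j}) atTop
      (𝓝 (P'.real {ω | ∃ i j, R i j ∧ χ' ω i ∧ χ' ω j})) := by
  classical
  have hmeas (s : Set (ι → Prop)) : MeasurableSet s := s.toFinite.measurableSet
  let V : Finset ι → Set (ι → Prop) := fun J => {x | ∀ i ∈ J, ¬ x i}
  have hpi : IsPiSystem (range V) := by
    rintro _ ⟨J, rfl⟩ _ ⟨J', rfl⟩ -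
    refine ⟨J ∪ J', ?_⟩
    ext x
    simp only [V, mem_ofPred_eq, Finset.mem_union, mem_inter_iff]
    grind
  have (n : ℕ) : IsProbabilityMeasure ((P n).map (χ n)) := Measure.isProbabilityMeasure_map (hχ n)
  have : IsProbabilityMeasure (P'.map χ') := Measure.isProbabilityMeasure_map hχ'
  -- No related pair is occupied exactly when the empty indices contain a vertex cover of `R`.
  have hun : {x : ι → Prop | ∃ i j, R i j ∧ x i ∧ x j}ᶜ =
      ⋃ s ∈ (Finset.univ.filter fun J : Finset ι => ∀ i j, R i j → i ∈ J ∨ j ∈ J).image V, s := by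
    ext x
    simp only [mem_compl_iff, mem_ofPred_eq, mem_iUnion, Finset.mem_image, Finset.mem_filter,
      Finset.mem_univ, true_and, exists_prop]
    constructor
    · intro hx
      refine ⟨_, ⟨Finset.univ.filter fun i => ¬ x i, ?_, rfl⟩, ?_⟩
      · intro i j hij
        simp only [Finset.mem_filter, Finset.mem_univ, true_and]
        by_contra! hc
        exact hx ⟨i, j, hij, hc.1, hc.2⟩
      · simp [V]
    · rintro ⟨_, ⟨J, hJ, rfl⟩, hx⟩ ⟨i, j, hij, hi, hj⟩
      rcases hJ i j hij with h | h
      · exact hx i h hi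
      · exact hx j h hj
  have hlim := hpi.tendsto_measureReal_biUnion (μ := fun n => (P n).map (χ n)) (ν := P'.map χ')
    (l := atTop)
    (t := (Finset.univ.filter fun J : Finset ι => ∀ i j, R i j → i ∈ J ∨ j ∈ J).image V)
    (fun s hs => by
      obtain ⟨J, -, rfl⟩ := Finset.mem_image.1 hs
      exact ⟨J, rfl⟩)
    (fun s _ => hmeas s)
    (by
      rintro _ ⟨J, rfl⟩
      simp_rw [fun n => map_measureReal_apply_of_aemeasurable (hχ n) (hmeas (V J))]
      rw [map_measureReal_apply_of_aemeasurable hχ' (hmeas (V J))]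
      exact h J)
  rw [← hun] at hlim
  simp_rw [probReal_compl_eq_one_sub (hmeas _)] at hlim
  have := hlim.const_sub 1
  simp only [sub_sub_cancel] at this
  simp_rw [fun n => map_measureReal_apply_of_aemeasurable (hχ n)
    (hmeas {x : ι → Prop | ∃ i j, R i j ∧ x i ∧ x j})] at this
  rw [map_measureReal_apply_of_aemeasurable hχ'
    (hmeas {x : ι → Prop | ∃ i j, R i j ∧ x i ∧ x j})] at this
  exact this

/-! ### The renewal identity for the exponential distribution -/

section Renewal

variable {α : ℝ → ℝ} {T : ℝ}

theorem locallyIntegrable_of_unit_bounded (hα : Measurable α) (h0 : ∀ s, 0 ≤ α s)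
    (h1 : ∀ s, α s ≤ 1) : LocallyIntegrable α := by
  refine (locallyIntegrable_const (1 : ℝ)).mono hα.aestronglyMeasurable
    (ae_of_all _ fun s => ?_)
  rw [Real.norm_of_nonneg (h0 s), norm_one]
  exact h1 s

theorem intervalIntegrable_of_unit_bounded (hα : Measurable α) (h0 : ∀ s, 0 ≤ α s)
    (h1 : ∀ s, α s ≤ 1) (a b : ℝ) : IntervalIntegrable α volume a b :=
  intervalIntegrable_iff.2 <| ((locallyIntegrable_of_unit_bounded hα h0 h1).integrableOn_isCompact
    isCompact_uIcc).mono_set uIoc_subset_uIcc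

theorem integrableOn_Ioi_of_unit_bounded (hα : Measurable α) (h0 : ∀ s, 0 ≤ α s)
    (h1 : ∀ s, α s ≤ 1) (hT : ∀ s, T < s → α s = 0) (x : ℝ) : IntegrableOn α (Ioi x) := by
  have h : IntegrableOn α (Ioc x T) :=
    ((locallyIntegrable_of_unit_bounded hα h0 h1).integrableOn_isCompact
      isCompact_Icc).mono_set Ioc_subset_Icc_self
  have h' : IntegrableOn α (Ioi T) :=
    (integrableOn_zero (μ := volume)).congr_fun (fun s hs => (hT s hs).symm) measurableSet_Ioi
  refine (h.union h').mono_set fun s hs => ?_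
  rcases le_or_gt s T with h | h
  · exact Or.inl ⟨hs, h⟩
  · exact Or.inr h

/-- Lipschitz continuity yields absolute continuity, so the fundamental theorem of calculus is
available although `β` is merely measurable and its primitive is differentiable only almost
everywhere. -/
theorem lipschitz_exp_neg_integral {β : ℝ → ℝ} (hβ : Measurable β) (h0 : ∀ s, 0 ≤ β s)
    (h1 : ∀ s, β s ≤ 1) (x M : ℝ) (hxM : x ≤ M) :
    LipschitzOnWith 1 (fun s => -Real.exp (-∫ r in x..s, β r)) (uIcc x M) := by
  have hint := intervalIntegrable_of_unit_bounded hβ h0 h1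
  have key : ∀ s ∈ Icc x M, ∀ t ∈ Icc x M, s ≤ t →
      |(-Real.exp (-∫ r in x..s, β r)) - (-Real.exp (-∫ r in x..t, β r))| ≤ t - s := by
    intro s hs t ht hst
    have e1 : ∫ r in x..t, β r = (∫ r in x..s, β r) + ∫ r in s..t, β r :=
      (intervalIntegral.integral_add_adjacent_intervals (hint _ _) (hint _ _)).symm
    have e2 : 0 ≤ ∫ r in x..s, β r := intervalIntegral.integral_nonneg hs.1 fun r _ => h0 r
    have e3 : 0 ≤ ∫ r in s..t, β r := intervalIntegral.integral_nonneg hst fun r _ => h0 r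
    have e4 : ∫ r in s..t, β r ≤ t - s := by
      calc ∫ r in s..t, β r ≤ ∫ r in s..t, (1 : ℝ) :=
            intervalIntegral.integral_mono_on hst (hint _ _) (by simp) fun r _ => h1 r
        _ = t - s := by simp
    rw [e1, neg_add, Real.exp_add]
    set A := Real.exp (-∫ r in x..s, β r)
    have hA0 : 0 < A := Real.exp_pos _
    have hA1 : A ≤ 1 := Real.exp_le_one_iff.2 (by linarith)
    have hB := Real.add_one_le_exp (-∫ r in s..t, β r)
    have hB1 : Real.exp (-∫ r in s..t, β r) ≤ 1 := Real.exp_le_one_iff.2 (by linarith)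
    rw [abs_le]
    constructor <;> nlinarith
  rw [uIcc_of_le hxM]
  refine LipschitzOnWith.of_dist_le_mul fun s hs t ht => ?_
  rw [NNReal.coe_one, one_mul, Real.dist_eq, Real.dist_eq]
  rcases le_total s t with h | h
  · rw [abs_sub_comm s t, abs_of_nonneg (sub_nonneg.2 h)]
    exact key s hs t ht h
  · rw [abs_sub_comm, abs_of_nonneg (sub_nonneg.2 h)]
    exact key t ht s hs h

theorem integral_mul_exp_neg_integral {β : ℝ → ℝ} (hβ : Measurable β) (h0 : ∀ s, 0 ≤ β s)
    (h1 : ∀ s, β s ≤ 1) (x M : ℝ) (hxM : x ≤ M) :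
    ∫ s in x..M, β s * Real.exp (-∫ r in x..s, β r) = 1 - Real.exp (-∫ r in x..M, β r) := by
  have h := (lipschitz_exp_neg_integral hβ h0 h1 x M
    hxM).absolutelyContinuousOnInterval.integral_deriv_eq_sub
  simp only [intervalIntegral.integral_same, neg_zero, Real.exp_zero] at h
  rw [show (1 : ℝ) - Real.exp (-∫ r in x..M, β r) = -Real.exp (-∫ r in x..M, β r) - -1 by ring, ← h]
  refine intervalIntegral.integral_congr_ae ?_
  filter_upwards [_root_.LocallyIntegrable.ae_hasDerivAt_integral
    (locallyIntegrable_of_unit_bounded hβ h0 h1)] with s hs _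
  have := ((hs x).neg.exp).neg
  rw [HasDerivAt.deriv (f := fun s => -Real.exp (-∫ r in x..s, β r)) this]
  simp only [Pi.neg_apply]
  ring

/-- This is the first-step equation of a void probability. If an arrival at time `s` hits with
probability `α s`, then v(x) = exp(-∫ₓ^∞ α) solves v(x) = E[(1 - α(x + Y)) v(x + Y)] for a unit
exponential Y. After shifting by `x`, the integrand is an exact derivative as long as `α` may be
nonzero, and a pure exponential afterwards. -/
theorem renewal_identity (hα : Measurable α) (h0 : ∀ s, 0 ≤ α s)
    (h1 : ∀ s, α s ≤ 1) (hT : ∀ s, T < s → α s = 0) (x : ℝ) :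
    IntegrableOn (fun y => Real.exp (-y) *
        ((1 - α (x + y)) * Real.exp (-∫ r in Ioi (x + y), α r))) (Ioi 0) ∧
    ∫ y in Ioi 0, Real.exp (-y) * ((1 - α (x + y)) * Real.exp (-∫ r in Ioi (x + y), α r)) =
      Real.exp (-∫ r in Ioi x, α r) := by
  have hI := integrableOn_Ioi_of_unit_bounded hα h0 h1 hT
  set M := max x T
  have hβ : Measurable fun s => 1 - α s := measurable_const.sub hα
  have hβ0 (s : ℝ) : 0 ≤ 1 - α s := by linarith [h1 s]
  have hβ1 (s : ℝ) : 1 - α s ≤ 1 := by linarith [h0 s]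
  have hint := intervalIntegrable_of_unit_bounded hα h0 h1
  let f : ℝ → ℝ := fun s => Real.exp (-s) * ((1 - α s) * Real.exp (-∫ r in Ioi s, α r))
  set C := Real.exp (-x) * Real.exp (-∫ r in Ioi x, α r) with hC
  -- The factor exp(-(s - x)) and the part of the tail integral between `x` and `s` merge into the
  -- exponential of -∫(1 - α), whose derivative supplies the factor 1 - α.
  have hf (s : ℝ) : f s = C * ((1 - α s) * Real.exp (-∫ r in x..s, 1 - α r)) := by
    have e1 : ∫ r in x..s, (1 - α r) = (s - x) - ∫ r in x..s, α r := by
      rw [intervalIntegral.integral_sub (by simp) (hint _ _)]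
      simp
    have e2 := intervalIntegral.integral_interval_add_Ioi (hI x) (hI s)
    simp only [f, hC]
    rw [e1, ← e2]
    have : Real.exp (-x) * Real.exp (-((∫ r in x..s, α r) + ∫ r in Ioi s, α r)) *
        Real.exp (-(s - x - ∫ r in x..s, α r)) = Real.exp (-s) * Real.exp (-∫ r in Ioi s, α r) := by
      rw [← Real.exp_add, ← Real.exp_add, ← Real.exp_add]
      congr 1
      ring
    linear_combination -(1 - α s) * this
  have hzero : ∀ s, M ≤ s → ∫ r in Ioi s, α r = 0 := fun s hs =>
    setIntegral_eq_zero_of_forall_eq_zero fun r hr =>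
      hT r (((le_max_right x T).trans hs).trans_lt hr)
  have hfM : ∀ s ∈ Ioi M, f s = Real.exp (-s) := by
    intro s hs
    simp only [f]
    rw [hzero s (le_of_lt hs), hT s ((le_max_right x T).trans_lt hs)]
    simp
  have hcont : Continuous fun s => ∫ r in x..s, (1 - α r) := by
    refine intervalIntegral.continuous_primitive (fun a b => ?_) x
    exact intervalIntegrable_of_unit_bounded hβ hβ0 hβ1 a b
  have hif1 : IntegrableOn f (Ioc x M) := by
    have : f = fun s => C * ((1 - α s) * Real.exp (-∫ r in x..s, 1 - α r)) := funext hf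
    rw [this]
    refine Integrable.const_mul ?_ C
    refine Integrable.mul_bdd (c := Real.exp 0) ?_ (by fun_prop) ?_
    · exact ((locallyIntegrable_of_unit_bounded hβ hβ0 hβ1).integrableOn_isCompact
        isCompact_Icc).mono_set Ioc_subset_Icc_self
    · refine (ae_restrict_iff' measurableSet_Ioc).2 (ae_of_all _ fun s hs => ?_)
      rw [Real.norm_of_nonneg (Real.exp_pos _).le]
      refine Real.exp_le_exp.2 (neg_nonpos.2 ?_)
      exact intervalIntegral.integral_nonneg hs.1.le fun r _ => hβ0 r
  have hif2 : IntegrableOn f (Ioi M) :=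
    (integrableOn_congr_fun hfM measurableSet_Ioi).2 (integrableOn_exp_neg_Ioi M)
  have hif : IntegrableOn f (Ioi x) := by
    rw [← Ioc_union_Ioi_eq_Ioi (le_max_left x T)]
    exact hif1.union hif2
  have hval : ∫ s in Ioi x, f s = C := by
    rw [← intervalIntegral.integral_interval_add_Ioi hif hif2,
      setIntegral_congr_fun measurableSet_Ioi hfM, integral_exp_neg_Ioi]
    simp_rw [hf]
    rw [intervalIntegral.integral_const_mul,
      integral_mul_exp_neg_integral hβ hβ0 hβ1 x M (le_max_left x T)]
    have e1 : ∫ r in x..M, (1 - α r) = (M - x) - ∫ r in x..M, α r := by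
      rw [intervalIntegral.integral_sub (by simp) (hint _ _)]
      simp
    have e2 := intervalIntegral.integral_interval_add_Ioi (hI x) (hI M)
    rw [hzero M le_rfl, add_zero] at e2
    have : C * Real.exp (-∫ r in x..M, 1 - α r) = Real.exp (-M) := by
      rw [e1, hC, ← e2, ← Real.exp_add, ← Real.exp_add]
      congr 1
      ring
    linear_combination -this
  have hshift (y : ℝ) : Real.exp (-y) * ((1 - α (x + y)) * Real.exp (-∫ r in Ioi (x + y), α r)) =
      Real.exp x * f (x + y) := by
    simp only [f]
    rw [neg_add, Real.exp_add]
    have : Real.exp x * Real.exp (-x) = 1 := by rw [← Real.exp_add]; simp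
    linear_combination (-Real.exp (-y) * ((1 - α (x + y)) *
      Real.exp (-∫ r in Ioi (x + y), α r))) * this
  have hmp : MeasurePreserving (fun y : ℝ => x + y) := measurePreserving_add_left volume x
  have hemb : MeasurableEmbedding (fun y : ℝ => x + y) := measurableEmbedding_addLeft x
  have hpre : (fun y : ℝ => x + y) ⁻¹' Ioi x = Ioi 0 := by ext; simp
  simp_rw [hshift]
  constructor
  · refine Integrable.const_mul ?_ _
    have := (hmp.integrableOn_comp_preimage hemb (f := f) (s := Ioi x)).2 hif
    rwa [hpre] at this
  · rw [integral_const_mul, ← hpre, hmp.setIntegral_preimage_emb hemb f (Ioi x), hval, hC,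
      ← mul_assoc, ← Real.exp_add]
    simp

end Renewal

theorem lintegral_expMeasure_one {f : ℝ → ℝ≥0∞} (hf : Measurable f) :
    ∫⁻ y, f y ∂(expMeasure 1) = ∫⁻ y in Ioi 0, ENNReal.ofReal (Real.exp (-y)) * f y := by
  have h1 : expMeasure 1 = volume.withDensity (exponentialPDF 1) := rfl
  have hm : Measurable (exponentialPDF 1) := (measurable_exponentialPDFReal 1).ennreal_ofReal
  rw [h1, lintegral_withDensity_eq_lintegral_mul _ hm hf, ← lintegral_indicator measurableSet_Ioi]
  have h0 : ∀ᵐ y : ℝ, y ≠ 0 := Measure.ae_ne volume 0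
  refine lintegral_congr_ae ?_
  filter_upwards [h0] with y hy
  simp only [Pi.mul_apply]
  rcases lt_or_gt_of_ne hy with h | h
  · rw [exponentialPDF_of_neg h, indicator_of_notMem (by simpa using h.le), zero_mul]
  · rw [exponentialPDF_of_nonneg h.le, indicator_of_mem (by simpa using h)]
    simp

/-! ### Void probabilities of marked arrival times -/

/-- The uniform distribution on the unit interval. -/
def unitUniform : Measure ℝ := ProbabilityTheory.cond volume (Icc (0 : ℝ) 1)

theorem unitUniform_eq : unitUniform = volume.restrict (Icc 0 1) := by
  simp [unitUniform, ProbabilityTheory.cond]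

instance : IsProbabilityMeasure unitUniform := ⟨by simp [unitUniform_eq]⟩

instance : IsProbabilityMeasure (expMeasure 1) := isProbabilityMeasure_expMeasure one_pos

/-- The joint law of a waiting time and a mark. -/
def stepLaw : Measure (ℝ × ℝ) := (expMeasure 1).prod unitUniform

instance : IsProbabilityMeasure stepLaw := by unfold stepLaw; infer_instance

theorem expUnifLaw_eq : expUnifLaw = Measure.infinitePi fun _ : ℕ => stepLaw := rfl

instance : IsProbabilityMeasure expUnifLaw := by rw [expUnifLaw_eq]; infer_instance

/-- Prepend an element to a sequence. -/
def consSeq {X : Type*} (p : X × (ℕ → X)) : ℕ → X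
  | 0 => p.1
  | m + 1 => p.2 m

theorem measurable_consSeq {X : Type*} [MeasurableSpace X] :
    Measurable (consSeq : X × (ℕ → X) → ℕ → X) := by
  refine measurable_pi_iff.2 fun m => ?_
  cases m with
  | zero => exact measurable_fst
  | succ m => exact (measurable_pi_apply m).comp measurable_snd

/-- An i.i.d. sequence is a first term followed by an independent copy of itself. This gives the
conditioning on the first arrival. -/
theorem map_consSeq_infinitePi {X : Type*} [MeasurableSpace X] (μ : Measure X)
    [IsProbabilityMeasure μ] :
    (μ.prod (Measure.infinitePi fun _ : ℕ => μ)).map consSeq =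
      Measure.infinitePi fun _ : ℕ => μ := by
  refine Measure.eq_infinitePi _ fun s t ht => ?_
  classical
  obtain ⟨N, hN⟩ : ∃ N, s ⊆ Finset.range (N + 1) := by
    obtain ⟨N, hN⟩ := s.exists_nat_subset_range
    exact ⟨N, hN.trans (Finset.range_subset_range.2 N.le_succ)⟩
  -- Padding with `univ` turns the finite index set into an initial segment, which splits into the
  -- index 0 and a shifted segment.
  set t' : ℕ → Set X := fun i => if i ∈ s then t i else univ with ht'
  have hmt' (i : ℕ) : MeasurableSet (t' i) := by
    simp only [ht']
    split_ifs
    exacts [ht i, .univ]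
  have hpre : consSeq ⁻¹' (Set.pi s t) =
      t' 0 ×ˢ Set.pi (Finset.range N : Set ℕ) (fun i => t' (i + 1)) := by
    ext ⟨x, y⟩
    simp only [mem_preimage, Set.mem_pi, Finset.mem_coe, mem_prod, Finset.mem_range, ht']
    constructor
    · intro h
      refine ⟨?_, fun i _ => ?_⟩
      · split_ifs with h0
        exacts [h 0 h0, trivial]
      · split_ifs with h0
        exacts [h _ h0, trivial]
    · rintro ⟨h0, h1⟩ i hi
      cases i with
      | zero => simpa [hi, consSeq] using h0
      | succ i =>
        have := h1 i (by simpa using hN hi)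
        simpa [hi, consSeq] using this
  rw [Measure.map_apply measurable_consSeq (.pi s.countable_toSet fun i _ => ht i), hpre,
    Measure.prod_prod, Measure.infinitePi_pi _ fun i _ => hmt' _, mul_comm,
    ← Finset.prod_range_succ' (fun i => μ (t' i)), ← Finset.prod_subset hN]
  · refine Finset.prod_congr rfl fun i hi => ?_
    simp [ht', hi]
  · intro i _ hi
    simp [ht', hi]

theorem lintegral_expUnifLaw {f : (ℕ → ℝ × ℝ) → ℝ≥0∞} (hf : Measurable f) :
    ∫⁻ y, f y ∂expUnifLaw = ∫⁻ p, ∫⁻ y, f (consSeq (p, y)) ∂expUnifLaw ∂stepLaw := by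
  conv_lhs => rw [expUnifLaw_eq, ← map_consSeq_infinitePi, lintegral_map hf measurable_consSeq]
  exact lintegral_prod _ (hf.comp measurable_consSeq).aemeasurable

/-- The sum of the first `m` waiting times. -/
def arrival (m : ℕ) (y : ℕ → ℝ × ℝ) : ℝ := ∑ j ∈ Finset.range m, (y j).1

theorem measurable_arrival (m : ℕ) : Measurable (arrival m) := by
  unfold arrival
  fun_prop

theorem partialSum_eq_arrival (y : ℕ → ℝ × ℝ) (m : ℕ) : partialSum y m = arrival (m + 1) y := rfl

theorem measurable_partialSum (m : ℕ) : Measurable fun y => partialSum y m :=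
  measurable_arrival (m + 1)

theorem arrival_succ_consSeq (m : ℕ) (p : ℝ × ℝ) (y : ℕ → ℝ × ℝ) :
    arrival (m + 1) (consSeq (p, y)) = p.1 + arrival m y := by
  unfold arrival
  rw [Finset.sum_range_succ', add_comm]
  rfl

theorem lintegral_exp_neg_arrival (m : ℕ) :
    ∫⁻ y, ENNReal.ofReal (Real.exp (-arrival m y)) ∂expUnifLaw = (2⁻¹ : ℝ≥0∞) ^ m := by
  induction m with
  | zero => simp [arrival]
  | succ m ih =>
    have hm : Measurable fun y => ENNReal.ofReal (Real.exp (-arrival (m + 1) y)) :=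
      (Real.measurable_exp.comp (measurable_arrival _).neg).ennreal_ofReal
    rw [lintegral_expUnifLaw hm]
    simp_rw [arrival_succ_consSeq, neg_add, Real.exp_add,
      ENNReal.ofReal_mul (Real.exp_pos _).le]
    have (p : ℝ × ℝ) : ∫⁻ y, ENNReal.ofReal (Real.exp (-p.1)) *
        ENNReal.ofReal (Real.exp (-arrival m y)) ∂expUnifLaw =
        ENNReal.ofReal (Real.exp (-p.1)) * (2⁻¹ : ℝ≥0∞) ^ m := by
      have hme : Measurable fun y => ENNReal.ofReal (Real.exp (-arrival m y)) :=
        (Real.measurable_exp.comp (measurable_arrival _).neg).ennreal_ofReal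
      rw [lintegral_const_mul _ hme, ih]
    simp_rw [this]
    have hme : Measurable fun y : ℝ => ENNReal.ofReal (Real.exp (-y)) := by fun_prop
    rw [lintegral_mul_const _ (by fun_prop), pow_succ, mul_comm, stepLaw,
      lintegral_prod _ (by fun_prop)]
    congr 1
    simp only [lintegral_const, measure_univ, mul_one]
    rw [lintegral_expMeasure_one hme]
    simp_rw [← ENNReal.ofReal_mul (Real.exp_pos _).le, ← Real.exp_add]
    have h2 (y : ℝ) : -y + -y = -2 * y := by ring
    simp_rw [h2]
    rw [← ofReal_integral_eq_lintegral_ofReal (integrableOn_exp_mul_Ioi (by norm_num) 0)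
      (ae_of_all _ fun y => (Real.exp_pos _).le), integral_exp_mul_Ioi (by norm_num)]
    rw [← ENNReal.ofReal_ofNat, ← ENNReal.ofReal_inv_of_pos (by norm_num)]
    congr 1
    norm_num

/-- The expectations of exp(-S_m) are 2^(-m), hence summable, so exp(-S_m) tends to 0 almost surely.
-/
theorem tendsto_arrival_atTop :
    ∀ᵐ y ∂expUnifLaw, Tendsto (fun m => arrival m y) atTop atTop := by
  have hm (m : ℕ) : Measurable fun y => ENNReal.ofReal (Real.exp (-arrival m y)) :=
    (Real.measurable_exp.comp (measurable_arrival _).neg).ennreal_ofReal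
  have hsum : ∫⁻ y, ∑' m, ENNReal.ofReal (Real.exp (-arrival m y)) ∂expUnifLaw ≠ ∞ := by
    rw [lintegral_tsum fun m => (hm m).aemeasurable]
    simp_rw [lintegral_exp_neg_arrival]
    rw [ENNReal.tsum_geometric]
    simp
  filter_upwards [ae_lt_top (Measurable.tsum hm) hsum] with y hy
  have h := ENNReal.tendsto_atTop_zero_of_tsum_ne_top hy.ne
  have h' : Tendsto (fun m => Real.exp (-arrival m y)) atTop (𝓝 0) := by
    have := (ENNReal.tendsto_toReal ENNReal.zero_ne_top).comp h
    simpa [Function.comp_def, ENNReal.toReal_ofReal (Real.exp_pos _).le] using this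
  have := Real.tendsto_exp_comp_nhds_zero.1 h'
  simpa [Function.comp_def] using tendsto_neg_atBot_atTop.comp this

theorem arrival_nonneg : ∀ᵐ y ∂expUnifLaw, ∀ m, 0 ≤ (y m).1 ∧ (y m).2 ∈ Icc (0 : ℝ) 1 := by
  rw [ae_all_iff]
  intro m
  have hmp := measurePreserving_eval_infinitePi (fun _ : ℕ => stepLaw) m
  have h1 : ∀ᵐ p ∂stepLaw, 0 ≤ p.1 := by
    have h : ∀ᵐ s ∂expMeasure 1, 0 ≤ s := by
      rw [ae_iff]
      have hm : Measurable (exponentialPDF 1) := (measurable_exponentialPDFReal 1).ennreal_ofReal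
      have : {a : ℝ | ¬ 0 ≤ a} = Iio 0 := by ext; simp
      rw [this, show expMeasure 1 = volume.withDensity (exponentialPDF 1) from rfl,
        withDensity_apply _ measurableSet_Iio]
      exact lintegral_exponentialPDF_of_nonpos le_rfl
    exact Measure.quasiMeasurePreserving_fst.ae h
  have h2 : ∀ᵐ p ∂stepLaw, p.2 ∈ Icc (0 : ℝ) 1 := by
    have h : ∀ᵐ s ∂unitUniform, s ∈ Icc (0 : ℝ) 1 := by
      rw [unitUniform_eq]
      exact ae_restrict_mem measurableSet_Icc
    exact Measure.quasiMeasurePreserving_snd.ae h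
  exact hmp.quasiMeasurePreserving.ae (h1.and h2)

section Void

variable {B : Set (ℝ × ℝ)} {T : ℝ}

/-- The mass of the points of `B` after time `s`. -/
def massAfter (B : Set (ℝ × ℝ)) (s : ℝ) : ℝ := ∫ r in Ioi s, unitUniform.real (Prod.mk r ⁻¹' B)

/-- Integrating out the uniform mark replaces the indicator by 1 - α, where α is the mass of the
section of `B`; what remains is `renewal_identity`. -/
theorem lintegral_renewal (hB : MeasurableSet B) (hT : ∀ p ∈ B, p.1 ≤ T) (x : ℝ) :
    ∫⁻ p, {p : ℝ × ℝ | (x + p.1, p.2) ∉ B}.indicator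
      (fun p => ENNReal.ofReal (Real.exp (-massAfter B (x + p.1)))) p ∂stepLaw =
      ENNReal.ofReal (Real.exp (-massAfter B x)) := by
  set α : ℝ → ℝ := fun r => unitUniform.real (Prod.mk r ⁻¹' B) with hαdef
  have hα : Measurable α := (measurable_measure_prodMk_left hB).ennreal_toReal
  have h0 (s : ℝ) : 0 ≤ α s := measureReal_nonneg
  have h1 (s : ℝ) : α s ≤ 1 := measureReal_le_one
  have hT' : ∀ s, T < s → α s = 0 := by
    intro s hs
    have : Prod.mk s ⁻¹' B = ∅ := by
      ext v
      simp only [mem_preimage, mem_empty_iff_false, iff_false]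
      exact fun h => (hT _ h).not_gt hs
    simp [hαdef, this]
  obtain ⟨hint, hval⟩ := renewal_identity hα h0 h1 hT' x
  have hI := integrableOn_Ioi_of_unit_bounded hα h0 h1 hT'
  have hmass : Antitone (massAfter B) := by
    intro s t hst
    exact setIntegral_mono_set (hI s) (ae_of_all _ h0) (Ioi_subset_Ioi hst).eventuallyLE
  have hG : Measurable fun s => ENNReal.ofReal (Real.exp (-massAfter B s)) :=
    (Real.measurable_exp.comp hmass.measurable.neg).ennreal_ofReal
  have hset : MeasurableSet {p : ℝ × ℝ | (x + p.1, p.2) ∉ B} :=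
    (show Measurable fun p : ℝ × ℝ => (x + p.1, p.2) by fun_prop) hB.compl
  have hGx : Measurable fun s : ℝ => ENNReal.ofReal (Real.exp (-massAfter B (x + s))) :=
    hG.comp (measurable_const.add measurable_id)
  have hGp : Measurable fun p : ℝ × ℝ => ENNReal.ofReal (Real.exp (-massAfter B (x + p.1))) :=
    hGx.comp measurable_fst
  rw [stepLaw, lintegral_prod _ (hGp.indicator hset).aemeasurable]
  have hin (s : ℝ) : ∫⁻ v, {p : ℝ × ℝ | (x + p.1, p.2) ∉ B}.indicator
      (fun p => ENNReal.ofReal (Real.exp (-massAfter B (x + p.1)))) (s, v) ∂unitUniform =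
      ENNReal.ofReal ((1 - α (x + s)) * Real.exp (-massAfter B (x + s))) := by
    have : (fun v => {p : ℝ × ℝ | (x + p.1, p.2) ∉ B}.indicator
      (fun p => ENNReal.ofReal (Real.exp (-massAfter B (x + p.1)))) (s, v)) =
      (Prod.mk (x + s) ⁻¹' B)ᶜ.indicator
        fun _ => ENNReal.ofReal (Real.exp (-massAfter B (x + s))) := by
      ext v
      by_cases hv : (x + s, v) ∈ B
      · rw [indicator_of_notMem (not_not.2 hv), indicator_of_notMem (not_not.2 hv)]
      · rw [indicator_of_mem (by exact hv), indicator_of_mem (by exact hv)]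
    have hms : MeasurableSet (Prod.mk (x + s) ⁻¹' B) := measurable_prodMk_left hB
    rw [this, lintegral_indicator_const hms.compl, mul_comm,
      ENNReal.ofReal_mul (by linarith [h1 (x + s)])]
    congr 1
    rw [← probReal_compl_eq_one_sub hms, ofReal_measureReal]
  simp_rw [hin]
  have hmeas : Measurable fun s : ℝ => ENNReal.ofReal ((1 - α (x + s)) *
      Real.exp (-massAfter B (x + s))) := by
    refine Measurable.ennreal_ofReal (Measurable.mul ?_ ?_)
    · exact measurable_const.sub (hα.comp (measurable_const.add measurable_id))
    · exact Real.measurable_exp.comp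
        (hmass.measurable.comp (measurable_const.add measurable_id)).neg
  rw [lintegral_expMeasure_one hmeas]
  simp_rw [← ENNReal.ofReal_mul (Real.exp_pos _).le]
  change _ = Real.exp (-massAfter B x) at hval
  rw [← hval]
  exact (ofReal_integral_eq_lintegral_ofReal hint (ae_of_all _ fun y => mul_nonneg
    (Real.exp_pos _).le (mul_nonneg (by linarith [h1 (x + y)]) (Real.exp_pos _).le))).symm

/-- The event that none of the first `m` shifted points is in `B`. -/
def avoidUpTo (B : Set (ℝ × ℝ)) (x : ℝ) (m : ℕ) : Set (ℕ → ℝ × ℝ) :=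
  {y | ∀ j < m, (x + partialSum y j, (y j).2) ∉ B}

theorem measurableSet_avoidUpTo (hB : MeasurableSet B) (x : ℝ) (m : ℕ) :
    MeasurableSet (avoidUpTo B x m) := by
  have : avoidUpTo B x m = ⋂ j, ⋂ _ : j < m,
      (fun y : ℕ → ℝ × ℝ => (x + partialSum y j, (y j).2)) ⁻¹' Bᶜ := by
    ext y
    simp [avoidUpTo]
  rw [this]
  refine MeasurableSet.iInter fun j => MeasurableSet.iInter fun _ => ?_
  refine Measurable.prodMk ?_ ?_ hB.compl
  · exact measurable_const.add (measurable_partialSum j)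
  · exact (measurable_pi_apply j).snd

theorem measurable_massAfter (hB : MeasurableSet B) (hT : ∀ p ∈ B, p.1 ≤ T) :
    Measurable (massAfter B) ∧ (∀ s, 0 ≤ massAfter B s) ∧ ∀ s, T ≤ s → massAfter B s = 0 := by
  have hT' : ∀ s, T < s → unitUniform.real (Prod.mk s ⁻¹' B) = 0 := by
    intro s hs
    have : Prod.mk s ⁻¹' B = ∅ := by
      ext v
      simp only [mem_preimage, mem_empty_iff_false, iff_false]
      exact fun h => (hT _ h).not_gt hs
    simp [this]
  refine ⟨?_, fun s => setIntegral_nonneg measurableSet_Ioi fun _ _ => measureReal_nonneg,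
    fun s hs => setIntegral_eq_zero_of_forall_eq_zero fun r hr => hT' r (hs.trans_lt hr)⟩
  have hmass : Antitone (massAfter B) := by
    intro s t hst
    exact setIntegral_mono_set (integrableOn_Ioi_of_unit_bounded
      (measurable_measure_prodMk_left hB).ennreal_toReal
      (fun _ => measureReal_nonneg) (fun _ => measureReal_le_one) hT' s)
      (ae_of_all _ fun _ => measureReal_nonneg) (Ioi_subset_Ioi hst).eventuallyLE
  exact hmass.measurable

/-- A martingale property: the indicator of no hit among the first `m` points, times the predicted
probability of no later hit, has constant expectation. The induction strips off the first arrival,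
which moves the starting time; hence the general `x`. -/
theorem lintegral_avoidUpTo (hB : MeasurableSet B) (hT : ∀ p ∈ B, p.1 ≤ T) (m : ℕ) (x : ℝ) :
    ∫⁻ y, (avoidUpTo B x m).indicator
      (fun y => ENNReal.ofReal (Real.exp (-massAfter B (x + arrival m y)))) y ∂expUnifLaw =
      ENNReal.ofReal (Real.exp (-massAfter B x)) := by
  have hG (x : ℝ) (m : ℕ) : Measurable fun y : ℕ → ℝ × ℝ =>
      ENNReal.ofReal (Real.exp (-massAfter B (x + arrival m y))) :=
    (Real.measurable_exp.comp ((measurable_massAfter hB hT).1.comp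
      (measurable_const.add (measurable_arrival m))).neg).ennreal_ofReal
  induction m generalizing x with
  | zero => simp [avoidUpTo, arrival]
  | succ m ih =>
    rw [lintegral_expUnifLaw ((hG x _).indicator (measurableSet_avoidUpTo hB x _)),
      ← lintegral_renewal hB hT x]
    refine lintegral_congr fun p => ?_
    have hsum (y : ℕ → ℝ × ℝ) (j : ℕ) :
        partialSum (consSeq (p, y)) (j + 1) = p.1 + partialSum y j := by
      rw [partialSum_eq_arrival, arrival_succ_consSeq, partialSum_eq_arrival]
    have hsum0 (y : ℕ → ℝ × ℝ) : partialSum (consSeq (p, y)) 0 = p.1 := by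
      simp [partialSum, consSeq]
    have hmem (y : ℕ → ℝ × ℝ) : consSeq (p, y) ∈ avoidUpTo B x (m + 1) ↔
        (x + p.1, p.2) ∉ B ∧ y ∈ avoidUpTo B (x + p.1) m := by
      simp only [avoidUpTo, mem_ofPred_eq]
      constructor
      · intro h
        refine ⟨?_, fun j hj => ?_⟩
        · have := h 0 m.succ_pos
          rwa [hsum0] at this
        · have := h (j + 1) (Nat.succ_lt_succ hj)
          rwa [hsum, ← add_assoc] at this
      · rintro ⟨h0, h⟩ j hj
        cases j with
        | zero => rwa [hsum0]
        | succ j =>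
          rw [hsum, ← add_assoc]
          exact h j (Nat.lt_of_succ_lt_succ hj)
    by_cases hp : (x + p.1, p.2) ∉ B
    · rw [indicator_of_mem (by exact hp), ← ih (x + p.1)]
      refine lintegral_congr fun y => ?_
      have hiff : consSeq (p, y) ∈ avoidUpTo B x (m + 1) ↔ y ∈ avoidUpTo B (x + p.1) m := by
        rw [hmem]
        exact and_iff_right hp
      by_cases hy : y ∈ avoidUpTo B (x + p.1) m
      · rw [indicator_of_mem hy, indicator_of_mem (hiff.2 hy), arrival_succ_consSeq, add_assoc]
      · rw [indicator_of_notMem hy, indicator_of_notMem (mt hiff.1 hy)]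
    · rw [indicator_of_notMem (by exact hp)]
      refine (lintegral_congr fun y => indicator_of_notMem (fun hy => ?_) _).trans lintegral_zero
      exact hp ((hmem y).1 hy).1

/-- The marked arrival times form a Poisson process: its void probabilities. -/
theorem expUnifLaw_void (hB : MeasurableSet B) (hT : ∀ p ∈ B, p.1 ≤ T) :
    expUnifLaw {y | ∀ m, (partialSum y m, (y m).2) ∉ B} =
      ENNReal.ofReal (Real.exp (-massAfter B 0)) := by
  obtain ⟨hmass, hnn, hz⟩ := measurable_massAfter hB hT
  set V : Set (ℕ → ℝ × ℝ) := {y | ∀ m, (partialSum y m, (y m).2) ∉ B}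
  have hVeq : V = ⋂ m, avoidUpTo B 0 m := by
    ext y
    simp only [V, avoidUpTo, mem_ofPred_eq, mem_iInter, zero_add]
    exact ⟨fun h m j _ => h j, fun h m => h (m + 1) m m.lt_succ_self⟩
  have hV : MeasurableSet V := by
    rw [hVeq]
    exact MeasurableSet.iInter fun m => measurableSet_avoidUpTo hB 0 m
  -- Once the arrival times exceed `T` no mass of `B` is left, so the integrands, bounded by 1,
  -- converge to the indicator of the void event while their integrals stay constant.
  have hlim := tendsto_lintegral_of_dominated_convergence (μ := expUnifLaw)
    (F := fun m y => (avoidUpTo B 0 m).indicator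
      (fun y => ENNReal.ofReal (Real.exp (-massAfter B (0 + arrival m y)))) y)
    (f := V.indicator 1) 1
    (fun m => Measurable.indicator (Real.measurable_exp.comp (hmass.comp
      (measurable_const.add (measurable_arrival m))).neg).ennreal_ofReal
      (measurableSet_avoidUpTo hB 0 m))
    (fun m => ae_of_all _ fun y => by
      refine indicator_apply_le' (fun _ => ?_) (fun _ => zero_le)
      refine ENNReal.ofReal_le_one.2 (Real.exp_le_one_iff.2 ?_)
      linarith [hnn (0 + arrival m y)])
    (by simp)
    (by
      filter_upwards [tendsto_arrival_atTop] with y hy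
      refine tendsto_const_nhds.congr' ?_
      by_cases hyV : y ∈ V
      · filter_upwards [hy.eventually_ge_atTop T] with m hm
        have : y ∈ avoidUpTo B 0 m := by
          rw [hVeq] at hyV
          exact mem_iInter.1 hyV m
        rw [indicator_of_mem hyV, indicator_of_mem this, hz _ (by simpa using hm)]
        simp
      · have : ∃ j, (partialSum y j, (y j).2) ∈ B := by
          by_contra! h
          exact hyV h
        obtain ⟨j, hj⟩ := this
        filter_upwards [eventually_gt_atTop j] with m hm
        rw [indicator_of_notMem hyV, indicator_of_notMem]
        intro h
        exact h j hm (by simpa using hj))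
  simp_rw [lintegral_avoidUpTo hB hT] at hlim
  rw [lintegral_indicator_one hV] at hlim
  exact (tendsto_nhds_unique tendsto_const_nhds hlim).symm

theorem ofReal_massAfter (hB : MeasurableSet B) (hT : ∀ p ∈ B, p.1 ≤ T) :
    ENNReal.ofReal (massAfter B 0) = volume (B ∩ Ioi 0 ×ˢ Ioo 0 1) := by
  have hT' : ∀ s, T < s → unitUniform.real (Prod.mk s ⁻¹' B) = 0 := by
    intro s hs
    have : Prod.mk s ⁻¹' B = ∅ := by
      ext v
      simp only [mem_preimage, mem_empty_iff_false, iff_false]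
      exact fun h => (hT _ h).not_gt hs
    simp [this]
  have hI : IntegrableOn (fun r => unitUniform.real (Prod.mk r ⁻¹' B)) (Ioi 0) :=
    integrableOn_Ioi_of_unit_bounded
      (measurable_measure_prodMk_left (ν := unitUniform) hB).ennreal_toReal
      (fun _ => measureReal_nonneg) (fun _ => measureReal_le_one) hT' 0
  rw [massAfter, ofReal_integral_eq_lintegral_ofReal hI (ae_of_all _ fun _ => measureReal_nonneg)]
  have hof (r : ℝ) : ENNReal.ofReal (unitUniform.real (Prod.mk r ⁻¹' B)) =
      unitUniform (Prod.mk r ⁻¹' B) := ofReal_measureReal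
  simp_rw [hof]
  -- Passing from closed to open mark interval costs only a null set and matches the strict
  -- inequalities of `limitRegion`.
  rw [← Measure.prod_apply hB, unitUniform_eq,
    ← Measure.restrict_congr_set Ioo_ae_eq_Icc, Measure.prod_restrict, Measure.restrict_apply hB]
  rfl

end Void

/-! ### The limit process -/

/-- The norm and angle belonging to an arrival time and a mark. -/
def normAngleMap (σ τ : ℝ) (p : ℝ × ℝ) : ℝ × ℝ :=
  (σ * p.1 ^ (2 / 3 : ℝ), p.2 * τ * σ ^ (1 / 2 : ℝ) * p.1 ^ (1 / 3 : ℝ))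

theorem measurable_normAngleMap (σ τ : ℝ) : Measurable (normAngleMap σ τ) := by
  unfold normAngleMap
  fun_prop

theorem measurable_normAngle (σ τ : ℝ) : Measurable (normAngle σ τ) :=
  measurable_pi_iff.2 fun m => (measurable_normAngleMap σ τ).comp
    ((measurable_partialSum m).prodMk (measurable_pi_apply m).snd)

/-- The region that carries the limit process. -/
def limitRegion (τ : ℝ) : Set (ℝ × ℝ) := {p | 0 < p.2 ∧ p.2 < τ * √p.1}

/-- The derivative of `normAngleMap`. -/
def normAngleDeriv (σ τ : ℝ) (p : ℝ × ℝ) : ℝ × ℝ →L[ℝ] ℝ × ℝ :=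
  (Matrix.toLin (.finTwoProd ℝ) (.finTwoProd ℝ)
    !![σ * ((2 / 3) * p.1 ^ (2 / 3 - 1 : ℝ)), 0;
      p.2 * τ * σ ^ (1 / 2 : ℝ) * ((1 / 3) * p.1 ^ (1 / 3 - 1 : ℝ)),
      τ * σ ^ (1 / 2 : ℝ) * p.1 ^ (1 / 3 : ℝ)]).toContinuousLinearMap

theorem hasFDerivAt_normAngleMap (σ τ : ℝ) {p : ℝ × ℝ} (hp : 0 < p.1) :
    HasFDerivAt (normAngleMap σ τ) (normAngleDeriv σ τ p) p := by
  have h1 : HasDerivAt (fun s : ℝ => σ * s ^ (2 / 3 : ℝ))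
      (σ * ((2 / 3) * p.1 ^ (2 / 3 - 1 : ℝ))) p.1 :=
    (Real.hasDerivAt_rpow_const (Or.inl hp.ne')).const_mul σ
  have h2 : HasDerivAt (fun s : ℝ => s ^ (1 / 3 : ℝ)) ((1 / 3) * p.1 ^ (1 / 3 - 1 : ℝ)) p.1 :=
    Real.hasDerivAt_rpow_const (Or.inl hp.ne')
  have h3 : HasFDerivAt (fun p : ℝ × ℝ => p.2 * τ * σ ^ (1 / 2 : ℝ))
      ((σ ^ (1 / 2 : ℝ)) • (τ • ContinuousLinearMap.snd ℝ ℝ ℝ)) p :=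
    (hasFDerivAt_snd.mul_const τ).mul_const _
  have := HasFDerivAt.prodMk (𝕜 := ℝ) (h1.comp_hasFDerivAt p hasFDerivAt_fst)
    (h3.mul (h2.comp_hasFDerivAt p hasFDerivAt_fst))
  unfold normAngleDeriv
  rw [Matrix.toLin_finTwoProd_toContinuousLinearMap]
  convert! this using 1
  ext <;> (simp; try ring)

/-- The matrix is triangular and the powers -1/3 and 1/3 on its diagonal cancel. A constant
determinant is what keeps the Poisson process homogeneous. -/
theorem det_normAngleDeriv {σ τ : ℝ} (hσ : 0 < σ) {p : ℝ × ℝ} (hp : 0 < p.1) :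
    (normAngleDeriv σ τ p).det = 2 / 3 * τ * σ ^ (3 / 2 : ℝ) := by
  unfold normAngleDeriv
  simp only [LinearMap.det_toContinuousLinearMap, LinearMap.det_toLin, Matrix.det_fin_two_of]
  have e1 : p.1 ^ (2 / 3 - 1 : ℝ) * p.1 ^ (1 / 3 : ℝ) = 1 := by
    rw [← Real.rpow_add hp]
    norm_num
  have e2 : σ * σ ^ (1 / 2 : ℝ) = σ ^ (3 / 2 : ℝ) := by
    nth_rewrite 1 [← Real.rpow_one σ]
    rw [← Real.rpow_add hσ]
    norm_num
  rw [← e2]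
  linear_combination (2 / 3 * σ * τ * σ ^ (1 / 2 : ℝ)) * e1

theorem sqrt_normAngleMap {σ τ : ℝ} (hσ : 0 < σ) {p : ℝ × ℝ} (hp : 0 ≤ p.1) :
    √(normAngleMap σ τ p).1 = σ ^ (1 / 2 : ℝ) * p.1 ^ (1 / 3 : ℝ) := by
  simp only [normAngleMap]
  rw [Real.sqrt_eq_rpow, Real.mul_rpow hσ.le (by positivity), ← Real.rpow_mul hp]
  norm_num

/-- The mark is the fraction of the height of `limitRegion` at which the image point sits; both the
image and the injectivity of the map are read off from this. -/
theorem normAngleMap_snd {σ τ : ℝ} (hσ : 0 < σ) {p : ℝ × ℝ} (hp : 0 ≤ p.1) :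
    (normAngleMap σ τ p).2 = p.2 * (τ * √(normAngleMap σ τ p).1) := by
  rw [sqrt_normAngleMap hσ hp]
  simp only [normAngleMap]
  ring

theorem volume_normAngleMap_preimage {σ τ : ℝ} (hσ : 0 < σ) (hτ : 0 < τ) {A : Set (ℝ × ℝ)}
    (hA : MeasurableSet A) :
    ENNReal.ofReal (2 / 3 * τ * σ ^ (3 / 2 : ℝ)) *
      volume (normAngleMap σ τ ⁻¹' A ∩ Ioi 0 ×ˢ Ioo 0 1) = volume (A ∩ limitRegion τ) := by
  set D := normAngleMap σ τ ⁻¹' A ∩ Ioi 0 ×ˢ Ioo 0 1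
  have hD : MeasurableSet D := (measurable_normAngleMap σ τ hA).inter
    (measurableSet_Ioi.prod measurableSet_Ioo)
  have hDpos : ∀ p ∈ D, 0 < p.1 := fun p hp => hp.2.1
  have himage : normAngleMap σ τ '' D = A ∩ limitRegion τ := by
    ext q
    constructor
    · rintro ⟨p, ⟨hpA, hp1, hp2⟩, rfl⟩
      have hp1 : 0 < p.1 := hp1
      have hpos : 0 < τ * √(normAngleMap σ τ p).1 := by
        rw [sqrt_normAngleMap hσ hp1.le]
        positivity
      refine ⟨hpA, ?_, ?_⟩
      · rw [normAngleMap_snd hσ hp1.le]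
        exact mul_pos hp2.1 hpos
      · rw [normAngleMap_snd hσ hp1.le]
        exact mul_lt_of_lt_one_left hpos hp2.2
    · rintro ⟨hqA, hq0, hq1⟩
      have hsq : 0 < τ * √q.1 := hq0.trans hq1
      have hsq' : 0 < √q.1 := pos_of_mul_pos_right hsq hτ.le
      have hq : 0 < q.1 := Real.sqrt_pos.1 hsq'
      -- The preimage of `q` has time (q.1/σ)^(3/2) and mark q.2/(τ√q.1).
      have hs : 0 < (q.1 / σ) ^ (3 / 2 : ℝ) := by positivity
      have e1 : σ * ((q.1 / σ) ^ (3 / 2 : ℝ)) ^ (2 / 3 : ℝ) = q.1 := by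
        rw [← Real.rpow_mul (by positivity)]
        norm_num
        field_simp
      have hfst : (normAngleMap σ τ ((q.1 / σ) ^ (3 / 2 : ℝ), q.2 / (τ * √q.1))).1 = q.1 := e1
      have heq : normAngleMap σ τ ((q.1 / σ) ^ (3 / 2 : ℝ), q.2 / (τ * √q.1)) = q := by
        refine Prod.ext hfst ?_
        rw [normAngleMap_snd hσ hs.le, hfst]
        field_simp
      refine ⟨((q.1 / σ) ^ (3 / 2 : ℝ), q.2 / (τ * √q.1)), ⟨?_, hs, ?_, ?_⟩, heq⟩
      · rw [mem_preimage, heq]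
        exact hqA
      · exact div_pos hq0 hsq
      · exact (div_lt_one hsq).2 hq1
  have hinj : InjOn (normAngleMap σ τ) D := by
    intro p hp q hq hpq
    have hp1 := hDpos p hp
    have hq1 := hDpos q hq
    have e1 : p.1 = q.1 := by
      have := congrArg Prod.fst hpq
      simp only [normAngleMap] at this
      have := mul_left_cancel₀ hσ.ne' this
      exact (Real.rpow_left_inj hp1.le hq1.le (by norm_num)).1 this
    refine Prod.ext e1 ?_
    have := congrArg Prod.snd hpq
    rw [normAngleMap_snd hσ hp1.le, normAngleMap_snd hσ hq1.le, hpq] at this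
    refine mul_right_cancel₀ (mul_pos hτ ?_).ne' this
    rw [sqrt_normAngleMap hσ hq1.le]
    positivity
  rw [← himage, ← lintegral_abs_det_fderiv_eq_addHaar_image volume hD
    (fun p hp => (hasFDerivAt_normAngleMap σ τ (hDpos p hp)).hasFDerivWithinAt) hinj]
  rw [setLIntegral_congr_fun hD (g := fun _ => ENNReal.ofReal (2 / 3 * τ * σ ^ (3 / 2 : ℝ)))]
  · simp
  · intro p hp
    simp only
    rw [det_normAngleDeriv hσ (hDpos p hp), abs_of_pos (by positivity)]

/-- The void probabilities of `NA_∞(σ, τ)`. -/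
theorem normAngleLaw_void {σ τ p R : ℝ} (hσ : 0 < σ) (hτ : 0 < τ)
    (hp : p * (2 / 3 * τ * σ ^ (3 / 2 : ℝ)) = 1) {A : Set (ℝ × ℝ)} (hA : MeasurableSet A)
    (hR : ∀ q ∈ A, q.1 ≤ R) :
    (normAngleLaw σ τ).real {z | ∀ k, z k ∉ A} =
      Real.exp (-(p * volume.real (A ∩ limitRegion τ))) := by
  have hset : MeasurableSet {z : ℕ → ℝ × ℝ | ∀ k, z k ∉ A} := by
    have : {z : ℕ → ℝ × ℝ | ∀ k, z k ∉ A} = ⋂ k, (fun z => z k) ⁻¹' Aᶜ := by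
      ext
      simp
    rw [this]
    exact MeasurableSet.iInter fun k => measurable_pi_apply k hA.compl
  set B := normAngleMap σ τ ⁻¹' A with hBdef
  have hB : MeasurableSet B := measurable_normAngleMap σ τ hA
  -- The second entry inverts σs^(2/3) ≤ R for positive times; the entry 0 covers nonpositive times,
  -- where monotonicity of the power is not available.
  set T := max 0 ((R / σ) ^ (3 / 2 : ℝ))
  have hT : ∀ q ∈ B, q.1 ≤ T := by
    intro q hq
    rcases le_or_gt q.1 0 with h | h
    · exact h.trans (le_max_left _ _)
    · refine le_trans ?_ (le_max_right _ _)
      have h1 : σ * q.1 ^ (2 / 3 : ℝ) ≤ R := hR _ hq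
      have h2 : q.1 ^ (2 / 3 : ℝ) ≤ R / σ := by
        rw [le_div_iff₀ hσ]
        linarith
      have h3 : q.1 = (q.1 ^ (2 / 3 : ℝ)) ^ (3 / 2 : ℝ) := by
        rw [← Real.rpow_mul h.le]
        norm_num
      rw [h3]
      exact Real.rpow_le_rpow (by positivity) h2 (by norm_num)
  have hvoid : normAngleLaw σ τ {z | ∀ k, z k ∉ A} =
      ENNReal.ofReal (Real.exp (-massAfter B 0)) := by
    rw [normAngleLaw, Measure.map_apply (measurable_normAngle σ τ) hset]
    exact expUnifLaw_void hB hT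
  have hmass : massAfter B 0 = p * volume.real (A ∩ limitRegion τ) := by
    have h1 := ofReal_massAfter hB hT
    have h2 := volume_normAngleMap_preimage hσ hτ hA
    rw [← h1, ← ENNReal.ofReal_mul (by positivity)] at h2
    rw [measureReal_def, ← h2, ENNReal.toReal_ofReal (mul_nonneg (by positivity)
      ((measurable_massAfter hB hT).2.1 0)), ← mul_assoc, hp, one_mul]
  rw [measureReal_def, hvoid, ENNReal.toReal_ofReal (Real.exp_pos _).le, hmass]

/-- The properties of almost all realisations of `NA_∞(σ, τ)`. -/
theorem normAngleLaw_ae {σ τ : ℝ} (hσ : 0 < σ) (hτ : 0 < τ) :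
    ∀ᵐ z ∂normAngleLaw σ τ, (∀ k, 0 ≤ (z k).1 ∧ 0 ≤ (z k).2 ∧ (z k).2 ≤ τ * √(z k).1) ∧
      Tendsto (fun k => (z k).1) atTop atTop := by
  have hset : MeasurableSet {z : ℕ → ℝ × ℝ |
      (∀ k, 0 ≤ (z k).1 ∧ 0 ≤ (z k).2 ∧ (z k).2 ≤ τ * √(z k).1) ∧
      Tendsto (fun k => (z k).1) atTop atTop} := by
    rw [ofPred_and]
    refine MeasurableSet.inter ?_ ?_
    · have : {z : ℕ → ℝ × ℝ | ∀ k, 0 ≤ (z k).1 ∧ 0 ≤ (z k).2 ∧ (z k).2 ≤ τ * √(z k).1} =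
          ⋂ k, (fun z => z k) ⁻¹' {p : ℝ × ℝ | 0 ≤ p.1 ∧ 0 ≤ p.2 ∧ p.2 ≤ τ * √p.1} := by
        ext
        simp
      rw [this]
      refine MeasurableSet.iInter fun k => measurable_pi_apply k ?_
      exact (measurableSet_le measurable_const measurable_fst).inter
        ((measurableSet_le measurable_const measurable_snd).inter
          (measurableSet_le measurable_snd (by fun_prop)))
    · exact measurableSet_tendsto (f := fun k (z : ℕ → ℝ × ℝ) => (z k).1) _
        fun k => (measurable_pi_apply k).fst
  rw [normAngleLaw, ae_map_iff (measurable_normAngle σ τ).aemeasurable hset]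
  filter_upwards [arrival_nonneg, tendsto_arrival_atTop] with y hy hlim
  have hS (k : ℕ) : 0 ≤ partialSum y k := Finset.sum_nonneg fun j _ => (hy j).1
  refine ⟨fun k => ?_, ?_⟩
  · have hfst : (normAngle σ τ y k) = normAngleMap σ τ (partialSum y k, (y k).2) := rfl
    have h0 : 0 ≤ τ * √(normAngle σ τ y k).1 := by positivity
    have h2 : (normAngle σ τ y k).2 = (y k).2 * (τ * √(normAngle σ τ y k).1) :=
      normAngleMap_snd (p := (partialSum y k, (y k).2)) hσ (hS k)
    refine ⟨?_, ?_, ?_⟩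
    · rw [hfst]
      have := hS k
      simp only [normAngleMap]
      positivity
    · rw [h2]
      exact mul_nonneg (hy k).2.1 h0
    · rw [h2]
      exact mul_le_of_le_one_left h0 (hy k).2.2
  · have h1 : Tendsto (fun k => partialSum y k) atTop atTop :=
      hlim.comp (tendsto_add_atTop_nat 1)
    exact ((tendsto_rpow_atTop (by norm_num)).comp h1).const_mul_atTop hσ

/-- Only finitely many pairs have both first coordinates below a given level, so `f` tends to
infinity along the cofinite filter and attains its minimum. -/
theorem isLeast_range_of_tendsto {z w : ℕ → ℝ × ℝ} (hz : ∀ k, 0 ≤ (z k).1)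
    (hw : ∀ k, 0 ≤ (w k).1) (hz' : Tendsto (fun k => (z k).1) atTop atTop)
    (hw' : Tendsto (fun k => (w k).1) atTop atTop) {f : ℕ × ℕ → ℝ}
    (hf : ∀ kl, (z kl.1).1 + (w kl.2).1 ≤ f kl) : IsLeast (range f) (⨅ kl, f kl) := by
  have hcof : Tendsto f cofinite atTop := by
    refine tendsto_atTop.2 fun c => ?_
    rw [← Nat.cofinite_eq_atTop] at hz' hw'
    have h1 := tendsto_atTop.1 hz' c
    have h2 := tendsto_atTop.1 hw' c
    rw [eventually_cofinite] at h1 h2 ⊢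
    refine (h1.prod h2).subset fun kl hkl => ?_
    have hkl : ¬ c ≤ f kl := hkl
    have := hf kl
    have := hz kl.1
    have := hw kl.2
    exact ⟨fun (h : c ≤ (z kl.1).1) => hkl (by linarith),
      fun (h : c ≤ (w kl.2).1) => hkl (by linarith)⟩
  obtain ⟨m, hm⟩ := hcof.exists_forall_le
  have : ⨅ kl, f kl = f m :=
    le_antisymm (ciInf_le ⟨f m, by rintro _ ⟨k, rfl⟩; exact hm k⟩ m) (le_ciInf hm)
  rw [this]
  exact ⟨mem_range_self m, by rintro _ ⟨k, rfl⟩; exact hm k⟩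

theorem minimaAttained_of_tendsto {z : Fin 4 → ℕ → ℝ × ℝ} (hz : ∀ i k, 0 ≤ (z i k).1)
    (hz' : ∀ i, Tendsto (fun k => (z i k).1) atTop atTop) : MinimaAttained 1 z := by
  have hadd (i j : Fin 4) : IsLeast (range (termAdd 1 (z i) (z j))) (minAdd 1 (z i) (z j)) :=
    isLeast_range_of_tendsto (hz i) (hz j) (hz' i) (hz' j) fun kl =>
      le_add_of_nonneg_right (by positivity)
  have hsub (i j : Fin 4) : IsLeast (range (termSub 1 (z i) (z j))) (minSub 1 (z i) (z j)) :=
    isLeast_range_of_tendsto (hz i) (hz j) (hz' i) (hz' j) fun kl =>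
      le_add_of_nonneg_right (by positivity)
  exact ⟨hadd 0 1, hsub 0 2, hsub 1 3, hadd 2 3⟩

/-! ### The signs of the quadrants -/

/-- The sign of the horizontal coordinate in a quadrant. -/
def signX : Fin 4 → ℝ := ![1, -1, -1, 1]

/-- The sign of the vertical coordinate in a quadrant. -/
def signY : Fin 4 → ℝ := ![1, 1, -1, -1]

theorem signX_cases (i : Fin 4) : signX i = 1 ∨ signX i = -1 := by
  fin_cases i <;> simp [signX]

theorem signY_cases (i : Fin 4) : signY i = 1 ∨ signY i = -1 := by
  fin_cases i <;> simp [signY]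

theorem ciInf_lt_iff_of_nonneg {f : ℕ × ℕ → ℝ} (hf : ∀ kl, 0 ≤ f kl) {t : ℝ} :
    ⨅ kl, f kl < t ↔ ∃ k l, f (k, l) < t := by
  rw [ciInf_lt_iff ⟨0, by rintro _ ⟨k, rfl⟩; exact hf k⟩, Prod.exists]

/-- Attaching `signY` to the angles merges sums and differences into one formula, and the pairs of a
right and a left quadrant are exactly the four pairs in the limit. -/
theorem limitMin_lt_iff {z : Fin 4 → ℕ → ℝ × ℝ} (hz : ∀ i k, 0 ≤ (z i k).1) {t : ℝ} :
    limitMin 1 z < t ↔ ∃ i j, signX i = 1 ∧ signX j = -1 ∧ ∃ k l,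
      (z i k).1 + (z j l).1 + (signY i * (z i k).2 + signY j * (z j l).2) ^ 2 / 4 < t := by
  have hadd (i j : Fin 4) : minAdd 1 (z i) (z j) < t ↔
      ∃ k l, (z i k).1 + (z j l).1 + 1 / 4 * ((z i k).2 + (z j l).2) ^ 2 < t := by
    refine ciInf_lt_iff_of_nonneg fun kl => ?_
    have := hz i kl.1
    have := hz j kl.2
    simp only [termAdd]
    positivity
  have hsub (i j : Fin 4) : minSub 1 (z i) (z j) < t ↔
      ∃ k l, (z i k).1 + (z j l).1 + 1 / 4 * ((z i k).2 - (z j l).2) ^ 2 < t := by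
    refine ciInf_lt_iff_of_nonneg fun kl => ?_
    have := hz i kl.1
    have := hz j kl.2
    simp only [termSub]
    positivity
  simp only [limitMin, min_lt_iff, hadd, hsub]
  constructor
  · rintro ((⟨k, l, h⟩ | ⟨k, l, h⟩) | (⟨k, l, h⟩ | ⟨k, l, h⟩))
    · refine ⟨0, 1, rfl, rfl, k, l, ?_⟩
      simp only [signY, Matrix.cons_val]
      linarith
    · refine ⟨0, 2, rfl, rfl, k, l, ?_⟩
      simp only [signY, Matrix.cons_val]
      linarith
    · refine ⟨3, 1, rfl, rfl, l, k, ?_⟩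
      simp only [signY, Matrix.cons_val]
      linarith
    · refine ⟨3, 2, rfl, rfl, l, k, ?_⟩
      simp only [signY, Matrix.cons_val]
      linarith
  · rintro ⟨i, j, hi, hj, k, l, h⟩
    have h11 : (1 : ℝ) ≠ -1 := by norm_num
    fin_cases i <;> fin_cases j <;> simp [signX, h11, h11.symm] at hi hj <;>
      simp only [signY, Matrix.cons_val, Fin.isValue, Fin.mk_one, Fin.zero_eta,
        Fin.reduceFinMk] at h
    · exact Or.inl (Or.inl ⟨k, l, by linarith⟩)
    · exact Or.inl (Or.inr ⟨k, l, by linarith⟩)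
    · exact Or.inr (Or.inl ⟨l, k, by linarith⟩)
    · exact Or.inr (Or.inr ⟨l, k, by linarith⟩)

/-! ### Coordinates of the plane and the uniform distribution in the ellipse -/

theorem norm_sq_plane (z : Plane) : ‖z‖ ^ 2 = z 0 ^ 2 + z 1 ^ 2 := by
  rw [EuclideanSpace.real_norm_sq_eq, Fin.sum_univ_two]

theorem dist_sq_plane (z w : Plane) : dist z w ^ 2 = (z 0 - w 0) ^ 2 + (z 1 - w 1) ^ 2 := by
  rw [dist_eq_norm, norm_sq_plane]
  rfl

theorem continuous_coord (i : Fin 2) : Continuous fun z : Plane => z i := by fun_prop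

theorem measurable_coord (i : Fin 2) : Measurable fun z : Plane => z i :=
  (continuous_coord i).measurable

/-- The pair of coordinates of a point. -/
def toPair (z : Plane) : ℝ × ℝ := (z 0, z 1)

theorem measurePreserving_toPair : MeasurePreserving toPair volume volume :=
  (volume_preserving_finTwoArrow ℝ).comp (PiLp.volume_preserving_ofLp (Fin 2))

theorem volume_affine_preimage {c d : ℝ} (hd : d ≠ 0) (s : Set ℝ) :
    volume ((fun x => c + d * x) ⁻¹' s) = ENNReal.ofReal |d⁻¹| * volume s := by
  have : (fun x => c + d * x) ⁻¹' s = (fun x => d * x) ⁻¹' ((fun x => c + x) ⁻¹' s) := rfl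
  rw [this, Real.volume_preimage_mul_left hd, measure_preimage_add]

theorem lintegral_comp_mul_left_real {d : ℝ} (hd : d ≠ 0) {f : ℝ → ℝ≥0∞} (hf : Measurable f) :
    ∫⁻ x, f (d * x) = ENNReal.ofReal |d⁻¹| * ∫⁻ x, f x := by
  rw [← lintegral_map hf (measurable_const_mul d), Real.map_volume_mul_left hd,
    lintegral_smul_measure, smul_eq_mul]

theorem isClosed_ellipse (b : ℝ) : IsClosed (ellipse b) :=
  isClosed_le (by fun_prop) continuous_const

theorem measurableSet_ellipse (b : ℝ) : MeasurableSet (ellipse b) :=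
  (isClosed_ellipse b).measurableSet

theorem snd_sq_le_of_mem_ellipse {b : ℝ} (hb0 : 0 < b) {z : Plane} (hz : z ∈ ellipse b) :
    z 1 ^ 2 ≤ b ^ 2 * (1 - z 0 ^ 2) := by
  have h : z 0 ^ 2 + (z 1 / b) ^ 2 ≤ 1 := hz
  rw [div_pow] at h
  have : z 1 ^ 2 / b ^ 2 ≤ 1 - z 0 ^ 2 := by linarith
  rwa [div_le_iff₀ (by positivity), mul_comm] at this

theorem mem_ellipse_iff {b : ℝ} (hb0 : 0 < b) {z : Plane} :
    z ∈ ellipse b ↔ z 1 ^ 2 ≤ b ^ 2 * (1 - z 0 ^ 2) := by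
  refine ⟨snd_sq_le_of_mem_ellipse hb0, fun h => ?_⟩
  change z 0 ^ 2 + (z 1 / b) ^ 2 ≤ 1
  rw [div_pow]
  have : z 1 ^ 2 / b ^ 2 ≤ 1 - z 0 ^ 2 := by
    rwa [div_le_iff₀ (by positivity), mul_comm]
  linarith

theorem fst_sq_le_of_mem_ellipse {b : ℝ} {z : Plane} (hz : z ∈ ellipse b) : z 0 ^ 2 ≤ 1 := by
  have h : z 0 ^ 2 + (z 1 / b) ^ 2 ≤ 1 := hz
  nlinarith [sq_nonneg (z 1 / b)]

/-- For b < 1 this is the quantitative form of uniqueness of the major axis: nearly unit norm forces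
1 - x² to be small, hence closeness to a pole. -/
theorem norm_sq_le_of_mem_ellipse {b : ℝ} (hb0 : 0 < b) {z : Plane} (hz : z ∈ ellipse b) :
    ‖z‖ ^ 2 ≤ 1 - (1 - b ^ 2) * (1 - z 0 ^ 2) := by
  have := snd_sq_le_of_mem_ellipse hb0 hz
  rw [norm_sq_plane]
  linarith

theorem norm_le_one_of_mem_ellipse {b : ℝ} (hb0 : 0 < b) (hb1 : b < 1) {z : Plane}
    (hz : z ∈ ellipse b) : ‖z‖ ≤ 1 := by
  have h1 := norm_sq_le_of_mem_ellipse hb0 hz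
  have h2 := fst_sq_le_of_mem_ellipse hz
  have h3 : 0 ≤ (1 - b ^ 2) * (1 - z 0 ^ 2) := mul_nonneg (by nlinarith) (by linarith)
  exact abs_le_one_iff_mul_self_le_one.2 (by nlinarith) |>.trans' (le_abs_self _)

theorem isCompact_ellipse {b : ℝ} (hb0 : 0 < b) (hb1 : b < 1) : IsCompact (ellipse b) := by
  refine (isCompact_closedBall (0 : Plane) 1).of_isClosed_subset (isClosed_ellipse b) fun z hz => ?_
  rw [mem_closedBall_zero_iff]
  exact norm_le_one_of_mem_ellipse hb0 hb1 hz

theorem volume_ellipse {b : ℝ} (hb0 : 0 < b) :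
    volume (ellipse b) = ENNReal.ofReal (Real.pi * b) := by
  let D : ℝ → Set (ℝ × ℝ) := fun c => {p | p.1 ^ 2 + (p.2 / c) ^ 2 ≤ 1}
  have hD (c : ℝ) : MeasurableSet (D c) := measurableSet_le (by fun_prop) measurable_const
  have h1 : volume (D 1) = ENNReal.ofReal Real.pi := by
    have : toPair ⁻¹' D 1 = Metric.closedBall (0 : Plane) 1 := by
      ext z
      rw [mem_closedBall_zero_iff, ← abs_norm z, ← sq_le_one_iff_abs_le_one, norm_sq_plane]
      simp [D, toPair]
    rw [← measurePreserving_toPair.measure_preimage (hD 1).nullMeasurableSet, this,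
      EuclideanSpace.volume_closedBall_fin_two]
    simp
  have hpre : ellipse b = toPair ⁻¹' D b := rfl
  rw [hpre, measurePreserving_toPair.measure_preimage (hD b).nullMeasurableSet, mul_comm,
    ENNReal.ofReal_mul hb0.le, ← h1, Measure.volume_eq_prod, Measure.prod_apply (hD b),
    Measure.prod_apply (hD 1), ← lintegral_const_mul _ (measurable_measure_prodMk_left (hD 1))]
  refine lintegral_congr fun x => ?_
  have : Prod.mk x ⁻¹' D b = (fun y => 0 + b⁻¹ * y) ⁻¹' (Prod.mk x ⁻¹' D 1) := by
    ext y
    simp [D, div_eq_inv_mul]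
  rw [this, volume_affine_preimage (inv_pos.2 hb0).ne', inv_inv, abs_of_pos hb0]

theorem uniformEllipse_eq {b : ℝ} (hb0 : 0 < b) :
    uniformEllipse b = ENNReal.ofReal (1 / (Real.pi * b)) • volume.restrict (ellipse b) := by
  rw [uniformEllipse, ProbabilityTheory.cond, volume_ellipse hb0, one_div,
    ENNReal.ofReal_inv_of_pos (by positivity)]

theorem isProbabilityMeasure_uniformEllipse {b : ℝ} (hb0 : 0 < b) :
    IsProbabilityMeasure (uniformEllipse b) := by
  refine ProbabilityTheory.cond_isProbabilityMeasure_of_finite ?_ ?_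
  · rw [volume_ellipse hb0]
    simp only [ne_eq, ENNReal.ofReal_eq_zero, not_le]
    positivity
  · rw [volume_ellipse hb0]
    exact ENNReal.ofReal_ne_top

/-! ### Local coordinates at the poles -/

/-- The scaled local coordinates in the quadrant `i`. -/
def localCoord (ε : ℝ) (i : Fin 4) (z : Plane) : ℝ × ℝ :=
  ((1 - signX i * z 0 - z 1 ^ 2 / 2) / ε, signY i * z 1 / √ε)

/-- The points of the quadrant `i` with local coordinates in `A`. -/
def localSet (ε : ℝ) (i : Fin 4) (A : Set (ℝ × ℝ)) : Set Plane :=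
  {z | 0 < signX i * z 0 ∧ 0 < signY i * z 1 ∧ localCoord ε i z ∈ A}

theorem measurable_localCoord (ε : ℝ) (i : Fin 4) : Measurable (localCoord ε i) := by
  unfold localCoord
  have := measurable_coord 0
  have := measurable_coord 1
  fun_prop

theorem measurableSet_localSet (ε : ℝ) (i : Fin 4) {A : Set (ℝ × ℝ)} (hA : MeasurableSet A) :
    MeasurableSet (localSet ε i A) :=
  (measurableSet_lt measurable_const ((measurable_coord 0).const_mul _)).inter
    ((measurableSet_lt measurable_const ((measurable_coord 1).const_mul _)).inter
      (measurable_localCoord ε i hA))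

/-- The local coordinates of the points of the ellipse in a quadrant. -/
def ellipseRegion (b ε : ℝ) : Set (ℝ × ℝ) :=
  {p | 0 < p.2 ∧ ε * (p.1 + p.2 ^ 2 / 2) < 1 ∧
    p.2 ^ 2 ≤ b ^ 2 * (2 * (p.1 + p.2 ^ 2 / 2) - ε * (p.1 + p.2 ^ 2 / 2) ^ 2)}

theorem measurableSet_ellipseRegion (b ε : ℝ) : MeasurableSet (ellipseRegion b ε) :=
  have h1 : Measurable fun p : ℝ × ℝ => ε * (p.1 + p.2 ^ 2 / 2) := by fun_prop
  have h2 : Measurable fun p : ℝ × ℝ => p.2 ^ 2 := by fun_prop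
  have h3 : Measurable fun p : ℝ × ℝ =>
      b ^ 2 * (2 * (p.1 + p.2 ^ 2 / 2) - ε * (p.1 + p.2 ^ 2 / 2) ^ 2) := by fun_prop
  (measurableSet_lt measurable_const measurable_snd).inter
    ((measurableSet_lt h1 measurable_const).inter (measurableSet_le h2 h3))

/-- These formulas invert the local coordinates. Subtracting y²/2 instead of using the norm itself
keeps the coordinates polynomial, while their first entry still agrees with the scaled norm deficit
to leading order. -/
theorem localCoord_spec {ε : ℝ} (hε : 0 < ε) (i : Fin 4) (z : Plane) :
    signX i * z 0 = 1 - ε * ((localCoord ε i z).1 + (localCoord ε i z).2 ^ 2 / 2) ∧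
    signY i * z 1 = √ε * (localCoord ε i z).2 := by
  have hs : 0 < √ε := Real.sqrt_pos.2 hε
  have hsq : √ε ^ 2 = ε := Real.sq_sqrt hε.le
  have hy : signY i ^ 2 = 1 := by rcases signY_cases i with h | h <;> simp [h]
  simp only [localCoord]
  constructor
  · rw [div_pow, mul_pow, hy, hsq]
    field_simp
    ring
  · field_simp

/-- For fixed vertical coordinate the first local coordinate is affine in the horizontal one with
slope ±1/ε, and the second is a scaling by ±1/√ε; Tonelli multiplies the two factors. -/
theorem volume_localCoord_preimage {ε : ℝ} (hε : 0 < ε) (i : Fin 4) {B : Set (ℝ × ℝ)}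
    (hB : MeasurableSet B) :
    volume (localCoord ε i ⁻¹' B) = ENNReal.ofReal (ε * √ε) * volume B := by
  have hs : 0 < √ε := Real.sqrt_pos.2 hε
  have hx : signX i ≠ 0 := by rcases signX_cases i with h | h <;> simp [h]
  have hxa : |signX i| = 1 := by rcases signX_cases i with h | h <;> simp [h]
  have hy : signY i ≠ 0 := by rcases signY_cases i with h | h <;> simp [h]
  have hya : |signY i| = 1 := by rcases signY_cases i with h | h <;> simp [h]
  let f : ℝ × ℝ → ℝ × ℝ := fun p =>
    ((1 - signX i * p.1 - p.2 ^ 2 / 2) / ε, signY i * p.2 / √ε)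
  have hf : Measurable f := by fun_prop
  have hpre : localCoord ε i ⁻¹' B = toPair ⁻¹' (f ⁻¹' B) := rfl
  rw [hpre, measurePreserving_toPair.measure_preimage (hf hB).nullMeasurableSet,
    Measure.volume_eq_prod, Measure.prod_apply_symm (hf hB), Measure.prod_apply_symm hB]
  have hsec (y : ℝ) : volume ((fun x => (x, y)) ⁻¹' (f ⁻¹' B)) =
      ENNReal.ofReal ε * volume ((fun u => (u, signY i / √ε * y)) ⁻¹' B) := by
    have : (fun x => (x, y)) ⁻¹' (f ⁻¹' B) =
        (fun x => (1 - y ^ 2 / 2) / ε + -(signX i / ε) * x) ⁻¹'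
          ((fun u => (u, signY i / √ε * y)) ⁻¹' B) := by
      ext x
      have e : f (x, y) = ((1 - y ^ 2 / 2) / ε + -(signX i / ε) * x, signY i / √ε * y) := by
        simp only [f]
        refine Prod.ext ?_ ?_ <;> simp only <;> ring
      simp only [mem_preimage, e]
    rw [this, volume_affine_preimage (neg_ne_zero.2 (div_ne_zero hx hε.ne'))]
    congr 2
    rw [abs_inv, abs_neg, abs_div, hxa, abs_of_pos hε, one_div, inv_inv]
  have hmeas : Measurable fun w => volume ((fun u => (u, w)) ⁻¹' B) :=
    measurable_measure_prodMk_right hB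
  simp_rw [hsec]
  have hmeas' : Measurable fun y => volume ((fun u => (u, signY i / √ε * y)) ⁻¹' B) :=
    hmeas.comp (measurable_const_mul (signY i / √ε))
  rw [lintegral_const_mul _ hmeas',
    lintegral_comp_mul_left_real (div_ne_zero hy hs.ne') hmeas, ← mul_assoc,
    ← ENNReal.ofReal_mul hε.le]
  congr 3
  rw [abs_inv, abs_div, hya, abs_of_pos hs, one_div, inv_inv]

theorem ellipse_inter_localSet {b ε : ℝ} (hb0 : 0 < b) (hε : 0 < ε) (i : Fin 4)
    (A : Set (ℝ × ℝ)) :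
    ellipse b ∩ localSet ε i A = localCoord ε i ⁻¹' (A ∩ ellipseRegion b ε) := by
  ext z
  obtain ⟨e0, e1⟩ := localCoord_spec hε i z
  have hs : 0 < √ε := Real.sqrt_pos.2 hε
  have hsq : √ε ^ 2 = ε := Real.sq_sqrt hε.le
  have hx : signX i ^ 2 = 1 := by rcases signX_cases i with h | h <;> simp [h]
  have hy : signY i ^ 2 = 1 := by rcases signY_cases i with h | h <;> simp [h]
  have hz0 : z 0 ^ 2 = (signX i * z 0) ^ 2 := by rw [mul_pow, hx, one_mul]
  have hz1 : z 1 ^ 2 = (signY i * z 1) ^ 2 := by rw [mul_pow, hy, one_mul]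
  rw [mem_inter_iff, mem_ellipse_iff hb0, hz0, hz1]
  simp only [localSet, mem_ofPred_eq, e0, e1, mem_preimage, mem_inter_iff, ellipseRegion]
  set p := localCoord ε i z
  set S := p.1 + p.2 ^ 2 / 2
  have k1 : 0 < √ε * p.2 ↔ 0 < p.2 := mul_pos_iff_of_pos_left hs
  have k2 : (√ε * p.2) ^ 2 ≤ b ^ 2 * (1 - (1 - ε * S) ^ 2) ↔
      p.2 ^ 2 ≤ b ^ 2 * (2 * S - ε * S ^ 2) := by
    rw [mul_pow, hsq,
      show b ^ 2 * (1 - (1 - ε * S) ^ 2) = ε * (b ^ 2 * (2 * S - ε * S ^ 2)) by ring]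
    exact mul_le_mul_iff_right₀ hε
  rw [k1, k2, sub_pos]
  tauto

theorem uniformEllipse_localSet {b ε : ℝ} (hb0 : 0 < b) (hε : 0 < ε) (i : Fin 4)
    {A : Set (ℝ × ℝ)} (hA : MeasurableSet A) :
    (uniformEllipse b).real (localSet ε i A) =
      1 / (Real.pi * b) * (ε * √ε) * volume.real (A ∩ ellipseRegion b ε) := by
  rw [measureReal_def, uniformEllipse_eq hb0, Measure.smul_apply,
    Measure.restrict_apply (measurableSet_localSet ε i hA), inter_comm,
    ellipse_inter_localSet hb0 hε, volume_localCoord_preimage hε i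
      (hA.inter (measurableSet_ellipseRegion b ε)), smul_eq_mul, ENNReal.toReal_mul,
    ENNReal.toReal_mul, ENNReal.toReal_ofReal (by positivity),
    ENNReal.toReal_ofReal (by positivity), measureReal_def]
  ring

/-- Monotonicity in `ε` lets the rescaled areas converge by continuity from below. -/
theorem ellipseRegion_antitone (b : ℝ) {ε ε' : ℝ} (hε : 0 ≤ ε) (h : ε ≤ ε') :
    ellipseRegion b ε' ⊆ ellipseRegion b ε := by
  rintro p ⟨h1, h2, h3⟩
  set S := p.1 + p.2 ^ 2 / 2 with hS
  have h4 : 0 < b ^ 2 * (2 * S - ε' * S ^ 2) := lt_of_lt_of_le (by positivity) h3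
  have hb : 0 < b ^ 2 := by
    by_contra hb
    have : b ^ 2 = 0 := le_antisymm (not_lt.1 hb) (sq_nonneg b)
    simp [this] at h4
  have h5 : 0 < 2 * S - ε' * S ^ 2 := pos_of_mul_pos_right h4 hb.le
  have hε' : 0 ≤ ε' := hε.trans h
  -- Nonnegativity is forced by the ellipse inequality and makes `ε * S` monotone in `ε`.
  have hS0 : 0 ≤ S := by nlinarith [mul_nonneg hε' (sq_nonneg S)]
  refine ⟨h1, lt_of_le_of_lt (mul_le_mul_of_nonneg_right h hS0) h2, h3.trans ?_⟩
  refine mul_le_mul_of_nonneg_left ?_ hb.le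
  have := mul_le_mul_of_nonneg_right h (sq_nonneg S)
  change 2 * S - ε' * S ^ 2 ≤ 2 * S - ε * S ^ 2
  linarith

/-- The inequality on the right is the ellipse equation at ε = 0; collecting v² gives (1 - b²)v² <
2b²u, which explains the value of τ. -/
theorem mem_limitRegion_iff {b : ℝ} (hb0 : 0 < b) (hb1 : b < 1) {p : ℝ × ℝ} :
    p ∈ limitRegion (√2 * b / √(1 - b ^ 2)) ↔
      0 < p.2 ∧ p.2 ^ 2 < b ^ 2 * (2 * (p.1 + p.2 ^ 2 / 2)) := by
  have hb2 : 0 < 1 - b ^ 2 := by nlinarith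
  set τ := √2 * b / √(1 - b ^ 2) with hτ
  have hτ0 : 0 < τ := by positivity
  have hτ2 : τ ^ 2 = 2 * b ^ 2 / (1 - b ^ 2) := by
    rw [hτ, div_pow, mul_pow, Real.sq_sqrt (by norm_num), Real.sq_sqrt hb2.le]
  simp only [limitRegion, mem_ofPred_eq]
  refine and_congr_right fun h0 => ?_
  rw [← div_lt_iff₀' hτ0, Real.lt_sqrt (by positivity), div_pow, div_lt_iff₀ (by positivity), hτ2]
  rw [mul_div_assoc', lt_div_iff₀ hb2]
  constructor <;> intro h <;> linarith

theorem iUnion_ellipseRegion {b : ℝ} (hb0 : 0 < b) (hb1 : b < 1) {ε : ℕ → ℝ}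
    (hε : ∀ n, 0 < ε n) (hlim : Tendsto ε atTop (𝓝 0)) :
    ⋃ n, ellipseRegion b (ε n) = limitRegion (√2 * b / √(1 - b ^ 2)) := by
  ext p
  rw [mem_limitRegion_iff hb0 hb1, mem_iUnion]
  set S := p.1 + p.2 ^ 2 / 2 with hS
  constructor
  · rintro ⟨n, h1, h2, h3⟩
    refine ⟨h1, lt_of_le_of_lt h3 (mul_lt_mul_of_pos_left ?_ (by positivity))⟩
    have h4 : 0 < b ^ 2 * (2 * S - ε n * S ^ 2) := lt_of_lt_of_le (by positivity) h3
    have hS0 : S ≠ 0 := fun h => by simp [h] at h4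
    have : 0 < ε n * S ^ 2 := mul_pos (hε n) (by positivity)
    change 2 * S - ε n * S ^ 2 < 2 * S
    linarith
  · rintro ⟨h1, h2⟩
    have l1 : Tendsto (fun n => ε n * S) atTop (𝓝 0) := by
      simpa using hlim.mul_const S
    have l2 : Tendsto (fun n => b ^ 2 * (2 * S - ε n * S ^ 2)) atTop (𝓝 (b ^ 2 * (2 * S))) := by
      have := ((hlim.mul_const (S ^ 2)).const_sub (2 * S)).const_mul (b ^ 2)
      simpa using this
    obtain ⟨n, hn1, hn2⟩ := ((l1.eventually_lt_const one_pos).and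
      (l2.eventually_const_lt h2)).exists
    exact ⟨n, h1, hn1, hn2.le⟩

/-! ### Convergence of the rescaled intensities -/

/-- The scale `n^(-2/3)`. -/
def scale (n : ℕ) : ℝ := (n : ℝ) ^ (-(2 / 3) : ℝ)

theorem scale_pos {n : ℕ} (hn : 0 < n) : 0 < scale n := by
  unfold scale
  positivity

theorem scale_mul_sqrt {n : ℕ} (hn : 0 < n) : scale n * √(scale n) = (n : ℝ)⁻¹ := by
  have : (0 : ℝ) < n := by exact_mod_cast hn
  unfold scale
  rw [Real.sqrt_eq_rpow, ← Real.rpow_mul this.le, ← Real.rpow_add this, ← Real.rpow_neg_one]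
  norm_num

theorem rpow_eq_inv_scale (n : ℕ) : (n : ℝ) ^ (2 / 3 : ℝ) = (scale n)⁻¹ := by
  rw [scale, Real.rpow_neg (Nat.cast_nonneg n), inv_inv]

theorem tendsto_scale : Tendsto scale atTop (𝓝 0) :=
  (tendsto_rpow_neg_atTop (by norm_num)).comp tendsto_natCast_atTop_atTop

theorem scale_antitone {m n : ℕ} (hm : 0 < m) (h : m ≤ n) : scale n ≤ scale m := by
  unfold scale
  exact Real.rpow_le_rpow_of_nonpos (by exact_mod_cast hm) (by exact_mod_cast h) (by norm_num)

theorem tendsto_mul_uniformEllipse_localSet {b : ℝ} (hb0 : 0 < b) (hb1 : b < 1) (i : Fin 4)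
    {A : Set (ℝ × ℝ)} (hA : MeasurableSet A) (hfin : volume A ≠ ∞) :
    Tendsto (fun n : ℕ => n * (uniformEllipse b).real (localSet (scale n) i A)) atTop
      (𝓝 (1 / (Real.pi * b) * volume.real (A ∩ limitRegion (√2 * b / √(1 - b ^ 2))))) := by
  have hmono : Monotone fun n : ℕ => A ∩ ellipseRegion b (scale (n + 1)) := fun m n hmn =>
    inter_subset_inter_right A (ellipseRegion_antitone b (scale_pos n.succ_pos).le
      (scale_antitone m.succ_pos (Nat.succ_le_succ hmn)))
  have h1 := tendsto_measure_iUnion_atTop (μ := (volume : Measure (ℝ × ℝ))) hmono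
  rw [← inter_iUnion, iUnion_ellipseRegion hb0 hb1 (fun n => scale_pos n.succ_pos)
    (tendsto_scale.comp (tendsto_add_atTop_nat 1))] at h1
  have h2 := (ENNReal.tendsto_toReal (ne_top_of_le_ne_top hfin
    (measure_mono inter_subset_left))).comp h1
  -- The index is shifted because `scale 0 = 0` is not positive.
  rw [← tendsto_add_atTop_iff_nat 1]
  refine (h2.const_mul (1 / (Real.pi * b))).congr fun n => ?_
  rw [uniformEllipse_localSet hb0 (scale_pos n.succ_pos) i hA, scale_mul_sqrt n.succ_pos]
  have : ((n + 1 : ℕ) : ℝ) ≠ 0 := by positivity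
  simp only [Function.comp, measureReal_def]
  field_simp

/-! ### Distances in local coordinates -/

/-- The scaled difference between `2` and the distance of two points near opposite poles, as a
function of their local coordinates (with signed second coordinates). -/
def gap (ε : ℝ) (p q : ℝ × ℝ) : ℝ :=
  (4 * (p.1 + p.2 ^ 2 / 2 + (q.1 + q.2 ^ 2 / 2))
      - ε * (p.1 + p.2 ^ 2 / 2 + (q.1 + q.2 ^ 2 / 2)) ^ 2 - (p.2 - q.2) ^ 2) /
    (2 + √((2 - ε * (p.1 + p.2 ^ 2 / 2 + (q.1 + q.2 ^ 2 / 2))) ^ 2 + ε * (p.2 - q.2) ^ 2))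

/-- Rationalising 2 - D to (4 - D²)/(2 + D) cancels the division by ε, so `gap` extends to ε = 0.
There the curvature terms v²/2 + v'²/2 and the vertical contribution -(v - v')²/4 add up to (v +
v')²/4. -/
theorem gap_zero (p q : ℝ × ℝ) : gap 0 p q = p.1 + q.1 + (p.2 + q.2) ^ 2 / 4 := by
  have : √((2 : ℝ) ^ 2) = 2 := Real.sqrt_sq (by norm_num)
  simp only [gap, zero_mul, sub_zero, add_zero, this]
  ring

theorem continuous_gap : Continuous fun x : ℝ × (ℝ × ℝ) × (ℝ × ℝ) => gap x.1 x.2.1 x.2.2 := by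
  unfold gap
  refine Continuous.div (by fun_prop) (by fun_prop) fun x => ?_
  positivity

/-- Uniform continuity on a compact set allows `ε` to be replaced by 0 and each point by a neighbour
in its cell, at a total cost below `η`. The compact box is symmetric to accommodate the signs. -/
theorem gap_uniform (R : ℝ) {η : ℝ} (hη : 0 < η) : ∃ δ > 0, ∀ ε, 0 ≤ ε → ε < δ →
    ∀ s t : ℝ, |s| = 1 → |t| = 1 → ∀ p p' q q' : ℝ × ℝ,
      p ∈ Icc 0 R ×ˢ Icc 0 R → p' ∈ Icc 0 R ×ˢ Icc 0 R →
      q ∈ Icc 0 R ×ˢ Icc 0 R → q' ∈ Icc 0 R ×ˢ Icc 0 R →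
      dist p p' < δ → dist q q' < δ →
      |gap ε (p.1, s * p.2) (q.1, t * q.2) - gap 0 (p'.1, s * p'.2) (q'.1, t * q'.2)| < η := by
  have hK : IsCompact
      (Icc (0 : ℝ) 1 ×ˢ ((Icc (-R) R ×ˢ Icc (-R) R) ×ˢ (Icc (-R) R ×ˢ Icc (-R) R))) :=
    isCompact_Icc.prod ((isCompact_Icc.prod isCompact_Icc).prod (isCompact_Icc.prod isCompact_Icc))
  have hu := hK.uniformContinuousOn_of_continuous continuous_gap.continuousOn
  obtain ⟨δ, hδ, h⟩ := Metric.uniformContinuousOn_iff.1 hu η hη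
  refine ⟨min δ 1, lt_min hδ one_pos, fun ε h0 h1 s t hs ht p p' q q' hp hp' hq hq' hd hd' => ?_⟩
  have hbox : ∀ s : ℝ, |s| = 1 → ∀ p : ℝ × ℝ, p ∈ Icc 0 R ×ˢ Icc 0 R →
      (p.1, s * p.2) ∈ Icc (-R) R ×ˢ Icc (-R) R := by
    rintro s hs p ⟨⟨hp1, hp2⟩, hp3, hp4⟩
    have : |s * p.2| ≤ R := by rw [abs_mul, hs, one_mul, abs_of_nonneg hp3]; exact hp4
    exact ⟨⟨by simp only; linarith, hp2⟩, abs_le.1 this⟩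
  have hdist : ∀ s : ℝ, |s| = 1 → ∀ p p' : ℝ × ℝ, dist p p' < min δ 1 →
      dist (p.1, s * p.2) (p'.1, s * p'.2) < δ := by
    intro s hs p p' hd
    have : dist (s * p.2) (s * p'.2) = dist p.2 p'.2 := by
      rw [Real.dist_eq, ← mul_sub, abs_mul, hs, one_mul, Real.dist_eq]
    change max (dist p.1 p'.1) (dist (s * p.2) (s * p'.2)) < δ
    rw [this]
    exact hd.trans_le (min_le_left _ _)
  have h1' := h1.trans_le (min_le_right _ _)
  have := h (ε, (p.1, s * p.2), (q.1, t * q.2)) ⟨⟨h0, h1'.le⟩, hbox s hs p hp, hbox t ht q hq⟩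
    (0, (p'.1, s * p'.2), (q'.1, t * q'.2))
      ⟨⟨le_rfl, zero_le_one⟩, hbox s hs p' hp', hbox t ht q' hq'⟩
    (by
      rw [Prod.dist_eq, Prod.dist_eq]
      refine max_lt ?_ (max_lt (hdist s hs p p' hd) (hdist t ht q q' hd'))
      rw [Real.dist_eq, sub_zero, abs_of_nonneg h0]
      exact h1.trans_le (min_le_left _ _))
  rwa [Real.dist_eq] at this

theorem gap_localCoord {ε : ℝ} (hε : 0 < ε) {i j : Fin 4} (hi : signX i = 1) (hj : signX j = -1)
    (z w : Plane) :
    gap ε ((localCoord ε i z).1, signY i * (localCoord ε i z).2)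
      ((localCoord ε j w).1, signY j * (localCoord ε j w).2) = (2 - dist z w) / ε := by
  obtain ⟨e0, e1⟩ := localCoord_spec hε i z
  obtain ⟨f0, f1⟩ := localCoord_spec hε j w
  set p := localCoord ε i z
  set q := localCoord ε j w
  have hsq : √ε ^ 2 = ε := Real.sq_sqrt hε.le
  have hyi : signY i ^ 2 = 1 := by rcases signY_cases i with h | h <;> simp [h]
  have hyj : signY j ^ 2 = 1 := by rcases signY_cases j with h | h <;> simp [h]
  have z0 : z 0 = 1 - ε * (p.1 + p.2 ^ 2 / 2) := by rw [hi] at e0; linarith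
  have w0 : w 0 = -(1 - ε * (q.1 + q.2 ^ 2 / 2)) := by rw [hj] at f0; linarith
  have z1 : z 1 = √ε * (signY i * p.2) := by
    linear_combination signY i * e1 - z 1 * hyi
  have w1 : w 1 = √ε * (signY j * q.2) := by
    linear_combination signY j * f1 - w 1 * hyj
  simp only [gap, mul_pow, hyi, hyj, one_mul]
  set S := p.1 + p.2 ^ 2 / 2 + (q.1 + q.2 ^ 2 / 2) with hS
  set y := signY i * p.2
  set y' := signY j * q.2
  have hd : dist z w ^ 2 = (2 - ε * S) ^ 2 + ε * (y - y') ^ 2 := by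
    rw [dist_sq_plane, z0, w0, z1, w1, hS]
    linear_combination (y - y') ^ 2 * hsq
  rw [← hd, Real.sqrt_sq dist_nonneg, div_eq_div_iff (by positivity) hε.ne']
  linear_combination hd

/-! ### Localisation of distant pairs -/

/-- Norm above 1 - εt forces 1 - x² < εC with C = 2t/(1 - b²). Since y² ≤ 1 - x² in the ellipse,
this bounds both local coordinates independently of `ε`. -/
theorem mem_localSet_box {b ε t R : ℝ} (hb0 : 0 < b) (hb1 : b < 1) (hε : 0 < ε)
    (hR : 2 * t / (1 - b ^ 2) + 1 ≤ R) (ht : 0 < t) (hsmall : ε * (2 * t / (1 - b ^ 2)) < 1)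
    {z : Plane} (hz : z ∈ ellipse b) (hz1 : z 1 ≠ 0) (hnorm : 1 - ε * t < ‖z‖)
    (hεt : ε * t ≤ 1) :
    1 - z 0 ^ 2 < ε * (2 * t / (1 - b ^ 2)) ∧
      ∃ i, z ∈ localSet ε i (Icc 0 R ×ˢ Icc 0 R) := by
  set C := 2 * t / (1 - b ^ 2) with hC
  have hb2 : 0 < 1 - b ^ 2 := sub_pos.2 (pow_lt_one₀ hb0.le hb1 two_ne_zero)
  have hC0 : 0 < C := by positivity
  have h1 := norm_sq_le_of_mem_ellipse hb0 hz
  have h2 : (1 - ε * t) ^ 2 < ‖z‖ ^ 2 := pow_lt_pow_left₀ hnorm (by linarith) two_ne_zero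
  have h3 : (1 - b ^ 2) * (1 - z 0 ^ 2) < 2 * ε * t := by linarith [sq_nonneg (ε * t)]
  have h4 : 1 - z 0 ^ 2 < ε * C := by
    rw [hC, mul_div_assoc', lt_div_iff₀ hb2]
    linarith
  refine ⟨h4, ?_⟩
  have hz0 : z 0 ≠ 0 := fun h => by
    rw [h] at h4
    linarith
  obtain ⟨i, hi0, hi1⟩ : ∃ i, 0 < signX i * z 0 ∧ 0 < signY i * z 1 := by
    rcases lt_or_gt_of_ne hz0 with h | h <;> rcases lt_or_gt_of_ne hz1 with h' | h'
    · exact ⟨2, by simpa [signX] using h, by simpa [signY] using h'⟩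
    · exact ⟨1, by simpa [signX] using h, by simpa [signY] using h'⟩
    · exact ⟨3, by simpa [signX] using h, by simpa [signY] using h'⟩
    · exact ⟨0, by simpa [signX] using h, by simpa [signY] using h'⟩
  refine ⟨i, hi0, hi1, ?_⟩
  have hx2 : signX i ^ 2 = 1 := by rcases signX_cases i with h | h <;> simp [h]
  have hy2 : signY i ^ 2 = 1 := by rcases signY_cases i with h | h <;> simp [h]
  have hz0' : z 0 ^ 2 = (signX i * z 0) ^ 2 := by rw [mul_pow, hx2, one_mul]
  have hz1' : z 1 ^ 2 = (signY i * z 1) ^ 2 := by rw [mul_pow, hy2, one_mul]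
  have h5 := snd_sq_le_of_mem_ellipse hb0 hz
  have h6 := fst_sq_le_of_mem_ellipse hz
  have h7 : z 1 ^ 2 ≤ 1 - z 0 ^ 2 := by
    refine h5.trans (mul_le_of_le_one_left (by linarith) (by linarith))
  set X := signX i * z 0
  have hx1 : X ≤ 1 := le_of_abs_le ((sq_le_one_iff_abs_le_one _).1 (hz0' ▸ h6))
  have hs : 0 < √ε := Real.sqrt_pos.2 hε
  have hsq : √ε ^ 2 = ε := Real.sq_sqrt hε.le
  refine ⟨⟨?_, ?_⟩, ⟨?_, ?_⟩⟩ <;> simp only [localCoord]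
  · refine div_nonneg ?_ hε.le
    -- From y² ≤ 1 - X² one gets 1 - X - y²/2 ≥ (1 - X)²/2.
    linarith [sq_nonneg (1 - X)]
  · rw [div_le_iff₀ hε]
    have hX2 : X ^ 2 ≤ X := by
      rw [sq]
      exact mul_le_of_le_one_left hi0.le hx1
    have : ε * C ≤ R * ε := by
      rw [mul_comm]
      exact mul_le_mul_of_nonneg_right (by linarith) hε.le
    linarith [sq_nonneg (z 1)]
  · exact div_nonneg hi1.le hs.le
  · have hR0 : 0 ≤ R := by linarith
    rw [div_le_iff₀ hs]
    refine (abs_le_of_sq_le_sq' ?_ (mul_nonneg hR0 hs.le)).2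
    rw [← hz1', mul_pow, hsq]
    -- The summand 1 in `hR` guarantees R ≥ 1, hence C ≤ R ≤ R².
    have hCR : C ≤ R ^ 2 := by
      have : R ≤ R ^ 2 := le_self_pow₀ (by linarith) two_ne_zero
      linarith
    have := mul_le_mul_of_nonneg_left hCR hε.le
    linarith

/-- Both norms are at most 1, so a distance above 2 - εt forces each norm above 1 - εt, and both
points lie in boxes at the poles. Two points near the same pole are too close to each other. -/
theorem exists_opposite_boxes {b t R : ℝ} (hb0 : 0 < b) (hb1 : b < 1)
    (hR : 2 * t / (1 - b ^ 2) + 1 ≤ R) (ht : 0 < t) :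
    ∃ ε₀ > 0, ∀ ε, 0 < ε → ε < ε₀ → ∀ z w : Plane, z ∈ ellipse b → w ∈ ellipse b →
      z 1 ≠ 0 → w 1 ≠ 0 → 2 - ε * t < dist z w →
      ∃ i j, z ∈ localSet ε i (Icc 0 R ×ˢ Icc 0 R) ∧ w ∈ localSet ε j (Icc 0 R ×ˢ Icc 0 R) ∧
        (signX i = 1 ∧ signX j = -1 ∨ signX i = -1 ∧ signX j = 1) := by
  set C := 2 * t / (1 - b ^ 2) with hC
  have hb2 : 0 < 1 - b ^ 2 := sub_pos.2 (pow_lt_one₀ hb0.le hb1 two_ne_zero)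
  have hC0 : 0 < C := by positivity
  -- With εC and εt below 1/4, points on the same side have squared distance at most 5/2, less than
  -- the required (7/4)².
  refine ⟨min (1 / (4 * C)) (1 / (4 * t)), by positivity,
    fun ε hε hlt z w hz hw hz1 hw1 hd => ?_⟩
  have e1 : ε * C < 1 / 4 := by
    have := hlt.trans_le (min_le_left _ _)
    rw [lt_div_iff₀ (by positivity)] at this
    linarith
  have e2 : ε * t < 1 / 4 := by
    have := hlt.trans_le (min_le_right _ _)
    rw [lt_div_iff₀ (by positivity)] at this
    linarith
  have hnz := norm_le_one_of_mem_ellipse hb0 hb1 hz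
  have hnw := norm_le_one_of_mem_ellipse hb0 hb1 hw
  have htri : dist z w ≤ ‖z‖ + ‖w‖ := dist_le_norm_add_norm z w
  obtain ⟨hz0, i, hi⟩ := mem_localSet_box hb0 hb1 hε hR ht (by linarith) hz hz1 (by linarith)
    (by linarith)
  obtain ⟨hw0, j, hj⟩ := mem_localSet_box hb0 hb1 hε hR ht (by linarith) hw hw1 (by linarith)
    (by linarith)
  refine ⟨i, j, hi, hj, ?_⟩
  have hsame (hpos : 0 < z 0 * w 0) : False := by
    have h1 := snd_sq_le_of_mem_ellipse hb0 hz
    have h2 := snd_sq_le_of_mem_ellipse hb0 hw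
    have h1' := fst_sq_le_of_mem_ellipse hz
    have h2' := fst_sq_le_of_mem_ellipse hw
    have h3 : z 1 ^ 2 ≤ 1 - z 0 ^ 2 := h1.trans
      (mul_le_of_le_one_left (by linarith) (by linarith))
    have h4 : w 1 ^ 2 ≤ 1 - w 0 ^ 2 := h2.trans
      (mul_le_of_le_one_left (by linarith) (by linarith))
    have h5 : dist z w ^ 2 ≤ 2 + 2 * (1 / 4) := by
      rw [dist_sq_plane]
      linarith [sq_nonneg (z 1 + w 1)]
    have h6 : (2 - ε * t) ^ 2 < dist z w ^ 2 := pow_lt_pow_left₀ hd (by linarith) two_ne_zero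
    have h7 : (7 / 4 : ℝ) ^ 2 ≤ (2 - ε * t) ^ 2 :=
      pow_le_pow_left₀ (by norm_num) (by linarith) 2
    linarith
  rcases signX_cases i with h | h <;> rcases signX_cases j with h' | h'
  · refine (hsame ?_).elim
    have h3 := hi.1
    have h4 := hj.1
    rw [h, one_mul] at h3
    rw [h', one_mul] at h4
    exact mul_pos h3 h4
  · exact Or.inl ⟨h, h'⟩
  · exact Or.inr ⟨h, h'⟩
  · refine (hsame ?_).elim
    have h3 := hi.1
    have h4 := hj.1
    rw [h, neg_one_mul] at h3
    rw [h', neg_one_mul] at h4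
    exact mul_pos_of_neg_of_neg (neg_pos.1 h3) (neg_pos.1 h4)

theorem signX_eq_of_mem {ε ε' : ℝ} {i j : Fin 4} {A B : Set (ℝ × ℝ)} {z : Plane}
    (hi : z ∈ localSet ε i A) (hj : z ∈ localSet ε' j B) : signX i = signX j := by
  have h1 := hi.1
  have h2 := hj.1
  rcases signX_cases i with h | h <;> rcases signX_cases j with h' | h' <;>
    rw [h] at h1 ⊢ <;> rw [h'] at h2 ⊢ <;> linarith

/-! ### Partition of a box into cells -/

/-- The cell with index `(k, l)` of the partition of a box of side length `R` with mesh `δ`. -/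
def cell (R δ : ℝ) (k l : ℕ) : Set (ℝ × ℝ) :=
  {p | p ∈ Icc 0 R ×ˢ Icc 0 R ∧ ⌊p.1 / δ⌋₊ = k ∧ ⌊p.2 / δ⌋₊ = l}

theorem measurableSet_cell (R δ : ℝ) (k l : ℕ) : MeasurableSet (cell R δ k l) :=
  (measurableSet_Icc.prod measurableSet_Icc).inter
    (((Nat.measurable_floor.comp (measurable_fst.div_const δ)) (measurableSet_singleton k)).inter
      ((Nat.measurable_floor.comp (measurable_snd.div_const δ)) (measurableSet_singleton l)))

theorem abs_sub_lt_of_floor_eq {x y δ : ℝ} (hδ : 0 < δ) (hx : 0 ≤ x) (hy : 0 ≤ y)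
    (h : ⌊x / δ⌋₊ = ⌊y / δ⌋₊) : |x - y| < δ := by
  have h1 := Nat.floor_le (div_nonneg hx hδ.le)
  have h2 := Nat.lt_floor_add_one (x / δ)
  have h3 := Nat.floor_le (div_nonneg hy hδ.le)
  have h4 := Nat.lt_floor_add_one (y / δ)
  rw [h] at h1 h2
  rw [le_div_iff₀ hδ] at h1 h3
  rw [div_lt_iff₀ hδ] at h2 h4
  rw [abs_lt]
  constructor <;> linarith

theorem dist_lt_of_mem_cell {R δ : ℝ} (hδ : 0 < δ) {k l : ℕ} {p q : ℝ × ℝ}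
    (hp : p ∈ cell R δ k l) (hq : q ∈ cell R δ k l) : dist p q < δ := by
  obtain ⟨⟨⟨hp1, -⟩, hp2, -⟩, hp3, hp4⟩ := hp
  obtain ⟨⟨⟨hq1, -⟩, hq2, -⟩, hq3, hq4⟩ := hq
  rw [Prod.dist_eq]
  exact max_lt (abs_sub_lt_of_floor_eq hδ hp1 hq1 (hp3.trans hq3.symm))
    (abs_sub_lt_of_floor_eq hδ hp2 hq2 (hp4.trans hq4.symm))

theorem exists_mem_cell {R δ : ℝ} (hδ : 0 < δ) {p : ℝ × ℝ} (hp : p ∈ Icc 0 R ×ˢ Icc 0 R) :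
    ∃ k l : Fin (⌊R / δ⌋₊ + 1), p ∈ cell R δ k l := by
  have h1 : ⌊p.1 / δ⌋₊ < ⌊R / δ⌋₊ + 1 :=
    Nat.lt_succ_of_le (Nat.floor_le_floor (div_le_div_of_nonneg_right hp.1.2 hδ.le))
  have h2 : ⌊p.2 / δ⌋₊ < ⌊R / δ⌋₊ + 1 :=
    Nat.lt_succ_of_le (Nat.floor_le_floor (div_le_div_of_nonneg_right hp.2.2 hδ.le))
  exact ⟨⟨_, h1⟩, ⟨_, h2⟩, hp, rfl, rfl⟩

/-! ### The constants of the ellipse -/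

theorem tauConst_ellipse {b : ℝ} (hb0 : 0 < b) (hb1 : b < 1) :
    tauConst 1 (2 * b) = √2 * b / √(1 - b ^ 2) := by
  have hb2 : 0 < 1 - b ^ 2 := sub_pos.2 (pow_lt_one₀ hb0.le hb1 two_ne_zero)
  have h : √(4 - (2 * b) ^ 2) = 2 * √(1 - b ^ 2) := by
    rw [show 4 - (2 * b) ^ 2 = 2 ^ 2 * (1 - b ^ 2) by ring, Real.sqrt_mul (by norm_num),
      Real.sqrt_sq (by norm_num)]
  have hs : 0 < √(1 - b ^ 2) := Real.sqrt_pos.2 hb2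
  rw [tauConst, cConst, h, mul_one]
  field_simp

/-- Here c = (2/3)τ, and σ = (pc)^(-2/3) is precisely the value for which the Jacobian of
`normAngleMap` is the reciprocal of the density at the poles. -/
theorem constants_ellipse {b : ℝ} (hb0 : 0 < b) (hb1 : b < 1) :
    0 < sigmaConst 1 (2 * b) (1 / (Real.pi * b)) ∧ 0 < tauConst 1 (2 * b) ∧
    1 / (Real.pi * b) * (2 / 3 * tauConst 1 (2 * b) *
      sigmaConst 1 (2 * b) (1 / (Real.pi * b)) ^ (3 / 2 : ℝ)) = 1 := by
  have hb2 : 0 < 1 - b ^ 2 := sub_pos.2 (pow_lt_one₀ hb0.le hb1 two_ne_zero)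
  have hτ : 0 < tauConst 1 (2 * b) := by
    rw [tauConst_ellipse hb0 hb1]
    positivity
  have hc : cConst 1 (2 * b) = 2 / 3 * tauConst 1 (2 * b) := by
    rw [tauConst]
    ring
  have hc0 : 0 < cConst 1 (2 * b) := by
    rw [hc]
    positivity
  have hp : 0 < 1 / (Real.pi * b) * cConst 1 (2 * b) := by positivity
  refine ⟨Real.rpow_pos_of_pos hp _, hτ, ?_⟩
  rw [← hc, sigmaConst, ← Real.rpow_mul hp.le,
    show (-(2 / 3) * (3 / 2) : ℝ) = -1 by norm_num, Real.rpow_neg_one, ← mul_assoc,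
    mul_inv_cancel₀ hp.ne']

/-! ### The limit theorem for random measures with asymptotically Poisson void probabilities -/

section LimitTheorem

variable {b : ℝ} {Ω' : Type*} [MeasurableSpace Ω'] {P' : Measure Ω'}
  {Z : Fin 4 → Ω' → ℕ → ℝ × ℝ}

theorem limit_ae (hb0 : 0 < b) (hb1 : b < 1) (hZ : ∀ i, HasLaw (Z i) (normAngleLaw
      (sigmaConst 1 (2 * b) (1 / (Real.pi * b))) (tauConst 1 (2 * b))) P') :
    ∀ᵐ ω ∂P', ∀ i, (∀ k, 0 ≤ (Z i ω k).1 ∧ 0 ≤ (Z i ω k).2 ∧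
        (Z i ω k).2 ≤ tauConst 1 (2 * b) * √(Z i ω k).1) ∧
      Tendsto (fun k => (Z i ω k).1) atTop atTop := by
  obtain ⟨hσ, hτ, -⟩ := constants_ellipse hb0 hb1
  refine ae_all_iff.2 fun i => ?_
  have := normAngleLaw_ae hσ hτ
  rw [← (hZ i).map_eq] at this
  exact ae_of_ae_map (hZ i).aemeasurable this

theorem limit_void (hb0 : 0 < b) (hb1 : b < 1) (hind : iIndepFun Z P')
    (hZ : ∀ i, HasLaw (Z i) (normAngleLaw
      (sigmaConst 1 (2 * b) (1 / (Real.pi * b))) (tauConst 1 (2 * b))) P')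
    {A : Fin 4 → Set (ℝ × ℝ)} (hA : ∀ i, MeasurableSet (A i)) {R : ℝ}
    (hR : ∀ i, ∀ q ∈ A i, q.1 ≤ R) :
    P'.real {ω | ∀ i k, Z i ω k ∉ A i} = Real.exp (-∑ i, 1 / (Real.pi * b) *
      volume.real (A i ∩ limitRegion (tauConst 1 (2 * b)))) := by
  obtain ⟨hσ, hτ, hp⟩ := constants_ellipse hb0 hb1
  have hset (i : Fin 4) : MeasurableSet {z : ℕ → ℝ × ℝ | ∀ k, z k ∉ A i} := by
    have : {z : ℕ → ℝ × ℝ | ∀ k, z k ∉ A i} = ⋂ k, (fun z => z k) ⁻¹' (A i)ᶜ := by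
      ext
      simp
    rw [this]
    exact MeasurableSet.iInter fun k => measurable_pi_apply k (hA i).compl
  have h1 := hind.measure_inter_preimage_eq_mul Finset.univ
    (sets := fun i => {z : ℕ → ℝ × ℝ | ∀ k, z k ∉ A i}) fun i _ => hset i
  have h2 : {ω | ∀ i k, Z i ω k ∉ A i} =
      ⋂ i ∈ Finset.univ, Z i ⁻¹' {z : ℕ → ℝ × ℝ | ∀ k, z k ∉ A i} := by
    ext ω
    simp
  rw [measureReal_def, h2, h1, ENNReal.toReal_prod, ← Finset.sum_neg_distrib, Real.exp_sum]
  refine Finset.prod_congr rfl fun i _ => ?_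
  rw [← normAngleLaw_void hσ hτ hp (hA i) (hR i), ← (hZ i).map_eq, measureReal_def,
    Measure.map_apply_of_aemeasurable (hZ i).aemeasurable (hset i)]

theorem disjoint_localSet (ε : ℝ) (A : Fin 4 → Set (ℝ × ℝ)) :
    Pairwise (Function.onFun Disjoint fun i => localSet ε i (A i)) := by
  intro i j hij
  refine Set.disjoint_left.2 fun z hi hj => ?_
  obtain ⟨hi1, hi2, -⟩ := hi
  obtain ⟨hj1, hj2, -⟩ := hj
  fin_cases i <;> fin_cases j <;> simp [signX, signY] at hi1 hi2 hj1 hj2 hij <;> linarith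

theorem tendsto_mul_uniformEllipse_iUnion (hb0 : 0 < b) (hb1 : b < 1)
    {A : Fin 4 → Set (ℝ × ℝ)} (hA : ∀ i, MeasurableSet (A i)) (hfin : ∀ i, volume (A i) ≠ ∞) :
    Tendsto (fun n : ℕ => n * (uniformEllipse b).real (⋃ i, localSet (scale n) i (A i))) atTop
      (𝓝 (∑ i, 1 / (Real.pi * b) * volume.real (A i ∩ limitRegion (tauConst 1 (2 * b))))) := by
  have := isProbabilityMeasure_uniformEllipse hb0
  rw [tauConst_ellipse hb0 hb1]
  refine (tendsto_finsetSum Finset.univ fun i _ =>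
    tendsto_mul_uniformEllipse_localSet hb0 hb1 i (hA i) (hfin i)).congr fun n => ?_
  rw [← Finset.mul_sum, measureReal_def, measure_iUnion (disjoint_localSet _ A)
    fun i => measurableSet_localSet _ i (hA i), tsum_fintype,
    ENNReal.toReal_sum fun i _ => measure_ne_top _ _]
  rfl

theorem exists_charged_cell {ι : Type*} [Finite ι] {φ : Measure Plane} {A : Set Plane}
    (hA : φ A ≠ 0) (S : ι → Set Plane) (p : ι → Prop)
    (hcov : ∀ z ∈ A, ∃ x, p x ∧ z ∈ S x) : ∃ x, p x ∧ φ (A ∩ S x) ≠ 0 := by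
  by_contra! h
  refine hA (measure_mono_null (fun z hz => ?_)
    (measure_iUnion_null fun x : {x // p x} => h x.1 x.2))
  obtain ⟨x, hx, hzx⟩ := hcov z hz
  exact mem_iUnion.2 ⟨⟨x, hx⟩, hz, hzx⟩

/-- If a measure on the ellipse charges two sets whose points are far apart, it charges cells
that contain distant points near the right and the left pole. -/
theorem exists_charged_cells {φ : Measure Plane} {E : Set Plane} (hE : φ Eᶜ = 0) {ε R δ s : ℝ}
    (hδ : 0 < δ)
    (hbox : ∀ z ∈ E, ∀ w ∈ E, 2 - dist z w < s →
      ∃ i j, z ∈ localSet ε i (Icc 0 R ×ˢ Icc 0 R) ∧ w ∈ localSet ε j (Icc 0 R ×ˢ Icc 0 R) ∧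
        (signX i = 1 ∧ signX j = -1 ∨ signX i = -1 ∧ signX j = 1))
    {A B : Set Plane} (hA : φ A ≠ 0) (hB : φ B ≠ 0) (hAB : ∀ z ∈ A, ∀ w ∈ B, 2 - dist z w < s) :
    ∃ x y : Fin 4 × Fin (⌊R / δ⌋₊ + 1) × Fin (⌊R / δ⌋₊ + 1), signX x.1 = 1 ∧ signX y.1 = -1 ∧
      φ (localSet ε x.1 (cell R δ x.2.1 x.2.2)) ≠ 0 ∧
      φ (localSet ε y.1 (cell R δ y.2.1 y.2.2)) ≠ 0 ∧
      ∃ z ∈ localSet ε x.1 (cell R δ x.2.1 x.2.2), ∃ w ∈ localSet ε y.1 (cell R δ y.2.1 y.2.2),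
        2 - dist z w < s := by
  have hA' : φ (A ∩ E) ≠ 0 := by rwa [measure_inter_conull hE]
  have hB' : φ (B ∩ E) ≠ 0 := by rwa [measure_inter_conull hE]
  have h11 : (1 : ℝ) ≠ -1 := by norm_num
  obtain ⟨z₀, hz₀A, hz₀E⟩ := nonempty_of_measure_ne_zero hA'
  obtain ⟨w₀, hw₀B, hw₀E⟩ := nonempty_of_measure_ne_zero hB'
  have hcell : ∀ (i : Fin 4) (z : Plane), z ∈ localSet ε i (Icc 0 R ×ˢ Icc 0 R) →
      ∃ x : Fin 4 × Fin (⌊R / δ⌋₊ + 1) × Fin (⌊R / δ⌋₊ + 1), signX x.1 = signX i ∧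
        z ∈ localSet ε x.1 (cell R δ x.2.1 x.2.2) := by
    rintro i z ⟨h1, h2, h3⟩
    obtain ⟨k, l, hkl⟩ := exists_mem_cell hδ h3
    exact ⟨(i, k, l), rfl, h1, h2, hkl⟩
  have hpair : ∀ z ∈ A ∩ E, ∀ w ∈ B ∩ E,
      ∃ x y : Fin 4 × Fin (⌊R / δ⌋₊ + 1) × Fin (⌊R / δ⌋₊ + 1),
        z ∈ localSet ε x.1 (cell R δ x.2.1 x.2.2) ∧ w ∈ localSet ε y.1 (cell R δ y.2.1 y.2.2) ∧
        (signX x.1 = 1 ∧ signX y.1 = -1 ∨ signX x.1 = -1 ∧ signX y.1 = 1) := by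
    intro z hz w hw
    obtain ⟨i, j, hi, hj, hij⟩ := hbox z hz.2 w hw.2 (hAB z hz.1 w hw.1)
    obtain ⟨x, hx, hx'⟩ := hcell i z hi
    obtain ⟨y, hy, hy'⟩ := hcell j w hj
    exact ⟨x, y, hx', hy', by rwa [hx, hy]⟩
  -- One reference pair fixes the sides: every point of `A ∩ E` is opposite to `w₀` and every point
  -- of `B ∩ E` opposite to `z₀`, so each of these sets stays near a single pole.
  obtain ⟨x₀, y₀, hx₀, hy₀, hxy₀⟩ := hpair z₀ ⟨hz₀A, hz₀E⟩ w₀ ⟨hw₀B, hw₀E⟩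
  have hcovA : ∀ z ∈ A ∩ E, ∃ x : Fin 4 × Fin (⌊R / δ⌋₊ + 1) × Fin (⌊R / δ⌋₊ + 1),
      signX x.1 = signX x₀.1 ∧ z ∈ localSet ε x.1 (cell R δ x.2.1 x.2.2) := by
    intro z hz
    obtain ⟨x, y, hx, hy, hxy⟩ := hpair z hz w₀ ⟨hw₀B, hw₀E⟩
    refine ⟨x, ?_, hx⟩
    have hyy := signX_eq_of_mem hy hy₀
    rw [hyy] at hxy
    rcases hxy with ⟨h1, h2⟩ | ⟨h1, h2⟩ <;> rcases hxy₀ with ⟨h3, h4⟩ | ⟨h3, h4⟩ <;>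
      rw [h1, h3] <;> linarith
  have hcovB : ∀ w ∈ B ∩ E, ∃ y : Fin 4 × Fin (⌊R / δ⌋₊ + 1) × Fin (⌊R / δ⌋₊ + 1),
      signX y.1 = signX y₀.1 ∧ w ∈ localSet ε y.1 (cell R δ y.2.1 y.2.2) := by
    intro w hw
    obtain ⟨x, y, hx, hy, hxy⟩ := hpair z₀ ⟨hz₀A, hz₀E⟩ w hw
    refine ⟨y, ?_, hy⟩
    have hyy := signX_eq_of_mem hx hx₀
    rw [hyy] at hxy
    rcases hxy with ⟨h1, h2⟩ | ⟨h1, h2⟩ <;> rcases hxy₀ with ⟨h3, h4⟩ | ⟨h3, h4⟩ <;>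
      rw [h2, h4] <;> linarith
  obtain ⟨x, hx, hxφ⟩ := exists_charged_cell hA'
    (fun x : Fin 4 × Fin (⌊R / δ⌋₊ + 1) × Fin (⌊R / δ⌋₊ + 1) =>
      localSet ε x.1 (cell R δ x.2.1 x.2.2)) (fun x => signX x.1 = signX x₀.1) hcovA
  obtain ⟨y, hy, hyφ⟩ := exists_charged_cell hB'
    (fun x : Fin 4 × Fin (⌊R / δ⌋₊ + 1) × Fin (⌊R / δ⌋₊ + 1) =>
      localSet ε x.1 (cell R δ x.2.1 x.2.2)) (fun y => signX y.1 = signX y₀.1) hcovB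
  obtain ⟨z, hzA, hzx⟩ := nonempty_of_measure_ne_zero hxφ
  obtain ⟨w, hwB, hwy⟩ := nonempty_of_measure_ne_zero hyφ
  have hzw := hAB z hzA.1 w hwB.1
  have hxφ' := fun h => hxφ (measure_mono_null inter_subset_right h)
  have hyφ' := fun h => hyφ (measure_mono_null inter_subset_right h)
  -- If `A` is at the left pole, the two cells exchange roles.
  rcases hxy₀ with ⟨h3, h4⟩ | ⟨h3, h4⟩
  · exact ⟨x, y, hx.trans h3, hy.trans h4, hxφ', hyφ', z, hzx, w, hwy, hzw⟩
  · refine ⟨y, x, hy.trans h4, hx.trans h3, hyφ', hxφ', w, hwy, z, hzx, ?_⟩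
    rwa [dist_comm]

theorem measurableSet_ellipse_offAxis (b : ℝ) :
    MeasurableSet (ellipse b ∩ {z : Plane | z 1 ≠ 0})ᶜ :=
  ((measurableSet_ellipse b).inter
    (measurableSet_eq_fun (measurable_coord 1) measurable_const).compl).compl

/-- The horizontal axis is null, so the points may be assumed to lie off it; near the poles they
then belong to one of the open quadrants. -/
theorem uniformEllipse_compl (hb0 : 0 < b) :
    uniformEllipse b (ellipse b ∩ {z : Plane | z 1 ≠ 0})ᶜ = 0 := by
  have hline : volume {z : Plane | z 1 = 0} = 0 := by
    have : {z : Plane | z 1 = 0} = toPair ⁻¹' (univ ×ˢ {0}) := by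
      ext z
      simp [toPair]
    rw [this, measurePreserving_toPair.measure_preimage
      (MeasurableSet.univ.prod (measurableSet_singleton 0)).nullMeasurableSet,
      Measure.volume_eq_prod, Measure.prod_prod]
    simp
  rw [uniformEllipse_eq hb0, Measure.smul_apply, Measure.restrict_apply
    (measurableSet_ellipse_offAxis b)]
  have : volume ((ellipse b ∩ {z : Plane | z 1 ≠ 0})ᶜ ∩ ellipse b) = 0 := by
    refine measure_mono_null (fun z hz => ?_) hline
    by_contra h
    exact hz.1 ⟨hz.2, h⟩
  rw [this, smul_zero]

variable {Ω : ℕ → Type*} [∀ n, MeasurableSpace (Ω n)] {P : (n : ℕ) → Measure (Ω n)}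
  [∀ n, IsProbabilityMeasure (P n)] {φ : (n : ℕ) → Ω n → Measure Plane}
  {W : (n : ℕ) → Ω n → ℝ}

theorem aemeasurable_limitMin (hZ : ∀ i, AEMeasurable (Z i) P') :
    AEMeasurable (fun ω => limitMin 1 fun i => Z i ω) P' := by
  have hcoord (i : Fin 4) (k : ℕ) : AEMeasurable (fun ω => Z i ω k) P' :=
    (measurable_pi_apply k).comp_aemeasurable (hZ i)
  have h1 (i : Fin 4) (k : ℕ) : AEMeasurable (fun ω => (Z i ω k).1) P' := (hcoord i k).fst
  have h2 (i : Fin 4) (k : ℕ) : AEMeasurable (fun ω => (Z i ω k).2) P' := (hcoord i k).snd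
  have hadd (i j : Fin 4) : AEMeasurable (fun ω => minAdd 1 (Z i ω) (Z j ω)) P' := by
    refine AEMeasurable.iInf fun kl => ?_
    have := h1 i kl.1
    have := h1 j kl.2
    have := h2 i kl.1
    have := h2 j kl.2
    simp only [termAdd]
    fun_prop
  have hsub (i j : Fin 4) : AEMeasurable (fun ω => minSub 1 (Z i ω) (Z j ω)) P' := by
    refine AEMeasurable.iInf fun kl => ?_
    have := h1 i kl.1
    have := h1 j kl.2
    have := h2 i kl.1
    have := h2 j kl.2
    simp only [termSub]
    fun_prop
  exact ((hadd 0 1).min (hsub 0 2)).min ((hsub 1 3).min (hadd 2 3))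

/-- The vectors of occupied cells converge in distribution. -/
theorem tendsto_occupied_cells [IsProbabilityMeasure P'] (hb0 : 0 < b)
    (hb1 : b < 1) (hind : iIndepFun Z P')
    (hZ : ∀ i, HasLaw (Z i) (normAngleLaw
      (sigmaConst 1 (2 * b) (1 / (Real.pi * b))) (tauConst 1 (2 * b))) P')
    (hφ : ∀ n A, MeasurableSet A → AEMeasurable (fun ω => φ n ω A) (P n))
    (hvoid : ∀ A : ℕ → Set Plane, (∀ n, MeasurableSet (A n)) → ∀ l : ℝ,
      Tendsto (fun n : ℕ => n * (uniformEllipse b).real (A n)) atTop (𝓝 l) →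
      Tendsto (fun n => (P n).real {ω | φ n ω (A n) = 0}) atTop (𝓝 (Real.exp (-l))))
    (R δ : ℝ) (N : ℕ) (Q : Fin 4 × Fin N × Fin N → Fin 4 × Fin N × Fin N → Prop) :
    Tendsto (fun n => (P n).real {ω | ∃ x y, Q x y ∧
        φ n ω (localSet (scale n) x.1 (cell R δ x.2.1 x.2.2)) ≠ 0 ∧
        φ n ω (localSet (scale n) y.1 (cell R δ y.2.1 y.2.2)) ≠ 0}) atTop
      (𝓝 (P'.real {ω | ∃ x y, Q x y ∧ (∃ k, Z x.1 ω k ∈ cell R δ x.2.1 x.2.2) ∧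
        ∃ l, Z y.1 ω l ∈ cell R δ y.2.1 y.2.2})) := by
  refine tendsto_occupied_pair (ι := Fin 4 × Fin N × Fin N)
    (χ := fun n ω x => φ n ω (localSet (scale n) x.1 (cell R δ x.2.1 x.2.2)) ≠ 0)
    (χ' := fun ω x => ∃ k, Z x.1 ω k ∈ cell R δ x.2.1 x.2.2) ?_ ?_ (fun J => ?_) Q
  · intro n
    refine aemeasurable_pi_iff.2 fun x => ?_
    have h := hφ n _ (measurableSet_localSet (scale n) x.1 (measurableSet_cell R δ x.2.1 x.2.2))
    have hne : Measurable fun c : ℝ≥0∞ => c ≠ 0 :=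
      measurableSet_setOfPred.1 (measurableSet_singleton 0).compl
    have h' : AEMeasurable (fun ω =>
        φ n ω (localSet (scale n) x.1 (cell R δ x.2.1 x.2.2)) ≠ 0) (P n) :=
      hne.comp_aemeasurable h
    exact h'
  · refine aemeasurable_pi_iff.2 fun x => ?_
    have hmeas : Measurable fun z : ℕ → ℝ × ℝ => ∃ k, z k ∈ cell R δ x.2.1 x.2.2 := by
      refine Measurable.exists fun k => measurableSet_setOfPred.1 ?_
      exact measurable_pi_apply k (measurableSet_cell R δ x.2.1 x.2.2)
    exact hmeas.comp_aemeasurable (hZ x.1).aemeasurable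
  -- Regrouping the cells of `J` by quadrant turns their joint emptiness into the emptiness of a
  -- single set, whose void probability has a known limit.
  · let A : Fin 4 → Set (ℝ × ℝ) := fun i => ⋃ x ∈ J, ⋃ _ : x.1 = i, cell R δ x.2.1 x.2.2
    have hAm (i : Fin 4) : MeasurableSet (A i) :=
      Finset.measurableSet_biUnion J fun x _ => MeasurableSet.iUnion fun _ =>
        measurableSet_cell R δ x.2.1 x.2.2
    have hAsub (i : Fin 4) : A i ⊆ Icc 0 R ×ˢ Icc 0 R :=
      iUnion₂_subset fun x _ => iUnion_subset fun _ => fun p hp => hp.1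
    have hAfin (i : Fin 4) : volume (A i) ≠ ∞ :=
      ne_top_of_le_ne_top (isCompact_Icc.prod isCompact_Icc).measure_ne_top
        (measure_mono (hAsub i))
    have h1 : {ω | ∀ x ∈ J, ¬ ∃ k, Z x.1 ω k ∈ cell R δ x.2.1 x.2.2} =
        {ω | ∀ i k, Z i ω k ∉ A i} := by
      ext ω
      simp only [A, mem_ofPred_eq, mem_iUnion, not_exists]
      constructor
      · rintro h i k x hx rfl
        exact h x hx k
      · intro h x hx k
        exact h x.1 k x hx rfl
    have h2 (n : ℕ) : {ω | ∀ x ∈ J,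
        ¬ φ n ω (localSet (scale n) x.1 (cell R δ x.2.1 x.2.2)) ≠ 0} =
        {ω | φ n ω (⋃ i, localSet (scale n) i (A i)) = 0} := by
      ext ω
      simp only [mem_ofPred_eq, not_not, measure_iUnion_null_iff]
      constructor
      · intro h i
        have hsub : localSet (scale n) i (A i) ⊆
            ⋃ x ∈ J, localSet (scale n) x.1 (cell R δ x.2.1 x.2.2) := by
          rintro z ⟨hz1, hz2, hz3⟩
          simp only [A, mem_iUnion] at hz3
          obtain ⟨x, hx, rfl, hzx⟩ := hz3
          exact mem_iUnion₂.2 ⟨x, hx, hz1, hz2, hzx⟩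
        refine measure_mono_null hsub ?_
        exact (measure_biUnion_null_iff J.countable_toSet).2 h
      · intro h x hx
        refine measure_mono_null ?_ (h x.1)
        rintro z ⟨hz1, hz2, hz3⟩
        exact ⟨hz1, hz2, mem_iUnion₂.2 ⟨x, hx, mem_iUnion.2 ⟨rfl, hz3⟩⟩⟩
    simp_rw [h2]
    rw [h1, limit_void hb0 hb1 hind hZ hAm fun i q hq => (hAsub i hq).1.2]
    exact hvoid _ (fun n => MeasurableSet.iUnion fun i => measurableSet_localSet _ i (hAm i)) _
      (tendsto_mul_uniformEllipse_iUnion hb0 hb1 hAm hAfin)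

/-- A limit theorem for random measures with asymptotically Poisson void probabilities. -/
theorem tendstoInDistribution_limitMin [IsProbabilityMeasure P'] (hb0 : 0 < b)
    (hb1 : b < 1) (hind : iIndepFun Z P')
    (hZ : ∀ i, HasLaw (Z i) (normAngleLaw
      (sigmaConst 1 (2 * b) (1 / (Real.pi * b))) (tauConst 1 (2 * b))) P')
    (hφ : ∀ n A, MeasurableSet A → AEMeasurable (fun ω => φ n ω A) (P n))
    (hnull : ∀ n A, MeasurableSet A → uniformEllipse b A = 0 → ∀ᵐ ω ∂P n, φ n ω A = 0)
    (hvoid : ∀ A : ℕ → Set Plane, (∀ n, MeasurableSet (A n)) → ∀ l : ℝ,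
      Tendsto (fun n : ℕ => n * (uniformEllipse b).real (A n)) atTop (𝓝 l) →
      Tendsto (fun n => (P n).real {ω | φ n ω (A n) = 0}) atTop (𝓝 (Real.exp (-l))))
    (hW : ∀ n, AEMeasurable (W n) (P n))
    (hWlt : ∀ t, ∀ᶠ n in atTop, ∀ᵐ ω ∂P n, W n ω < t ↔ ∃ A B, φ n ω A ≠ 0 ∧ φ n ω B ≠ 0 ∧
      ∀ z ∈ A, ∀ w ∈ B, 2 - dist z w < scale n * t) :
    TendstoInDistribution W atTop (fun ω => limitMin 1 fun i => Z i ω) P P' := by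
  obtain ⟨hσ, hτ, -⟩ := constants_ellipse hb0 hb1
  have hlim := limit_ae hb0 hb1 hZ
  -- Both comparisons pass through an event on occupied cells. The upper one uses the level s + η
  -- and spends η on each side; the lower one uses the level s, with no loss for the limit process
  -- and η for finite `n`.
  have key : ∀ s t : ℝ, s < t →
      (∃ (a : ℕ → ℝ) (a' : ℝ), Tendsto a atTop (𝓝 a') ∧
        (∀ᶠ n in atTop, (P n).real {ω | W n ω < s} ≤ a n) ∧
        a' ≤ P'.real {ω | (limitMin 1 fun i => Z i ω) < t}) ∧
      (∃ (a : ℕ → ℝ) (a' : ℝ), Tendsto a atTop (𝓝 a') ∧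
        P'.real {ω | (limitMin 1 fun i => Z i ω) < s} ≤ a' ∧
        (∀ᶠ n in atTop, a n ≤ (P n).real {ω | W n ω < t})) := by
    intro s t hst
    set η := (t - s) / 2 with hη
    have hη0 : 0 < η := by linarith
    set T := |s| + 1 with hT
    have hT0 : 0 < T := by positivity
    have hsT : s < T := (le_abs_self s).trans_lt (lt_add_one _)
    have hb2 : 0 < 1 - b ^ 2 := sub_pos.2 (pow_lt_one₀ hb0.le hb1 two_ne_zero)
    -- The first two summands localise distant pairs of sample points; `T` and `τ√T` bound the two
    -- coordinates of limit points with norm part below `T`.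
    set R := 2 * T / (1 - b ^ 2) + 1 + T + tauConst 1 (2 * b) * √T with hR
    have hC0 : 0 < 2 * T / (1 - b ^ 2) := by positivity
    have hτT : 0 < tauConst 1 (2 * b) * √T := mul_pos hτ (Real.sqrt_pos.2 hT0)
    obtain ⟨δ, hδ, hgap⟩ := gap_uniform R hη0
    obtain ⟨ε₀, hε₀, hbox⟩ := exists_opposite_boxes hb0 hb1
      (show 2 * T / (1 - b ^ 2) + 1 ≤ R by linarith) hT0
    have hsmall : ∀ᶠ n in atTop, 0 < scale n ∧ scale n < δ ∧ scale n < ε₀ := by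
      filter_upwards [eventually_gt_atTop 0, tendsto_scale.eventually_lt_const hδ,
        tendsto_scale.eventually_lt_const hε₀] with n h1 h2 h3
      exact ⟨scale_pos h1, h2, h3⟩
    have hsgn (i : Fin 4) : |signY i| = 1 := by rcases signY_cases i with h | h <;> simp [h]
    let ι := Fin 4 × Fin (⌊R / δ⌋₊ + 1) × Fin (⌊R / δ⌋₊ + 1)
    let Q : ℝ → ι → ι → Prop := fun r x y => signX x.1 = 1 ∧ signX y.1 = -1 ∧
      ∃ p ∈ cell R δ x.2.1 x.2.2, ∃ q ∈ cell R δ y.2.1 y.2.2,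
        gap 0 (p.1, signY x.1 * p.2) (q.1, signY y.1 * q.2) < r
    have hocc (r : ℝ) := tendsto_occupied_cells (Z := Z) hb0 hb1 hind hZ hφ hvoid R δ _ (Q r)
    refine ⟨⟨_, _, hocc (s + η), ?_, ?_⟩, ⟨_, _, hocc s, ?_, ?_⟩⟩
    · filter_upwards [hsmall, hWlt s] with n ⟨hn0, hnδ, hnε⟩ hn
      refine ENNReal.toReal_mono (measure_ne_top _ _) (measure_mono_ae ?_)
      filter_upwards [hn, hnull n _ (measurableSet_ellipse_offAxis b) (uniformEllipse_compl hb0)]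
        with ω hω hωE hlt
      obtain ⟨A, B, hA, hB, hAB⟩ := hω.1 hlt
      obtain ⟨x, y, hx, hy, hxφ, hyφ, z, hz, w, hw, hzw⟩ := exists_charged_cells hωE hδ
        (fun z hz w hw h => hbox (scale n) hn0 hnε z w hz.1 hw.1 hz.2 hw.2
          (by linarith [mul_lt_mul_of_pos_left hsT hn0])) hA hB hAB
      refine ⟨x, y, ⟨hx, hy, _, hz.2.2, _, hw.2.2, ?_⟩, hxφ, hyφ⟩
      have h1 := hgap (scale n) hn0.le hnδ (signY x.1) (signY y.1) (hsgn _) (hsgn _) _ _ _ _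
        hz.2.2.1 hz.2.2.1 hw.2.2.1 hw.2.2.1 (by rwa [dist_self]) (by rwa [dist_self])
      rw [gap_localCoord hn0 hx hy] at h1
      have h2 : (2 - dist z w) / scale n < s := by
        rw [div_lt_iff₀ hn0]
        linarith
      linarith [(abs_lt.1 h1).1]
    · refine ENNReal.toReal_mono (measure_ne_top _ _) (measure_mono_ae ?_)
      filter_upwards [hlim] with ω hω
      rintro ⟨x, y, ⟨hx, hy, p, hp, q, hq, hpq⟩, ⟨k, hk⟩, l, hl⟩
      refine (limitMin_lt_iff fun i k => ((hω i).1 k).1).2 ⟨x.1, y.1, hx, hy, k, l, ?_⟩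
      have h1 := hgap 0 le_rfl hδ (signY x.1) (signY y.1) (hsgn _) (hsgn _) _ _ _ _
        hk.1 hp.1 hl.1 hq.1 (dist_lt_of_mem_cell hδ hk hp) (dist_lt_of_mem_cell hδ hl hq)
      have h2 := (abs_lt.1 h1).2
      rw [gap_zero (_, signY x.1 * (Z x.1 ω k).2)] at h2
      simp only at h2
      linarith
    · refine ENNReal.toReal_mono (measure_ne_top _ _) (measure_mono_ae ?_)
      filter_upwards [hlim] with ω hω hlt
      obtain ⟨i, j, hi, hj, k, l, hkl⟩ := (limitMin_lt_iff fun i k => ((hω i).1 k).1).1 hlt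
      have hsq := sq_nonneg (signY i * (Z i ω k).2 + signY j * (Z j ω l).2)
      have hin : ∀ i k, (Z i ω k).1 < T → Z i ω k ∈ Icc 0 R ×ˢ Icc 0 R := by
        intro i k hlt
        obtain ⟨h1, h2, h3⟩ := (hω i).1 k
        refine ⟨⟨h1, by linarith⟩, h2, ?_⟩
        have := mul_le_mul_of_nonneg_left (Real.sqrt_le_sqrt hlt.le) hτ.le
        linarith
      have h1 := ((hω i).1 k).1
      have h2 := ((hω j).1 l).1
      obtain ⟨a, a', ha⟩ := exists_mem_cell hδ (hin i k (by linarith))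
      obtain ⟨c, c', hc⟩ := exists_mem_cell hδ (hin j l (by linarith))
      refine ⟨(i, a, a'), (j, c, c'), ⟨hi, hj, _, ha, _, hc, ?_⟩, ⟨k, ha⟩, l, hc⟩
      rw [gap_zero]
      exact hkl
    · filter_upwards [hsmall, hWlt t] with n ⟨hn0, hnδ, hnε⟩ hn
      refine ENNReal.toReal_mono (measure_ne_top _ _) (measure_mono_ae ?_)
      filter_upwards [hn] with ω hω
      rintro ⟨x, y, ⟨hx, hy, p, hp, q, hq, hpq⟩, hxφ, hyφ⟩
      refine hω.2 ⟨_, _, hxφ, hyφ, fun z hz w hw => ?_⟩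
      have h1 := hgap (scale n) hn0.le hnδ (signY x.1) (signY y.1) (hsgn _) (hsgn _) _ _ _ _
        hz.2.2.1 hp.1 hw.2.2.1 hq.1 (dist_lt_of_mem_cell hδ hz.2.2 hp)
        (dist_lt_of_mem_cell hδ hw.2.2 hq)
      rw [gap_localCoord hn0 hx hy] at h1
      have h2 : (2 - dist z w) / scale n < t := by linarith [(abs_lt.1 h1).2]
      rw [div_lt_iff₀ hn0] at h2
      linarith
  refine tendstoInDistribution_of_squeeze hW (aemeasurable_limitMin fun i => (hZ i).aemeasurable)
    (fun s t hst c hc => ?_) (fun s t hst c hc => ?_)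
  · obtain ⟨⟨a, a', ha, h1, h2⟩, -⟩ := key s t hst
    filter_upwards [h1, ha.eventually_lt_const (h2.trans_lt hc)] with n hn1 hn2
    exact hn1.trans_lt hn2
  · obtain ⟨-, ⟨a, a', ha, h1, h2⟩⟩ := key s t hst
    filter_upwards [h2, ha.eventually_const_lt (hc.trans_le h1)] with n hn1 hn2
    exact hn2.trans_le hn1

end LimitTheorem

/-! ### Poisson processes -/

theorem lt_supportDiam {φ : Measure Plane} {d : ℝ} (hφ : Bornology.IsBounded φ.support)
    {A B : Set Plane} (hA : φ A ≠ 0) (hB : φ B ≠ 0)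
    (hAB : ∀ z ∈ A, ∀ w ∈ B, d < dist z w) : d < supportDiam φ := by
  obtain ⟨z, hzA, hz⟩ := Measure.nonempty_inter_support_of_pos (pos_iff_ne_zero.2 hA)
  obtain ⟨w, hwB, hw⟩ := Measure.nonempty_inter_support_of_pos (pos_iff_ne_zero.2 hB)
  exact (hAB z hzA w hwB).trans_le (Metric.dist_le_diam_of_mem hφ hz hw)

/-- Two distant support points have basic neighbourhoods that are still far apart. Countability of
the basis makes the event measurable, and the pair of sets is what the general limit theorem asks
for. -/
theorem exists_basis_of_lt_supportDiam {φ : Measure Plane} {d : ℝ} (hd : 0 ≤ d)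
    (h : d < supportDiam φ) :
    ∃ A ∈ TopologicalSpace.countableBasis Plane, ∃ B ∈ TopologicalSpace.countableBasis Plane,
      (∀ z ∈ A, ∀ w ∈ B, d < dist z w) ∧ φ A ≠ 0 ∧ φ B ≠ 0 := by
  obtain ⟨z, hz, w, hw, hzw⟩ : ∃ z ∈ φ.support, ∃ w ∈ φ.support, d < dist z w := by
    by_contra! hle
    exact h.not_ge (Metric.diam_le_of_forall_dist_le hd hle)
  have hr : 0 < (dist z w - d) / 2 := by linarith
  have hb := TopologicalSpace.isBasis_countableBasis Plane
  obtain ⟨A, hA, hzA, hAU⟩ := hb.mem_nhds_iff.1 (Metric.ball_mem_nhds z hr)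
  obtain ⟨B, hB, hwB, hBV⟩ := hb.mem_nhds_iff.1 (Metric.ball_mem_nhds w hr)
  have hA0 : 0 < φ A :=
    (Measure.mem_support_iff_forall z).1 hz A ((hb.isOpen hA).mem_nhds hzA)
  have hB0 : 0 < φ B :=
    (Measure.mem_support_iff_forall w).1 hw B ((hb.isOpen hB).mem_nhds hwB)
  refine ⟨A, hA, B, hB, fun z' hz' w' hw' => ?_, hA0.ne', hB0.ne'⟩
  have h1 := Metric.mem_ball.1 (hAU hz')
  have h2 := Metric.mem_ball.1 (hBV hw')
  rw [dist_comm] at h1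
  linarith [dist_triangle4 z z' w' w]

/-- `Metric.diam` is 0 on unbounded sets, so diameters are compared with charged pairs only for
measures carried by a bounded set. The indicator enforces this and changes the Poisson process only
on a null event. -/
theorem measurable_indicator_supportDiam {K : Set Plane} (hK : IsClosed K)
    (hK' : Bornology.IsBounded K) :
    Measurable ({φ : Measure Plane | φ Kᶜ = 0}.indicator supportDiam) := by
  have hnull {A : Set Plane} (hA : MeasurableSet A) :
      MeasurableSet {φ : Measure Plane | φ A = 0} :=
    Measure.measurable_coe hA (measurableSet_singleton 0)
  have hcov {A : Set Plane} (hA : A ∈ TopologicalSpace.countableBasis Plane) :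
      MeasurableSet A :=
    ((TopologicalSpace.isBasis_countableBasis Plane).isOpen hA).measurableSet
  refine measurable_of_Ioi fun d => ?_
  rcases lt_or_ge d 0 with hd | hd
  · convert! MeasurableSet.univ using 1
    refine eq_univ_of_forall fun φ => ?_
    exact hd.trans_le (indicator_nonneg (fun _ _ => Metric.diam_nonneg) φ)
  · have : {φ : Measure Plane | φ Kᶜ = 0}.indicator supportDiam ⁻¹' Ioi d =
        {φ : Measure Plane | φ Kᶜ = 0} ∩
          ⋃ A ∈ TopologicalSpace.countableBasis Plane,
          ⋃ B ∈ TopologicalSpace.countableBasis Plane,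
          ⋃ _ : ∀ z ∈ A, ∀ w ∈ B, d < dist z w,
            {φ : Measure Plane | φ A = 0}ᶜ ∩ {φ : Measure Plane | φ B = 0}ᶜ := by
      ext φ
      by_cases hφ : φ ∈ {φ : Measure Plane | φ Kᶜ = 0}
      · rw [mem_preimage, indicator_of_mem hφ, mem_Ioi, mem_inter_iff, and_iff_right hφ]
        simp only [mem_iUnion]
        constructor
        · intro h
          obtain ⟨A, hA, B, hB, hAB, h1, h2⟩ := exists_basis_of_lt_supportDiam hd h
          exact ⟨A, hA, B, hB, hAB, h1, h2⟩
        · rintro ⟨A, hA, B, hB, hAB, h1, h2⟩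
          exact lt_supportDiam (hK'.subset (Measure.support_subset_of_isClosed hK hφ)) h1 h2 hAB
      · rw [mem_preimage, indicator_of_notMem hφ, mem_Ioi]
        exact iff_of_false hd.not_gt fun h => hφ h.1
    rw [this]
    have hc := TopologicalSpace.countable_countableBasis Plane
    exact (hnull hK.measurableSet.compl).inter <| MeasurableSet.biUnion hc fun A hA =>
      MeasurableSet.biUnion hc fun B hB => MeasurableSet.iUnion fun _ =>
        (hnull (hcov hA)).compl.inter (hnull (hcov hB)).compl

theorem IsPoissonProcess.measure_void {E Ω : Type*} [MeasurableSpace E] [MeasurableSpace Ω]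
    {Φ : Ω → Measure E} {μ : Measure E} {P : Measure Ω} (h : IsPoissonProcess Φ μ P)
    {B : Set E} (hB : MeasurableSet B) (hμ : μ B ≠ ∞) :
    P {ω | Φ ω B = 0} = ENNReal.ofReal (Real.exp (-μ.real B)) := by
  have h0 : MeasurableSet {x : ℝ≥0∞ | x = 0} := measurableSet_singleton 0
  have hpre : (fun k : ℕ => (k : ℝ≥0∞)) ⁻¹' {x : ℝ≥0∞ | x = 0} = {0} := by
    ext k
    simp
  rw [(h.hasLaw B hB hμ).measure_eq (p := fun x => x = 0) h0,
    Measure.map_apply .of_discrete h0, hpre, poissonMeasure_singleton]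
  simp [measureReal_def, ENNReal.coe_toNNReal_eq_toReal]

/-- The limit theorem for the diameter of Poisson processes in the ellipse. -/
theorem tendstoInDistribution_supportDiam {b : ℝ} (hb0 : 0 < b) (hb1 : b < 1)
    {Ω' : Type*} [MeasurableSpace Ω'] {P' : Measure Ω'} [IsProbabilityMeasure P']
    {Z : Fin 4 → Ω' → ℕ → ℝ × ℝ} (hind : iIndepFun Z P')
    (hZ : ∀ i, HasLaw (Z i) (normAngleLaw
      (sigmaConst 1 (2 * b) (1 / (Real.pi * b))) (tauConst 1 (2 * b))) P')
    {Ω : ℕ → Type*} [∀ n, MeasurableSpace (Ω n)] {P : (n : ℕ) → Measure (Ω n)}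
    [∀ n, IsProbabilityMeasure (P n)] {Φ : (n : ℕ) → Ω n → Measure Plane}
    (hΦ : ∀ n : ℕ, IsPoissonProcess (Φ n) ((n : ℝ≥0∞) • uniformEllipse b) (P n)) :
    TendstoInDistribution
      (fun (n : ℕ) ω => (n : ℝ) ^ (2 / 3 : ℝ) * (2 - supportDiam (Φ n ω)))
      atTop (fun ω => limitMin 1 fun i => Z i ω) P P' := by
  have := isProbabilityMeasure_uniformEllipse hb0
  have hmeas (n : ℕ) {A : Set Plane} (hA : MeasurableSet A) : Measurable fun ω => Φ n ω A :=
    (Measure.measurable_coe hA).comp (hΦ n).measurable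
  have hfin (n : ℕ) (A : Set Plane) : ((n : ℝ≥0∞) • uniformEllipse b) A ≠ ∞ :=
    ENNReal.mul_ne_top (ENNReal.natCast_ne_top n) (measure_ne_top _ _)
  have hreal (n : ℕ) (A : Set Plane) :
      ((n : ℝ≥0∞) • uniformEllipse b).real A = n * (uniformEllipse b).real A := by
    simp [measureReal_def]
  have hnull (n : ℕ) (A : Set Plane) (hA : MeasurableSet A) (h : uniformEllipse b A = 0) :
      ∀ᵐ ω ∂P n, Φ n ω A = 0 := by
    have h1 : P n {ω | Φ n ω A = 0} = 1 := by
      rw [(hΦ n).measure_void hA (hfin n A), hreal, measureReal_def, h]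
      simp
    exact (mem_ae_iff_prob_eq_one (hmeas n hA (measurableSet_singleton 0))).2 h1
  have hcl := isClosed_ellipse (b := b)
  have hbd := (isCompact_ellipse hb0 hb1).isBounded
  have hsupp (n : ℕ) : ∀ᵐ ω ∂P n, Φ n ω (ellipse b)ᶜ = 0 := by
    filter_upwards [hnull n _ (measurableSet_ellipse_offAxis b) (uniformEllipse_compl hb0)]
      with ω hω
    exact measure_mono_null (compl_subset_compl.2 inter_subset_left) hω
  refine tendstoInDistribution_limitMin (φ := Φ) hb0 hb1 hind hZ
    (fun n A hA => (hmeas n hA).aemeasurable) hnull (fun A hA l hl => ?_) (fun n => ?_)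
    fun t => ?_
  · have h1 (n : ℕ) : (P n).real {ω | Φ n ω (A n) = 0} =
        Real.exp (-(n * (uniformEllipse b).real (A n))) := by
      rw [measureReal_def, (hΦ n).measure_void (hA n) (hfin n _), hreal,
        ENNReal.toReal_ofReal (Real.exp_nonneg _)]
    simp_rw [h1]
    exact (Real.continuous_exp.tendsto _).comp hl.neg
  · have h1 : AEMeasurable (fun ω => supportDiam (Φ n ω)) (P n) := by
      refine ⟨_, (measurable_indicator_supportDiam hcl hbd).comp (hΦ n).measurable, ?_⟩
      filter_upwards [hsupp n] with ω hω
      exact (indicator_of_mem (s := {φ : Measure Plane | φ (ellipse b)ᶜ = 0}) hω _).symm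
    fun_prop
  · have h2 : Tendsto (fun n => 2 - scale n * t) atTop (𝓝 2) := by
      simpa using (tendsto_scale.mul_const t).const_sub 2
    -- Eventually the threshold is positive, so exceeding it cannot fail to produce two distant
    -- support points.
    filter_upwards [eventually_gt_atTop 0, h2.eventually_const_lt two_pos] with n hn hd
    filter_upwards [hsupp n] with ω hω
    have h3 : (n : ℝ) ^ (2 / 3 : ℝ) * (2 - supportDiam (Φ n ω)) < t ↔
        2 - scale n * t < supportDiam (Φ n ω) := by
      rw [rpow_eq_inv_scale, inv_mul_lt_iff₀ (scale_pos hn), sub_lt_comm]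
    rw [h3]
    constructor
    · intro h
      obtain ⟨A, -, B, -, hAB, hA, hB⟩ := exists_basis_of_lt_supportDiam hd.le h
      exact ⟨A, B, hA, hB, fun z hz w hw => sub_lt_comm.1 (hAB z hz w hw)⟩
    · rintro ⟨A, B, hA, hB, hAB⟩
      exact lt_supportDiam (hbd.subset (Measure.support_subset_of_isClosed hcl hω)) hA hB
        fun z hz w hw => sub_lt_comm.1 (hAB z hz w hw)

/-! ### Independent points -/

theorem sum_dirac_ne_zero_iff {ι : Type*} {s : Finset ι} {x : ι → Plane} {A : Set Plane} :
    (∑ i ∈ s, Measure.dirac (x i)) A ≠ 0 ↔ ∃ i ∈ s, x i ∈ A := by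
  simp [Measure.dirac_apply, Finset.sum_eq_zero_iff]

theorem maxDist_eq_iSup {Ω : Type*} (X : ℕ → Ω → Plane) (n : ℕ) (ω : Ω) :
    maxDist X n ω =
      ⨆ p : {p : ℕ × ℕ // p.1 < p.2 ∧ p.2 < n}, ‖X p.1.1 ω - X p.1.2 ω‖ := by
  rw [maxDist, iSup]
  congr 1
  ext d
  simp only [mem_ofPred_eq, mem_range, Subtype.exists, Prod.exists]
  constructor
  · rintro ⟨i, j, hij, hj, rfl⟩
    exact ⟨i, j, ⟨hij, hj⟩, rfl⟩
  · rintro ⟨i, j, ⟨hij, hj⟩, rfl⟩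
    exact ⟨i, j, hij, hj, rfl⟩

/-- The condition `2 ≤ n` makes the index set nonempty, and `0 ≤ d` rules out coinciding indices. -/
theorem lt_maxDist_iff {Ω : Type*} (X : ℕ → Ω → Plane) {n : ℕ} (hn : 2 ≤ n) (ω : Ω) {d : ℝ}
    (hd : 0 ≤ d) :
    d < maxDist X n ω ↔ ∃ i < n, ∃ j < n, d < dist (X i ω) (X j ω) := by
  have hfin : {p : ℕ × ℕ | p.1 < p.2 ∧ p.2 < n}.Finite :=
    ((finite_Iio n).prod (finite_Iio n)).subset fun p hp => ⟨hp.1.trans hp.2, hp.2⟩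
  have : Finite {p : ℕ × ℕ // p.1 < p.2 ∧ p.2 < n} := hfin
  have : Nonempty {p : ℕ × ℕ // p.1 < p.2 ∧ p.2 < n} := ⟨⟨(0, 1), one_pos, hn⟩⟩
  rw [maxDist_eq_iSup, lt_ciSup_iff (finite_range _).bddAbove]
  constructor
  · rintro ⟨⟨⟨i, j⟩, hij, hj⟩, h⟩
    exact ⟨i, hij.trans hj, j, hj, by rwa [dist_eq_norm]⟩
  · rintro ⟨i, hi, j, hj, h⟩
    rcases lt_trichotomy i j with hij | rfl | hij
    · exact ⟨⟨(i, j), hij, hj⟩, by rwa [dist_eq_norm] at h⟩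
    · rw [dist_self] at h
      exact absurd h hd.not_gt
    · exact ⟨⟨(j, i), hij, hi⟩, by rwa [dist_comm, dist_eq_norm] at h⟩

/-- The limit theorem for the largest distance between independent points in the ellipse. -/
theorem tendstoInDistribution_maxDist {b : ℝ} (hb0 : 0 < b) (hb1 : b < 1)
    {Ω' : Type*} [MeasurableSpace Ω'] {P' : Measure Ω'} [IsProbabilityMeasure P']
    {Z : Fin 4 → Ω' → ℕ → ℝ × ℝ} (hind : iIndepFun Z P')
    (hZ : ∀ i, HasLaw (Z i) (normAngleLaw
      (sigmaConst 1 (2 * b) (1 / (Real.pi * b))) (tauConst 1 (2 * b))) P')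
    {Ω : Type*} [MeasurableSpace Ω] {P : Measure Ω} [IsProbabilityMeasure P]
    {X : ℕ → Ω → Plane} (hX : iIndepFun X P) (hlaw : ∀ i, HasLaw (X i) (uniformEllipse b) P) :
    TendstoInDistribution
      (fun (n : ℕ) ω => (n : ℝ) ^ (2 / 3 : ℝ) * (2 - maxDist X n ω))
      atTop (fun ω => limitMin 1 fun i => Z i ω) (fun _ => P) P' := by
  have := isProbabilityMeasure_uniformEllipse hb0
  -- The sum of point masses charges exactly the sets that contain one of the first `n` points;
  -- singletons then witness distant pairs.
  let φ : ℕ → Ω → Measure Plane := fun n ω => ∑ i ∈ Finset.range n, Measure.dirac (X i ω)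
  have hφ (n : ℕ) (ω : Ω) (A : Set Plane) : φ n ω A ≠ 0 ↔ ∃ i < n, X i ω ∈ A := by
    simp only [φ, sum_dirac_ne_zero_iff, Finset.mem_range]
  have hφ0 (n : ℕ) (ω : Ω) (A : Set Plane) : φ n ω A = 0 ↔ ∀ i < n, X i ω ∉ A := by
    rw [← not_iff_not, ← ne_eq, hφ]
    push Not
    rfl
  refine tendstoInDistribution_limitMin (φ := φ) (P := fun _ => P) hb0 hb1 hind hZ
    (fun n A hA => ?_) (fun n A hA h => ?_) (fun A hA l hl => ?_) (fun n => ?_) fun t => ?_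
  · have h1 (i : ℕ) : AEMeasurable (fun ω => A.indicator (1 : Plane → ℝ≥0∞) (X i ω)) P :=
      (measurable_one.indicator hA).comp_aemeasurable (hlaw i).aemeasurable
    have h2 : (fun ω => φ n ω A) =
        fun ω => ∑ i ∈ Finset.range n, A.indicator (1 : Plane → ℝ≥0∞) (X i ω) := by
      ext ω
      simp [φ, Measure.dirac_apply]
    rw [h2]
    exact Finset.aemeasurable_fun_sum _ fun i _ => h1 i
  · have h1 (i : ℕ) : ∀ᵐ ω ∂P, X i ω ∉ A := by
      have h2 : ∀ᵐ z ∂P.map (X i), z ∉ A := by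
        rw [(hlaw i).map_eq]
        exact measure_eq_zero_iff_ae_notMem.1 h
      exact ae_of_ae_map (hlaw i).aemeasurable h2
    filter_upwards [ae_all_iff.2 h1] with ω hω
    exact (hφ0 n ω A).2 fun i _ => hω i
  · have h1 (n : ℕ) : P.real {ω | φ n ω (A n) = 0} =
        (1 + -(uniformEllipse b).real (A n)) ^ n := by
      have h2 : {ω | φ n ω (A n) = 0} = ⋂ i ∈ Finset.range n, X i ⁻¹' (A n)ᶜ := by
        ext ω
        simp [hφ0]
      have h3 (i : ℕ) : P (X i ⁻¹' (A n)ᶜ) = uniformEllipse b (A n)ᶜ := by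
        rw [← (hlaw i).map_eq, Measure.map_apply_of_aemeasurable (hlaw i).aemeasurable
          (hA n).compl]
      have h4 : (uniformEllipse b (A n)ᶜ).toReal = 1 + -(uniformEllipse b).real (A n) := by
        rw [← measureReal_def, probReal_compl_eq_one_sub (hA n), sub_eq_add_neg]
      rw [measureReal_def, h2, hX.measure_inter_preimage_eq_mul _ fun i _ => (hA n).compl]
      simp_rw [h3]
      rw [Finset.prod_const, Finset.card_range, ENNReal.toReal_pow, h4]
    simp_rw [h1]
    -- This is (1 + xₙ)^n → e^(-l) for n·xₙ → -l.
    refine Real.tendsto_one_add_pow_exp_of_tendsto ?_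
    simpa using hl.neg
  · have h1 : AEMeasurable (fun ω => maxDist X n ω) P := by
      simp_rw [maxDist_eq_iSup]
      refine AEMeasurable.iSup fun p => ?_
      exact ((hlaw p.1.1).aemeasurable.sub (hlaw p.1.2).aemeasurable).norm
    fun_prop
  · have h2 : Tendsto (fun n => 2 - scale n * t) atTop (𝓝 2) := by
      simpa using (tendsto_scale.mul_const t).const_sub 2
    filter_upwards [eventually_ge_atTop 2, h2.eventually_const_lt two_pos] with n hn hd
    refine ae_of_all _ fun ω => ?_
    have h3 : (n : ℝ) ^ (2 / 3 : ℝ) * (2 - maxDist X n ω) < t ↔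
        2 - scale n * t < maxDist X n ω := by
      rw [rpow_eq_inv_scale, inv_mul_lt_iff₀ (scale_pos (by omega)), sub_lt_comm]
    rw [h3, lt_maxDist_iff X hn ω hd.le]
    simp only [hφ]
    constructor
    · rintro ⟨i, hi, j, hj, h⟩
      refine ⟨{X i ω}, {X j ω}, ⟨i, hi, rfl⟩, ⟨j, hj, rfl⟩, ?_⟩
      rintro z rfl w rfl
      exact sub_lt_comm.1 h
    · rintro ⟨A, B, ⟨i, hi, hiA⟩, ⟨j, hj, hjB⟩, hAB⟩
      exact ⟨i, hi, j, hj, sub_lt_comm.1 (hAB _ hiA _ hjB)⟩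

/-! ### The interior of the ellipse -/

theorem tendsto_smul_plane (z : Plane) (s : Set ℝ) :
    Tendsto (fun t : ℝ => t • z) (𝓝[s] 1) (𝓝 z) := by
  have h : Continuous fun t : ℝ => t • z := by fun_prop
  have h1 := h.tendsto 1
  rw [one_smul] at h1
  exact h1.mono_left nhdsWithin_le_nhds

theorem ellipse_form_smul (b t : ℝ) (z : Plane) :
    (t • z) 0 ^ 2 + ((t • z) 1 / b) ^ 2 = t ^ 2 * (z 0 ^ 2 + (z 1 / b) ^ 2) := by
  simp only [PiLp.smul_apply, smul_eq_mul]
  ring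

/-- Dilating an interior point by a factor slightly above 1 stays in the set, while the quadratic
form grows by the square of that factor; so the form cannot equal 1 there. -/
theorem interior_ellipse (b : ℝ) :
    interior (ellipse b) = {z | z 0 ^ 2 + (z 1 / b) ^ 2 < 1} := by
  refine Subset.antisymm (fun z hz => ?_) (interior_maximal ?_ ?_)
  · have h1 := (tendsto_smul_plane z (Ioi 1)).eventually (mem_interior_iff_mem_nhds.1 hz)
    obtain ⟨t, ht, ht1⟩ := (h1.and self_mem_nhdsWithin).exists
    have h2 : (t • z) 0 ^ 2 + ((t • z) 1 / b) ^ 2 ≤ 1 := ht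
    rw [ellipse_form_smul] at h2
    by_contra h3
    have h4 : 1 ≤ z 0 ^ 2 + (z 1 / b) ^ 2 := not_lt.1 h3
    have h5 : 1 < t ^ 2 := one_lt_pow₀ ht1 two_ne_zero
    have h6 := mul_le_mul_of_nonneg_left h4 (sq_nonneg t)
    linarith
  · intro z hz
    have h : z 0 ^ 2 + (z 1 / b) ^ 2 < 1 := hz
    exact h.le
  · exact isOpen_lt (by fun_prop) continuous_const

theorem ellipse_subset_closure_interior (b : ℝ) : ellipse b ⊆ closure (interior (ellipse b)) := by
  intro z hz
  refine mem_closure_of_tendsto (tendsto_smul_plane z (Iio 1)) ?_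
  filter_upwards [Ioo_mem_nhdsLT (zero_lt_one' ℝ)] with t ht
  rw [interior_ellipse]
  change (t • z) 0 ^ 2 + ((t • z) 1 / b) ^ 2 < 1
  rw [ellipse_form_smul]
  have h1 : z 0 ^ 2 + (z 1 / b) ^ 2 ≤ 1 := hz
  have h2 : t ^ 2 < 1 := pow_lt_one₀ ht.1.le ht.2 two_ne_zero
  have h3 := mul_le_mul_of_nonneg_left h1 (sq_nonneg t)
  linarith

theorem mem_interior_ellipse_iff {b : ℝ} (hb0 : 0 < b) {z : Plane} :
    z ∈ interior (ellipse b) ↔ -(b * √(1 - z 0 ^ 2)) < z 1 ∧ z 1 < b * √(1 - z 0 ^ 2) := by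
  have h1 : b * √(1 - z 0 ^ 2) = √(b ^ 2 * (1 - z 0 ^ 2)) := by
    rw [Real.sqrt_mul (sq_nonneg b), Real.sqrt_sq hb0.le]
  rw [interior_ellipse, ← abs_lt, h1, Real.lt_sqrt (abs_nonneg _), sq_abs]
  change z 0 ^ 2 + (z 1 / b) ^ 2 < 1 ↔ _
  rw [← lt_sub_iff_add_lt', div_pow, div_lt_iff₀ (by positivity), mul_comm]

theorem fst_sq_lt_of_mem_interior_ellipse {b : ℝ} {z : Plane} (hz : z ∈ interior (ellipse b)) :
    z 0 ^ 2 < 1 := by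
  rw [interior_ellipse] at hz
  have h : z 0 ^ 2 + (z 1 / b) ^ 2 < 1 := hz
  linarith [sq_nonneg (z 1 / b)]

/-! ### The uniform distribution in the ellipse -/

theorem support_uniformEllipse {b : ℝ} (hb0 : 0 < b) :
    (uniformEllipse b).support = ellipse b := by
  refine Subset.antisymm (Measure.support_subset_of_isClosed (isClosed_ellipse b) ?_) ?_
  · exact measure_mono_null (compl_subset_compl.2 inter_subset_left) (uniformEllipse_compl hb0)
  · intro z hz
    refine (Measure.mem_support_iff_forall z).2 fun U hU => ?_
    obtain ⟨V, hVU, hV, hzV⟩ := mem_nhds_iff.1 hU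
    have hne : (V ∩ interior (ellipse b)).Nonempty :=
      mem_closure_iff.1 (ellipse_subset_closure_interior b hz) V hV hzV
    have hpos := (hV.inter isOpen_interior).measure_pos volume hne
    refine lt_of_lt_of_le ?_ (measure_mono hVU)
    rw [uniformEllipse_eq hb0, Measure.smul_apply, Measure.restrict_apply hV.measurableSet]
    refine ENNReal.mul_pos ?_ ?_
    · simp only [ne_eq, ENNReal.ofReal_eq_zero, not_le]
      positivity
    · exact (hpos.trans_le (measure_mono (inter_subset_inter_right _ interior_subset))).ne'

theorem uniformEllipse_eq_withDensity {b : ℝ} (hb0 : 0 < b) :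
    uniformEllipse b = volume.withDensity (fun z => ENNReal.ofReal (ellipseDensity b z)) := by
  have h : (fun z => ENNReal.ofReal (ellipseDensity b z)) =
      (ellipse b).indicator fun _ => ENNReal.ofReal (1 / (Real.pi * b)) := by
    ext z
    by_cases hz : z ∈ ellipse b
    · rw [ellipseDensity, indicator_of_mem hz, indicator_of_mem hz]
    · rw [ellipseDensity, indicator_of_notMem hz, indicator_of_notMem hz, ENNReal.ofReal_zero]
  rw [h, withDensity_indicator (measurableSet_ellipse b), withDensity_const,
    uniformEllipse_eq hb0]

/-! ### The geometric assumptions for the ellipse -/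

theorem pole_mem_ellipse (b : ℝ) {s : ℝ} (hs : s ^ 2 = 1) : !₂[s, 0] ∈ ellipse b := by
  change s ^ 2 + (0 / b) ^ 2 ≤ 1
  simp [hs]

theorem assumptionA1_ellipse {b : ℝ} (hb0 : 0 < b) (hb1 : b < 1) :
    AssumptionA1 (ellipse b) 1 := by
  have hbd := (isCompact_ellipse hb0 hb1).isBounded
  have h1 : !₂[(1 : ℝ), 0] ∈ ellipse b := pole_mem_ellipse b (by norm_num)
  have h2 : !₂[(-1 : ℝ), 0] ∈ ellipse b := pole_mem_ellipse b (by norm_num)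
  refine ⟨one_pos, hbd, le_antisymm ?_ ?_, ?_, ?_⟩
  · refine Metric.diam_le_of_forall_dist_le (by norm_num) fun z hz w hw => ?_
    have := norm_le_one_of_mem_ellipse hb0 hb1 hz
    have := norm_le_one_of_mem_ellipse hb0 hb1 hw
    linarith [dist_le_norm_add_norm z w]
  · refine le_trans ?_ (Metric.dist_le_diam_of_mem hbd h1 h2)
    refine le_of_sq_le_sq ?_ dist_nonneg
    rw [dist_sq_plane]
    norm_num
  · refine IsLeast.isGLB ⟨⟨_, h2, rfl⟩, ?_⟩
    rintro _ ⟨z, hz, rfl⟩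
    exact (abs_le.1 ((sq_le_one_iff_abs_le_one _).1 (fst_sq_le_of_mem_ellipse hz))).1
  · refine IsGreatest.isLUB ⟨⟨_, h1, rfl⟩, ?_⟩
    rintro _ ⟨z, hz, rfl⟩
    exact (abs_le.1 ((sq_le_one_iff_abs_le_one _).1 (fst_sq_le_of_mem_ellipse hz))).2

theorem isOpen_axisBall (x ε : ℝ) : IsOpen (axisBall x ε) :=
  isOpen_lt (by fun_prop) continuous_const

theorem norm_lt_one_of_mem_ellipse {b : ℝ} (hb0 : 0 < b) (hb1 : b < 1) {z : Plane}
    (hz : z ∈ ellipse b) (h1 : z ≠ !₂[1, 0]) (h2 : z ≠ !₂[-1, 0]) : ‖z‖ < 1 := by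
  have hb2 : 0 < 1 - b ^ 2 := sub_pos.2 (pow_lt_one₀ hb0.le hb1 two_ne_zero)
  have hn := norm_sq_le_of_mem_ellipse hb0 hz
  rcases (fst_sq_le_of_mem_ellipse hz).lt_or_eq with h | h
  · have := mul_pos hb2 (sub_pos.2 h)
    exact lt_of_pow_lt_pow_left₀ 2 zero_le_one (by linarith)
  · exfalso
    have h3 := snd_sq_le_of_mem_ellipse hb0 hz
    rw [h, sub_self, mul_zero] at h3
    have h4 : z 1 = 0 := pow_eq_zero_iff two_ne_zero |>.1 (le_antisymm h3 (sq_nonneg _))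
    rcases sq_eq_sq_iff_eq_or_eq_neg.1 (h.trans (one_pow 2).symm) with h5 | h5
    · exact h1 (by ext i; fin_cases i <;> simp [h4, h5])
    · exact h2 (by ext i; fin_cases i <;> simp [h4, h5])

/-- After removal of the two open balls a compact set remains. The norm attains its maximum on it,
below 1 because only the poles have norm 1, and the diameter is at most twice this maximum. -/
theorem assumptionA2_ellipse {b : ℝ} (hb0 : 0 < b) (hb1 : b < 1) :
    AssumptionA2 (ellipse b) 1 := by
  intro ε hε
  have hK : IsCompact (ellipse b \ (axisBall (-1) ε ∪ axisBall 1 ε)) :=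
    (isCompact_ellipse hb0 hb1).diff ((isOpen_axisBall _ _).union (isOpen_axisBall _ _))
  rcases (ellipse b \ (axisBall (-1) ε ∪ axisBall 1 ε)).eq_empty_or_nonempty with h | h
  · rw [h, Metric.diam_empty]
    norm_num
  · obtain ⟨z, hz, hmax⟩ := hK.exists_isMaxOn h continuous_norm.continuousOn
    have hlt : ‖z‖ < 1 := by
      refine norm_lt_one_of_mem_ellipse hb0 hb1 hz.1 ?_ ?_
      · rintro rfl
        refine hz.2 (Or.inr ?_)
        simpa [axisBall] using hε
      · rintro rfl
        refine hz.2 (Or.inl ?_)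
        simpa [axisBall] using hε
    have hle : Metric.diam (ellipse b \ (axisBall (-1) ε ∪ axisBall 1 ε)) ≤ 2 * ‖z‖ := by
      refine Metric.diam_le_of_forall_dist_le (by positivity) fun v hv w hw => ?_
      have h1 : ‖v‖ ≤ ‖z‖ := hmax hv
      have h2 : ‖w‖ ≤ ‖z‖ := hmax hw
      linarith [dist_le_norm_add_norm v w]
    linarith

theorem volume_ellipse_near_pole_pos {b : ℝ} (hb0 : 0 < b) (hb1 : b < 1) {s t ε : ℝ}
    (hs : s = 1 ∨ s = -1) (ht : t = 1 ∨ t = -1) (hε : 0 < ε) :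
    0 < volume (ellipse b ∩ {z | 0 < s * z 0 ∧ 0 < t * z 1} ∩ axisBall s ε) := by
  have hs2 : s * s = 1 := by rcases hs with rfl | rfl <;> norm_num
  have ht2 : t * t = 1 := by rcases ht with rfl | rfl <;> norm_num
  have hq (c : ℝ) (i : Fin 2) : IsOpen {z : Plane | 0 < c * z i} :=
    isOpen_lt continuous_const (by fun_prop)
  have hopen : IsOpen (interior (ellipse b) ∩ {z | 0 < s * z 0 ∧ 0 < t * z 1} ∩ axisBall s ε) :=
    (isOpen_interior.inter ((hq s 0).inter (hq t 1))).inter (isOpen_axisBall _ _)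
  refine (hopen.measure_pos volume ?_).trans_le (measure_mono
    (inter_subset_inter_left _ (inter_subset_inter_left _ interior_subset)))
  obtain ⟨δ, hδ0, hδ⟩ := exists_between (lt_min (one_half_pos (α := ℝ)) (half_pos hε))
  obtain ⟨hδ1, hδ2⟩ := lt_min_iff.1 hδ
  have hδsq : δ ^ 2 ≤ δ := by
    have := mul_le_mul_of_nonneg_left (show δ ≤ 1 by linarith) hδ0.le
    linarith
  -- The quadratic form of the ellipse at this point is 1 - 2δ + 5δ²/4, which is below 1 for small
  -- positive δ.
  refine ⟨!₂[s * (1 - δ), t * (b * (δ / 2))], ⟨?_, ?_, ?_⟩, ?_⟩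
  · rw [interior_ellipse]
    change (s * (1 - δ)) ^ 2 + (t * (b * (δ / 2)) / b) ^ 2 < 1
    have : t * (b * (δ / 2)) / b = t * (δ / 2) := by field_simp
    rw [this]
    have : (s * (1 - δ)) ^ 2 + (t * (δ / 2)) ^ 2 =
        s * s * (1 - 2 * δ + δ ^ 2) + t * t * (δ ^ 2 / 4) := by ring
    rw [this, hs2, ht2]
    linarith
  · change 0 < s * (s * (1 - δ))
    rw [← mul_assoc, hs2]
    linarith
  · change 0 < t * (t * (b * (δ / 2)))
    rw [← mul_assoc, ht2]
    positivity
  · change ‖!₂[s * (1 - δ), t * (b * (δ / 2))] - !₂[s, 0]‖ < ε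
    refine lt_of_pow_lt_pow_left₀ 2 hε.le ?_
    rw [norm_sq_plane]
    simp only [PiLp.sub_apply, Matrix.cons_val_zero, Matrix.cons_val_one, sub_zero]
    have : (s * (1 - δ) - s) ^ 2 + (t * (b * (δ / 2))) ^ 2 =
        s * s * δ ^ 2 + t * t * (b ^ 2 * (δ ^ 2 / 4)) := by ring
    rw [this, hs2, ht2]
    have h1 : b ^ 2 * (δ ^ 2 / 4) ≤ 1 * (δ ^ 2 / 4) :=
      mul_le_mul_of_nonneg_right (pow_le_one₀ hb0.le hb1.le) (by positivity)
    have h2 : δ ^ 2 < (ε / 2) ^ 2 := pow_lt_pow_left₀ hδ2 hδ0.le two_ne_zero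
    linarith [sq_nonneg δ]

theorem assumptionA3_ellipse {b : ℝ} (hb0 : 0 < b) (hb1 : b < 1) :
    AssumptionA3 (ellipse b) 1 := by
  intro ε hε
  have h (s t : ℝ) (hs : s = 1 ∨ s = -1) (ht : t = 1 ∨ t = -1) :=
    volume_ellipse_near_pole_pos hb0 hb1 hs ht hε
  refine ⟨?_, ?_, ?_, ?_⟩
  · simpa [quadrantPart, quadrant] using h 1 1 (by simp) (by simp)
  · simpa [quadrantPart, quadrant] using h (-1) 1 (by simp) (by simp)
  · simpa [quadrantPart, quadrant] using h (-1) (-1) (by simp) (by simp)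
  · simpa [quadrantPart, quadrant] using h 1 (-1) (by simp) (by simp)

theorem assumptionA4_ellipse {b ν : ℝ} (hb0 : 0 < b) (hν : ν ∈ Ico (0 : ℝ) 1) :
    AssumptionA4 (ellipse b) 1 ν (ellipseBoundary b) := by
  have hnn (x : ℝ) : 0 ≤ b * √(1 - x ^ 2) := mul_nonneg hb0.le (Real.sqrt_nonneg _)
  have hnp (x : ℝ) : -(b * √(1 - x ^ 2)) ≤ 0 := neg_nonpos.2 (hnn x)
  refine ⟨hν, fun i => ?_, fun x _ => hnn x, fun x _ => hnn x, fun x _ => hnp x,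
    fun x _ => hnp x, ?_, ?_, ?_, ?_, ?_, ?_⟩
  · fin_cases i <;> simp only [ellipseBoundary] <;> fun_prop
  · simp [ellipseBoundary]
  · simp [ellipseBoundary]
  · simp [ellipseBoundary]
  · simp [ellipseBoundary]
  · ext z
    constructor
    · rintro ⟨hz, hν'⟩
      have h := (mem_interior_ellipse_iff hb0).1 hz
      have h1 := (sq_lt_one_iff_abs_lt_one _).1 (fst_sq_lt_of_mem_interior_ellipse hz)
      exact ⟨hν', (abs_lt.1 h1).2, h⟩
    · rintro ⟨h1, -, h3⟩
      exact ⟨(mem_interior_ellipse_iff hb0).2 h3, h1⟩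
  · ext z
    constructor
    · rintro ⟨hz, hν'⟩
      have h := (mem_interior_ellipse_iff hb0).1 hz
      have h1 := (sq_lt_one_iff_abs_lt_one _).1 (fst_sq_lt_of_mem_interior_ellipse hz)
      exact ⟨(abs_lt.1 h1).1, hν', h⟩
    · rintro ⟨-, h1, h3⟩
      exact ⟨(mem_interior_ellipse_iff hb0).2 h3, h1⟩

theorem assumptionA5_ellipse {b : ℝ} (hb0 : 0 < b) (hb1 : b < 1) :
    AssumptionA5 1 (ellipseBoundary b) fun _ => 2 * b := by
  have h {x : ℝ} (hx : x ∈ Ioo (-1 : ℝ) 1) : b * √(1 - x ^ 2) / refBoundary 1 x = 2 * b := by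
    have h1 : x ^ 2 < 1 := (sq_lt_one_iff_abs_lt_one _).2 (abs_lt.2 hx)
    have h2 : 0 < √(1 - x ^ 2) := Real.sqrt_pos.2 (by linarith)
    rw [refBoundary, one_pow]
    field_simp
  have hr : Tendsto (fun x => b * √(1 - x ^ 2) / refBoundary 1 x) (𝓝[<] 1) (𝓝 (2 * b)) := by
    refine tendsto_const_nhds.congr' ?_
    filter_upwards [Ioo_mem_nhdsLT (show (-1 : ℝ) < 1 by norm_num)] with x hx
    exact (h hx).symm
  have hl : Tendsto (fun x => b * √(1 - x ^ 2) / refBoundary 1 x) (𝓝[>] (-1)) (𝓝 (2 * b)) := by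
    refine tendsto_const_nhds.congr' ?_
    filter_upwards [Ioo_mem_nhdsGT (show (-1 : ℝ) < 1 by norm_num)] with x hx
    exact (h hx).symm
  refine ⟨fun _ => ⟨by linarith, by linarith⟩, hr, ?_, hl, ?_⟩
  · simpa only [ellipseBoundary, neg_neg] using hr
  · simpa only [ellipseBoundary, neg_neg] using hl

theorem frontier_disc {h : ℝ} (hh : h < 1) : frontier (disc 1 h) = {z | ‖z‖ = 1 - h} := by
  have h1 : disc 1 h = Metric.closedBall (0 : Plane) (1 - h) := by
    ext z
    rw [mem_closedBall_zero_iff]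
    rfl
  rw [h1, frontier_closedBall _ (by linarith)]
  ext z
  rw [mem_sphere_zero_iff_norm]
  rfl

/-- On the boundary of the ellipse the squared norm is affine in x² with slope 1 - b² > 0, so a
circle determines x². -/
theorem mem_frontier_disc_iff {b h x y : ℝ} (hb0 : 0 < b) (hb1 : b < 1) (hh : h < 1)
    (hy : y ^ 2 = b ^ 2 * (1 - x ^ 2)) :
    !₂[x, y] ∈ frontier (disc 1 h) ↔ x ^ 2 = ((1 - h) ^ 2 - b ^ 2) / (1 - b ^ 2) := by
  have hb2 : 0 < 1 - b ^ 2 := sub_pos.2 (pow_lt_one₀ hb0.le hb1 two_ne_zero)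
  have h1 : ‖!₂[x, y]‖ ^ 2 = x ^ 2 + y ^ 2 := norm_sq_plane _
  rw [frontier_disc hh, eq_div_iff hb2.ne']
  change ‖!₂[x, y]‖ = 1 - h ↔ _
  rw [← sq_eq_sq₀ (norm_nonneg _) (by linarith), h1, hy]
  constructor <;> intro h <;> linarith

theorem assumptionA6_ellipse {b ν : ℝ} (hb0 : 0 < b) (hb1 : b < 1) (hν : ν ∈ Ico (0 : ℝ) 1) :
    AssumptionA6 (ellipse b) 1 ν (ellipseBoundary b) := by
  have hb2 : 0 < 1 - b ^ 2 := sub_pos.2 (pow_lt_one₀ hb0.le hb1 two_ne_zero)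
  have hν2 : 0 < 1 - ν ^ 2 := sub_pos.2 (pow_lt_one₀ hν.1 hν.2 two_ne_zero)
  have hc := mul_pos hb2 hν2
  -- The bound 2h < (1 - b²)(1 - ν²) gives (1 - h)² ≥ 1 - 2h > 1 - (1 - b²)(1 - ν²). This is used
  -- both for the inclusion in the disc and for placing the crossing point beyond `ν`.
  filter_upwards [Ioo_mem_nhdsGT (lt_min one_pos (half_pos hc))] with h ⟨hh0, hh⟩ i
  obtain ⟨hh1, hh2⟩ := lt_min_iff.1 hh
  constructor
  · rintro z ⟨hz, hzν⟩
    have hz' : z ∈ ellipse b := (interior_subset hz).1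
    have h1 := norm_sq_le_of_mem_ellipse hb0 hz'
    have h2 : z 0 ^ 2 ≤ ν ^ 2 := by
      rw [← sq_abs]
      exact pow_le_pow_left₀ (abs_nonneg _) (le_of_lt hzν) 2
    have h3 : (1 - b ^ 2) * (1 - ν ^ 2) ≤ (1 - b ^ 2) * (1 - z 0 ^ 2) :=
      mul_le_mul_of_nonneg_left (by linarith) hb2.le
    change ‖z‖ ≤ 1 - h
    refine le_of_sq_le_sq ?_ (by linarith)
    linarith [sq_nonneg h]
  · set r := ((1 - h) ^ 2 - b ^ 2) / (1 - b ^ 2) with hr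
    have hr1 : r ≤ 1 := by
      rw [hr, div_le_one hb2]
      have := mul_le_mul_of_nonneg_left hh1.le hh0.le
      linarith
    have hrν : ν ^ 2 ≤ r := by
      rw [hr, le_div_iff₀ hb2]
      linarith [sq_nonneg h]
    have hr0 : 0 ≤ r := (sq_nonneg ν).trans hrν
    have hνr : ν ≤ √r := Real.le_sqrt_of_sq_le hrν
    have hr1' : √r ≤ 1 := Real.sqrt_le_one.2 hr1
    have hiff (i : Fin 4) {x : ℝ} (hx : x ^ 2 ≤ 1) :
        !₂[x, ellipseBoundary b i x] ∈ frontier (disc 1 h) ↔ x ^ 2 = r := by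
      refine mem_frontier_disc_iff hb0 hb1 hh1 ?_
      have hsq : (b * √(1 - x ^ 2)) ^ 2 = b ^ 2 * (1 - x ^ 2) := by
        rw [mul_pow, Real.sq_sqrt (by linarith)]
      fin_cases i
      · exact hsq
      · exact hsq
      · exact (neg_sq _).trans hsq
      · exact (neg_sq _).trans hsq
    have hright (i : Fin 4) : ∃! x, x ∈ Icc ν 1 ∧
        !₂[x, ellipseBoundary b i x] ∈ frontier (disc 1 h) := by
      refine ⟨√r, ⟨⟨hνr, hr1'⟩, (hiff i ?_).2 (Real.sq_sqrt hr0)⟩, ?_⟩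
      · rwa [Real.sq_sqrt hr0]
      · rintro x ⟨⟨hx1, hx2⟩, hx⟩
        have hx0 : 0 ≤ x := hν.1.trans hx1
        rw [← (hiff i (pow_le_one₀ hx0 hx2)).1 hx, Real.sqrt_sq hx0]
    have hleft (i : Fin 4) : ∃! x, x ∈ Icc (-1) (-ν) ∧
        !₂[x, ellipseBoundary b i x] ∈ frontier (disc 1 h) := by
      refine ⟨-√r, ⟨⟨by linarith, by linarith⟩, (hiff i ?_).2 ?_⟩, ?_⟩
      · rwa [neg_sq, Real.sq_sqrt hr0]
      · rw [neg_sq, Real.sq_sqrt hr0]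
      · rintro x ⟨⟨hx1, hx2⟩, hx⟩
        have hx0 : 0 ≤ -x := by linarith [hν.1]
        have hx3 : x ^ 2 ≤ 1 := by
          rw [← neg_sq]
          exact pow_le_one₀ hx0 (by linarith)
        rw [← (hiff i hx3).1 hx, ← neg_sq, Real.sqrt_sq hx0, neg_neg]
    fin_cases i
    · exact hright 0
    · exact hleft 1
    · exact hleft 2
    · exact hright 3

theorem assumptionA7_ellipse {b : ℝ} (hb0 : 0 < b) :
    AssumptionA7 (ellipse b) 1 (ellipseDensity b) fun _ => 1 / (Real.pi * b) := by
  have hpos : 0 < 1 / (Real.pi * b) := by positivity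
  have hcont (s : Set Plane) : ContinuousOn (ellipseDensity b) (ellipse b ∩ s) :=
    continuousOn_const.congr fun z hz => indicator_of_mem hz.1 _
  have h1 : ellipseDensity b !₂[1, 0] = 1 / (Real.pi * b) :=
    indicator_of_mem (pole_mem_ellipse b (by norm_num)) _
  have h2 : ellipseDensity b !₂[-1, 0] = 1 / (Real.pi * b) :=
    indicator_of_mem (pole_mem_ellipse b (by norm_num)) _
  exact ⟨.of_forall fun ε => ⟨hcont _, hcont _⟩, h1.symm, h1.symm, h1 ▸ hpos, h2.symm, h2.symm,
    h2 ▸ hpos⟩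

end LargestDistance

end

/-! ### Geometric assumptions and limit theorems combined -/

theorem corollary1 (b : ℝ) (hb0 : 0 < b) (hb1 : b < 1) :
    -- the uniform distribution in the ellipse has compact support and a density
    (IsCompact (LargestDistance.ellipse b) ∧
      volume (LargestDistance.ellipse b) = ENNReal.ofReal (Real.pi * b) ∧
      (LargestDistance.uniformEllipse b).support = LargestDistance.ellipse b ∧
      LargestDistance.uniformEllipse b =
        volume.withDensity (fun z => ENNReal.ofReal (LargestDistance.ellipseDensity b z))) ∧
    -- A1 to A6 with `a = 1` and `q_i = 2b`, for every `ν ∈ [0, 1)`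
    (LargestDistance.AssumptionA1 (LargestDistance.ellipse b) 1 ∧
      LargestDistance.AssumptionA2 (LargestDistance.ellipse b) 1 ∧
      LargestDistance.AssumptionA3 (LargestDistance.ellipse b) 1 ∧
      LargestDistance.AssumptionA5 1 (LargestDistance.ellipseBoundary b) (fun _ => 2 * b) ∧
      ∀ ν ∈ Ico (0 : ℝ) 1,
        LargestDistance.AssumptionA4 (LargestDistance.ellipse b) 1 ν
          (LargestDistance.ellipseBoundary b) ∧
        LargestDistance.AssumptionA6 (LargestDistance.ellipse b) 1 ν
          (LargestDistance.ellipseBoundary b)) ∧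
    -- A7 with `p_i = 1 / (πb)`
    LargestDistance.AssumptionA7 (LargestDistance.ellipse b) 1
      (LargestDistance.ellipseDensity b) (fun _ => 1 / (Real.pi * b)) ∧
    -- the limit theorems, with four i.i.d. random elements `Z i ∼ NA_∞(σ, τ)`
    ∀ (Ω' : Type*) [MeasurableSpace Ω'] (P' : Measure Ω') [IsProbabilityMeasure P']
      (Z : Fin 4 → Ω' → ℕ → ℝ × ℝ),
      iIndepFun Z P' →
      (∀ i, HasLaw (Z i)
        (LargestDistance.normAngleLaw
          (LargestDistance.sigmaConst 1 (2 * b) (1 / (Real.pi * b)))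
          (LargestDistance.tauConst 1 (2 * b))) P') →
      (∀ᵐ ω ∂P', LargestDistance.MinimaAttained 1 (fun i => Z i ω)) ∧
      -- Poisson processes with intensity measures `n` times the uniform distribution
      (∀ (Ω : ℕ → Type*) [∀ n, MeasurableSpace (Ω n)] (P : (n : ℕ) → Measure (Ω n))
        [∀ n, IsProbabilityMeasure (P n)] (Φ : (n : ℕ) → Ω n → Measure LargestDistance.Plane),
        (∀ n : ℕ, LargestDistance.IsPoissonProcess (Φ n)
          ((n : ℝ≥0∞) • LargestDistance.uniformEllipse b) (P n)) →
        TendstoInDistribution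
          (fun (n : ℕ) ω => (n : ℝ) ^ (2 / 3 : ℝ) * (2 - LargestDistance.supportDiam (Φ n ω)))
          atTop (fun ω => LargestDistance.limitMin 1 (fun i => Z i ω)) P P') ∧
      -- independent uniformly distributed points
      (∀ (Ω : Type*) [MeasurableSpace Ω] (P : Measure Ω) [IsProbabilityMeasure P]
        (X : ℕ → Ω → LargestDistance.Plane),
        iIndepFun X P → (∀ i, HasLaw (X i) (LargestDistance.uniformEllipse b) P) →
        TendstoInDistribution
          (fun (n : ℕ) ω => (n : ℝ) ^ (2 / 3 : ℝ) * (2 - LargestDistance.maxDist X n ω))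
          atTop (fun ω => LargestDistance.limitMin 1 (fun i => Z i ω)) (fun _ => P) P') := by
  refine ⟨⟨LargestDistance.isCompact_ellipse hb0 hb1, LargestDistance.volume_ellipse hb0,
    LargestDistance.support_uniformEllipse hb0,
    LargestDistance.uniformEllipse_eq_withDensity hb0⟩,
    ⟨LargestDistance.assumptionA1_ellipse hb0 hb1,
    LargestDistance.assumptionA2_ellipse hb0 hb1,
    LargestDistance.assumptionA3_ellipse hb0 hb1,
    LargestDistance.assumptionA5_ellipse hb0 hb1,
    fun ν hν => ⟨LargestDistance.assumptionA4_ellipse hb0 hν,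
      LargestDistance.assumptionA6_ellipse hb0 hb1 hν⟩⟩,
    LargestDistance.assumptionA7_ellipse hb0, ?_⟩
  intro Ω' _ P' _ Z hind hZ
  refine ⟨?_, fun Ω _ P _ Φ hΦ =>
      LargestDistance.tendstoInDistribution_supportDiam hb0 hb1 hind hZ hΦ,
    fun Ω _ P _ X hX hlaw =>
      LargestDistance.tendstoInDistribution_maxDist hb0 hb1 hind hZ hX hlaw⟩
  filter_upwards [LargestDistance.limit_ae hb0 hb1 hZ] with ω hω
  exact LargestDistance.minimaAttained_of_tendsto (fun i k => ((hω i).1 k).1)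
    fun i => (hω i).2
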